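/- For $x\ne0$ write $\bar x=x^{-1}$ and $\sigma(x)=x-\bar x$. Let $n\ge 0$, and let $\mathcal T_n$ be the triangular grid graph with top vertices $(0,j)$, $1\le j\le 2n+1$, and vertices $(i,j)$, $1\le i\le n+1$, $i\le j\le 2n+2-i$ ($i$ is the row, counted downwards, and $j$ the column). Its edges are the vertical edges joining $(i-1,j)$ to $(i,j)$ for $1\le i\le n+1$, $i\le j\le 2n+2-i$, and the horizontal edges joining $(i,j)$ to $(i,j+1)$ for $1\le i\le n$, $i\le j\le 2n+1-i$. A configuration of the six-vertex model on $\mathcal T_n$ is an orientation of the edges such that every edge incident to a top vertex is directed upwards and, at each bulk vertex $(i,j)$ ($1\le i\le n$, $i+1\le j\le 2n+1-i$), two of the four incident edges are directed in and two are directed out. For a configuration $C$ and parameters $q$ and $u$, define local weights as follows. - Bulk vertex: $W(C_{ij},u)=1$ if the left and right edges are both directed in or both directed out; $W(C_{ij},u)=\sigma(q^2u)/\sigma(q^4)$ if the left and bottom edges are both in or both out; $W(C_{ij},u)=\sigma(q^2\bar u)/\sigma(q^4)$ if the left and top edges are both in or both out. (Exactly one of these cases occurs.) - Left boundary vertex $(i,i)$,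 $1\le i\le n$, incident to a top and a right edge: $W(C_{ii},u)=\sigma(qu)/\sigma(q)$ if these two edges are both in or both out, and $W(C_{ii},u)=1$ otherwise. - Right boundary vertex $(i,2n+2-i)$, $1\le i\le n$, incident to a top and a left edge: $W(C_{i,2n+2-i},u)=\sigma(q\bar u)/\sigma(q)$ if these two edges are both in or both out, and $W(C_{i,2n+2-i},u)=1$ otherwise. The odd-order DASASM partition function is $$Z(u_1,\ldots,u_{n+1})=\sum_{C}\prod_{i=1}^n W(C_{ii},u_i)\Biggl(\prod_{j=i+1}^{2n+1-i}W\bigl(C_{ij},u_i\,u_{\min(j,2n+2-j)}\bigr)\Biggr)W(C_{i,2n+2-i},u_i),$$ the sum being over all configurations $C$ of the six-vertex model on $\mathcal T_n$. **Theorem.** Let $q,u_1,\ldots,u_{n+1}$ be nonzero complex numbers such that no denominator below vanishes, that is, $\sigma(q^4)\ne0$; $u_i^2\ne1$ for $1\le i\le n+1$; $\sigma(u_i\bar u_j)\neq0$ for $1\le i<j\le n+1$; and $\sigma(q^2u_iu_j)\ne0$, $\sigma(q^2\bar u_i\bar u_j)\ne0$ for $1\le i\le n$, $1\le j\le n+1$.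 Then $$\begin{aligned}Z(u_1,\ldots,u_{n+1})={}&\frac{\sigma(q^2)^n}{\sigma(q)^{2n}\,\sigma(q^4)^{n^2}} \prod_{i=1}^n\frac{\sigma(u_i)\,\sigma(qu_i)\,\sigma(q\bar u_i)\,\sigma(q^2u_iu_{n+1})\,\sigma(q^2\bar u_i\bar u_{n+1})}{\sigma(u_i\bar u_{n+1})} \prod_{1\le i<j\le n}\biggl(\frac{\sigma(q^2u_iu_j)\,\sigma(q^2\bar u_i\bar u_j)}{\sigma(u_i\bar u_j)}\biggr)^2\\ &\times\left(\det_{1\le i,j\le n+1}\left(\begin{cases}\dfrac{q^2+\bar q^2+u_i^2+\bar u_j^2}{\sigma(q^2u_iu_j)\,\sigma(q^2\bar u_i\bar u_j)},&i\le n\\[2mm] \dfrac{u_{n+1}-1}{u_j^2-1},&i=n+1\end{cases}\right)+ \det_{1\le i,j\le n+1}\left(\begin{cases}\dfrac{q^2+\bar q^2+\bar u_i^2+u_j^2}{\sigma(q^2u_iu_j)\,\sigma(q^2\bar u_i\bar u_j)},&i\le n\\[2mm] \dfrac{\bar u_{n+1}-1}{\bar u_j^2-1},&i=n+1\end{cases}\right)\right).\end{aligned}$$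 -/

import Mathlib

namespace DASASM

/-- `σ(x) = x - x⁻¹`. -/
noncomputable def σ (x : ℂ) : ℂ := x - x⁻¹

/-!
### The grid graph on a triangle

The vertices of `T_n` are the top vertices `(0, j)` with `1 ≤ j ≤ 2n+1`, and the vertices `(i, j)`
with `1 ≤ i ≤ n+1` and `i ≤ j ≤ 2n+2-i`, where `i` is the row (counted downwards) and `j` the column.
-/

/-- The vertical edges of `T_n`. The edge joining `(i-1, j)` to `(i, j)` is named by its lower
endpoint `(i, j)`. -/
def vEdges (n : ℕ) : Finset (ℕ × ℕ) :=
  (Finset.Icc 1 (n + 1) ×ˢ Finset.Icc 1 (2 * n + 1)).filter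
    fun e => e.1 ≤ e.2 ∧ e.1 + e.2 ≤ 2 * n + 2

/-- The horizontal edges of `T_n`. The edge joining `(i, j)` to `(i, j+1)` is named by its left
endpoint `(i, j)`. -/
def hEdges (n : ℕ) : Finset (ℕ × ℕ) :=
  (Finset.Icc 1 n ×ˢ Finset.Icc 1 (2 * n + 1)).filter
    fun e => e.1 ≤ e.2 ∧ e.1 + e.2 ≤ 2 * n + 1

/-- Data of an orientation: `C.1` is the set of the vertical edges which are directed upwards (all
other vertical edges are directed downwards), and `C.2` is the set of the horizontal edges which are
directed rightwards (all other horizontal edges are directed leftwards). -/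
abbrev Orientation : Type := Finset (ℕ × ℕ) × Finset (ℕ × ℕ)

/-- All orientations of the edges of `T_n`. -/
def orientations (n : ℕ) : Finset Orientation := (vEdges n).powerset ×ˢ (hEdges n).powerset

/-- Whether the edge to the left of the vertex `(i, j)` is directed into that vertex. -/
def leftIn (C : Orientation) (i j : ℕ) : Bool := decide ((i, j - 1) ∈ C.2)

/-- Whether the edge below the vertex `(i, j)` is directed into that vertex. -/
def bottomIn (C : Orientation) (i j : ℕ) : Bool := decide ((i + 1, j) ∈ C.1)

/-- Whether the edge to the right of the vertex `(i, j)` is directed into that vertex. -/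
def rightIn (C : Orientation) (i j : ℕ) : Bool := decide ((i, j) ∉ C.2)

/-- Whether the edge above the vertex `(i, j)` is directed into that vertex. -/
def topIn (C : Orientation) (i j : ℕ) : Bool := decide ((i, j) ∉ C.1)

/-- The six-vertex rule for the four edges at the vertex `(i, j)`: two of them are directed into the
vertex and two are directed out of it. -/
def SixVertexRule (C : Orientation) (i j : ℕ) : Prop :=
  (leftIn C i j).toNat + (bottomIn C i j).toNat + (rightIn C i j).toNat + (topIn C i j).toNat = 2

instance (C : Orientation) (i j : ℕ) : Decidable (SixVertexRule C i j) :=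
  inferInstanceAs (Decidable (_ = _))

/-- The conditions on a configuration of the six-vertex model on `T_n`: each top edge is directed
upwards, and the six-vertex rule holds at each bulk vertex `(i, j)`, where `1 ≤ i ≤ n` and
`i+1 ≤ j ≤ 2n+1-i`. -/
def IsConfiguration (n : ℕ) (C : Orientation) : Prop :=
  (∀ j ∈ Finset.Icc 1 (2 * n + 1), (1, j) ∈ C.1) ∧
  (∀ i ∈ Finset.Icc 1 n, ∀ j ∈ Finset.Icc (i + 1) (2 * n + 1 - i), SixVertexRule C i j)

instance (n : ℕ) : DecidablePred (IsConfiguration n) := fun C =>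
  inferInstanceAs (Decidable ((∀ j ∈ Finset.Icc 1 (2 * n + 1), (1, j) ∈ C.1) ∧
    (∀ i ∈ Finset.Icc 1 n, ∀ j ∈ Finset.Icc (i + 1) (2 * n + 1 - i), SixVertexRule C i j)))

/-- The configurations of the six-vertex model on `T_n`. -/
def configurations (n : ℕ) : Finset Orientation := (orientations n).filter (IsConfiguration n)

/-- The bulk weights. Under the six-vertex rule, exactly one of the three pairs of edges
`{left, right}`, `{left, bottom}`, `{left, top}` consists of two edges which are both directed in or
both directed out; these are the three rows of the table of bulk weights. -/
noncomputable def bulkWeight (q u : ℂ) (left bottom right top : Bool) : ℂ :=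
  if left = right then 1
  else if left = bottom then σ (q ^ 2 * u) / σ (q ^ 4)
  else if left = top then σ (q ^ 2 * u⁻¹) / σ (q ^ 4)
  else 0

/-- The left boundary weights: `1` if one of the two edges is directed in and the other is directed
out, and `σ(q u)/σ(q)` if both are directed in or both are directed out. -/
noncomputable def leftWeight (q u : ℂ) (right top : Bool) : ℂ :=
  if right = top then σ (q * u) / σ q else 1

/-- The right boundary weights: `1` if one of the two edges is directed in and the other is directed
out, and `σ(q u⁻¹)/σ(q)` if both are directed in or both are directed out. -/
noncomputable def rightWeight (q u : ℂ) (left top : Bool) : ℂ :=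
  if left = top then σ (q * u⁻¹) / σ q else 1

/-- The odd-order DASASM partition function `Z(u_1, …, u_{n+1})`. The parameter `u_k` is `u k`; only
the values `u 1, …, u (n+1)` are used. -/
noncomputable def Z (n : ℕ) (q : ℂ) (u : ℕ → ℂ) : ℂ :=
  ∑ C ∈ configurations n, ∏ i ∈ Finset.Icc 1 n,
    leftWeight q (u i) (rightIn C i i) (topIn C i i) *
    (∏ j ∈ Finset.Icc (i + 1) (2 * n + 1 - i),
      bulkWeight q (u i * u (min j (2 * n + 2 - j)))
        (leftIn C i j) (bottomIn C i j) (rightIn C i j) (topIn C i j)) *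
    rightWeight q (u i) (leftIn C i (2 * n + 2 - i)) (topIn C i (2 * n + 2 - i))

end DASASM

/-!
The partition function is a scattering amplitude. Row `i` of the triangle, together with the two
columns that end in it, is one line, which enters at the top on the left, is reflected at the left
boundary vertex, follows the row, is reflected at the right boundary vertex and leaves at the top on
the right; the central column is one more line, with parameter `u_{n+1}`. A configuration assigns a
spin to each edge, and summing over the spins amounts to composing operators `crossing` and `wall`
on functions of the spins (`Z_eq_amplitude`). These operators satisfy the Yang–Baxter equation
(`yang_baxter`) and the reflection equation (`reflection_equation`), and they have the following
consequences.

* The amplitude is symmetric in `u_1, …, u_n` (`amplitude_swapParam`) and even in each of them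
  (`amplitude_neg`).
* If `u_1 u_{n+1} = q²`, the top row and the central column just exchange their spins where they
  cross. The row can then be removed, and the partition function reduces to an explicit factor times
  the one of order `n - 1` with parameters `u_2, …, u_n, u_1` (`amplitude_reduction`).

In addition, reflection in the central column inverts all parameters (`Z_inv`).

The determinant formula is proved for generic parameters by induction on `n` and interpolation in
`w = u_{n+1}`. After multiplication by `w^{2n} (w + 1) ∏ᵢ σ(uᵢ w⁻¹)`, the difference of its two
sides is a polynomial in `w` of degree at most `4n + 1` (`isPoly_defect`), the `defect`. It has `4n + 2`
zeros (`defect_eq_zero`).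

* At `w = ±u_k`, one factor `σ(u_k w⁻¹)` vanishes, and each determinant has two equal columns.
* At `u_1 w = q²`, the last columns of the determinants, once cleared of denominators, are multiples
  of a unit vector, so the right-hand side satisfies the same recursion as the partition function.
  Parity and symmetry carry this zero to all `w` with `(u_k w)² = q⁴`.
* Inversion of the parameters gives the zeros with `(u_1 w)² = q⁻⁴`.

Finally, all admissible parameters are limits of generic ones along `u_j t^j` as `t → 1`, and both
sides are continuous there (`Z_eq_determinantFormula`).
-/

namespace DASASM

/-! ### Operators on spins -/

section

/-- A spin on each line. Lines are labelled by `ℕ`; `true` means that the edge under consideration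
is directed along the direction in which the line is travelled, `false` that it is directed against
it. -/
abbrev Spins : Type := ℕ → Bool

/-- Operators on states. A state is a function of the spins of the lines at a cut through the
lattice, and an operator propagates it from one cut to a later one; in a product `X * Y`, the lines
traverse `Y` before `X`. -/
abbrev Op : Type := Module.End ℂ (Spins → ℂ)

/-- The bulk weight `σ(q²u)/σ(q⁴)`. -/
noncomputable def wt (q u : ℂ) : ℂ := σ (q ^ 2 * u) / σ (q ^ 4)

/-- The weight `σ(q x⁻¹)/σ(q)` of a reversal of the spin at a boundary vertex. -/
noncomputable def refl (q x : ℂ) : ℂ := σ (q * x⁻¹) / σ q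

/-- The crossing of the lines `i` and `j` at a bulk vertex. Equal spins are kept, with weight `wt q
u`; opposite spins are kept with weight `wt q u⁻¹` and exchanged with weight `1`. -/
noncomputable def crossing (q : ℂ) (i j : ℕ) (u : ℂ) : Op where
  toFun f s := if s i = s j then wt q u * f s else wt q u⁻¹ * f s + f (s ∘ Equiv.swap i j)
  map_add' f g := by ext s; simp only [Pi.add_apply]; split_ifs <;> ring
  map_smul' c f := by
    ext s; simp only [Pi.smul_apply, smul_eq_mul, RingHom.id_apply]; split_ifs <;> ring

/-- The reflection of the line `i` at a boundary vertex: the spin is kept with weight `1` and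
reversed with weight `refl q x`. -/
noncomputable def wall (q : ℂ) (i : ℕ) (x : ℂ) : Op where
  toFun f s := f s + refl q x * f (Function.update s i (!s i))
  map_add' f g := by ext s; simp only [Pi.add_apply]; ring
  map_smul' c f := by
    ext s; simp only [Pi.smul_apply, smul_eq_mul, RingHom.id_apply]; ring

/-- The exchange of the spins of the lines `i` and `j`. -/
noncomputable def exchange (i j : ℕ) : Op where
  toFun f s := f (s ∘ Equiv.swap i j)
  map_add' _ _ := rfl
  map_smul' _ _ := rfl

variable {q : ℂ} {i j k l : ℕ}

theorem σ_pow_four (hq : q ≠ 0) : σ (q ^ 4) = (q ^ 8 - 1) / q ^ 4 := by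
  unfold σ; field_simp

theorem wt_eq (hq : q ≠ 0) {u : ℂ} (hu : u ≠ 0) :
    wt q u = q ^ 2 * (q ^ 4 * u ^ 2 - 1) / (u * (q ^ 8 - 1)) := by
  rw [wt, σ_pow_four hq, σ]
  field_simp

theorem pow_eight_sub_one_ne_zero (hq : q ≠ 0) (hq4 : σ (q ^ 4) ≠ 0) : q ^ 8 - 1 ≠ 0 := by
  rw [σ_pow_four hq] at hq4
  exact fun h => hq4 (by rw [h, zero_div])

theorem crossing_apply (q : ℂ) (i j : ℕ) (u : ℂ) (f : Spins → ℂ) (s : Spins) :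
    crossing q i j u f s =
      if s i = s j then wt q u * f s else wt q u⁻¹ * f s + f (s ∘ Equiv.swap i j) := rfl

theorem wall_apply (q : ℂ) (i : ℕ) (x : ℂ) (f : Spins → ℂ) (s : Spins) :
    wall q i x f s = f s + refl q x * f (Function.update s i (!s i)) := rfl

theorem exchange_apply (i j : ℕ) (f : Spins → ℂ) (s : Spins) :
    exchange i j f s = f (s ∘ Equiv.swap i j) := rfl

theorem crossing_symm (q : ℂ) (i j : ℕ) (u : ℂ) : crossing q i j u = crossing q j i u := by
  ext f s
  simp only [crossing_apply, Equiv.swap_comm i j, eq_comm (a := s i)]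

theorem comp_swap_apply_of_ne (s : Spins) (hi : k ≠ i) (hj : k ≠ j) :
    (s ∘ Equiv.swap i j) k = s k := by
  simp [Equiv.swap_apply_of_ne_of_ne hi hj]

theorem crossing_commute (hik : i ≠ k) (hil : i ≠ l) (hjk : j ≠ k) (hjl : j ≠ l) (u v : ℂ) :
    Commute (crossing q i j u) (crossing q k l v) := by
  have hs : ∀ s : Spins, (s ∘ Equiv.swap i j) ∘ Equiv.swap k l =
      (s ∘ Equiv.swap k l) ∘ Equiv.swap i j := by
    intro s
    ext m
    simp only [Function.comp_apply, Equiv.swap_apply_def]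
    split_ifs <;> simp_all
  ext f s
  simp only [Module.End.mul_apply, crossing_apply, hs, comp_swap_apply_of_ne s hik hil,
    comp_swap_apply_of_ne s hjk hjl, comp_swap_apply_of_ne s hik.symm hjk.symm,
    comp_swap_apply_of_ne s hil.symm hjl.symm]
  split_ifs <;> ring

theorem crossing_wall_commute (hik : i ≠ k) (hjk : j ≠ k) (u x : ℂ) :
    Commute (crossing q i j u) (wall q k x) := by
  have hs : ∀ (s : Spins) (b : Bool), (Function.update s k b) ∘ Equiv.swap i j =
      Function.update (s ∘ Equiv.swap i j) k b := by
    intro s b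
    ext m
    simp only [Function.comp_apply, Function.update_apply, Equiv.swap_apply_def]
    split_ifs <;> simp_all
  ext f s
  simp only [Module.End.mul_apply, crossing_apply, wall_apply, hs, comp_swap_apply_of_ne s hik.symm
    hjk.symm, Function.update_of_ne hik, Function.update_of_ne hjk]
  split_ifs <;> ring

theorem wall_commute (hij : i ≠ j) (x y : ℂ) : Commute (wall q i x) (wall q j y) := by
  ext f s
  simp only [Module.End.mul_apply, wall_apply, Function.update_of_ne hij,
    Function.update_of_ne hij.symm, Function.update_comm hij]
  ring

/-! ### The Yang–Baxter equation -/

/-- The spins `s` with the spins of the lines `i`, `j`, `k` replaced by `a`, `b`, `c`. -/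
def spins₃ (s : Spins) (i j k : ℕ) (a b c : Bool) : Spins :=
  Function.update (Function.update (Function.update s i a) j b) k c

theorem spins₃_self (s : Spins) (i j k : ℕ) : spins₃ s i j k (s i) (s j) (s k) = s := by
  simp [spins₃]

theorem crossing_spins₃ (hij : i ≠ j) (hik : i ≠ k) (hjk : j ≠ k) (u : ℂ)
    (f : Spins → ℂ) (s : Spins) (a b c : Bool) :
    crossing q i j u f (spins₃ s i j k a b c) = (if a = b then wt q u * f (spins₃ s i j k a b c)
      else wt q u⁻¹ * f (spins₃ s i j k a b c) + f (spins₃ s i j k b a c)) ∧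
    crossing q i k u f (spins₃ s i j k a b c) = (if a = c then wt q u * f (spins₃ s i j k a b c)
      else wt q u⁻¹ * f (spins₃ s i j k a b c) + f (spins₃ s i j k c b a)) ∧
    crossing q j k u f (spins₃ s i j k a b c) = (if b = c then wt q u * f (spins₃ s i j k a b c)
      else wt q u⁻¹ * f (spins₃ s i j k a b c) + f (spins₃ s i j k a c b)) := by
  have h1 : spins₃ s i j k a b c i = a := by simp [spins₃, hij, hik]
  have h2 : spins₃ s i j k a b c j = b := by simp [spins₃, hjk]
  have h3 : spins₃ s i j k a b c k = c := by simp [spins₃]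
  have e1 : spins₃ s i j k a b c ∘ Equiv.swap i j = spins₃ s i j k b a c := by
    ext m
    simp only [spins₃, Function.comp_apply, Function.update_apply, Equiv.swap_apply_def]
    split_ifs <;> simp_all
  have e2 : spins₃ s i j k a b c ∘ Equiv.swap i k = spins₃ s i j k c b a := by
    ext m
    simp only [spins₃, Function.comp_apply, Function.update_apply, Equiv.swap_apply_def]
    split_ifs <;> simp_all
  have e3 : spins₃ s i j k a b c ∘ Equiv.swap j k = spins₃ s i j k a c b := by
    ext m
    simp only [spins₃, Function.comp_apply, Function.update_apply, Equiv.swap_apply_def]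
    split_ifs <;> simp_all
  simp only [crossing_apply, h1, h2, h3, e1, e2, e3, and_self]

/-- The Yang–Baxter equation. In terms of the spins of the three lines it is a finite list of
identities between rational functions of `q`, `a` and `c`. -/
theorem yang_baxter (hq : q ≠ 0) (hq4 : σ (q ^ 4) ≠ 0) (hij : i ≠ j) (hik : i ≠ k) (hjk : j ≠ k)
    {a b c : ℂ} (ha : a ≠ 0) (hc : c ≠ 0) (h : b * q ^ 2 = a * c) :
    crossing q i j a * crossing q i k b * crossing q j k c =
      crossing q j k c * crossing q i k b * crossing q i j a := by
  ext f s
  rw [← spins₃_self s i j k]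
  have hb : b = a * c * q⁻¹ ^ 2 := by rw [← h]; field_simp
  subst hb
  -- In each of the eight cases only rational functions of `q`, `a`, `c` and values of `f` remain.
  generalize s i = x
  generalize s j = y
  generalize s k = z
  have H := fun u f a b c => (crossing_spins₃ (q := q) hij hik hjk u f s a b c).1
  have H1 := fun u f a b c => (crossing_spins₃ (q := q) hij hik hjk u f s a b c).2.1
  have H2 := fun u f a b c => (crossing_spins₃ (q := q) hij hik hjk u f s a b c).2.2
  simp only [Module.End.mul_apply, H, H1, H2]
  generalize spins₃ s i j k = g
  cases x <;> cases y <;> cases z <;>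
    simp only [if_true, if_false, Bool.false_eq_true, Bool.true_eq_false]
  all_goals
    have h8 := pow_eight_sub_one_ne_zero hq hq4
    have hai : a⁻¹ ≠ 0 := inv_ne_zero ha
    have hci : c⁻¹ ≠ 0 := inv_ne_zero hc
    have hb : a * c * q⁻¹ ^ 2 ≠ 0 := by positivity
    simp only [wt_eq hq hb, wt_eq hq (inv_ne_zero hb), wt_eq hq ha, wt_eq hq hai, wt_eq hq hc,
      wt_eq hq hci]
    field_simp
    try ring

/-! ### The reflection equation -/

/-- The spins `s` with the spins of the lines `i`, `j` replaced by `a`, `b`. -/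
def spins₂ (s : Spins) (i j : ℕ) (a b : Bool) : Spins :=
  Function.update (Function.update s i a) j b

theorem spins₂_self (s : Spins) (i j : ℕ) : spins₂ s i j (s i) (s j) = s := by
  simp [spins₂]

theorem crossing_spins₂ (hij : i ≠ j) (u : ℂ) (f : Spins → ℂ) (s : Spins) (a b : Bool) :
    crossing q i j u f (spins₂ s i j a b) = (if a = b then wt q u * f (spins₂ s i j a b)
      else wt q u⁻¹ * f (spins₂ s i j a b) + f (spins₂ s i j b a)) := by
  have h1 : spins₂ s i j a b i = a := by simp [spins₂, hij]
  have h2 : spins₂ s i j a b j = b := by simp [spins₂]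
  have e1 : spins₂ s i j a b ∘ Equiv.swap i j = spins₂ s i j b a := by
    ext m
    simp only [spins₂, Function.comp_apply, Function.update_apply, Equiv.swap_apply_def]
    split_ifs <;> simp_all
  simp only [crossing_apply, h1, h2, e1]

theorem wall_spins₂ (hij : i ≠ j) (x : ℂ) (f : Spins → ℂ) (s : Spins) (a b : Bool) :
    wall q i x f (spins₂ s i j a b) =
      f (spins₂ s i j a b) + refl q x * f (spins₂ s i j (!a) b) ∧
    wall q j x f (spins₂ s i j a b) =
      f (spins₂ s i j a b) + refl q x * f (spins₂ s i j a (!b)) := by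
  have h1 : spins₂ s i j a b i = a := by simp [spins₂, hij]
  have h2 : spins₂ s i j a b j = b := by simp [spins₂]
  rw [wall_apply, wall_apply, h1, h2]
  simp only [spins₂, Function.update_idem, Function.update_comm hij, and_true]

theorem σ_eq {x : ℂ} (hx : x ≠ 0) : σ x = (x ^ 2 - 1) / x := by
  unfold σ; field_simp

theorem refl_eq (hq : q ≠ 0) {x : ℂ} (hx : x ≠ 0) :
    refl q x = (q ^ 2 - x ^ 2) / (x * (q ^ 2 - 1)) := by
  rw [refl, σ_eq hq, σ_eq (mul_ne_zero hq (inv_ne_zero hx))]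
  field_simp

theorem pow_two_sub_one_ne_zero (hq : q ≠ 0) (hq4 : σ (q ^ 4) ≠ 0) : q ^ 2 - 1 ≠ 0 := by
  intro h
  apply pow_eight_sub_one_ne_zero hq hq4
  linear_combination (q ^ 6 + q ^ 4 + q ^ 2 + 1) * h

/-- The reflection equation, for two lines which cross each other and are reflected at the same
wall. -/
theorem reflection_equation (hq : q ≠ 0) (hq4 : σ (q ^ 4) ≠ 0) (hij : i ≠ j) {x y z : ℂ}
    (hx : x ≠ 0) (hy : y ≠ 0) (h : z * x = q ^ 2 * y) :
    wall q i x * crossing q i j (x * y) * wall q j y * crossing q i j z =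
      crossing q i j z * wall q j y * crossing q i j (x * y) * wall q i x := by
  ext f s
  rw [← spins₂_self s i j]
  have hz : z = q ^ 2 * y * x⁻¹ := by rw [← h]; field_simp
  subst hz
  generalize s i = a
  generalize s j = b
  have H := fun u f a b => (crossing_spins₂ (q := q) hij u f s a b)
  have H1 := fun x f a b => (wall_spins₂ (q := q) hij x f s a b).1
  have H2 := fun x f a b => (wall_spins₂ (q := q) hij x f s a b).2
  simp only [Module.End.mul_apply, H, H1, H2]
  generalize spins₂ s i j = g
  have h8 := pow_eight_sub_one_ne_zero hq hq4
  have h2 := pow_two_sub_one_ne_zero hq hq4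
  have hxy : x * y ≠ 0 := mul_ne_zero hx hy
  have hz : q ^ 2 * y * x⁻¹ ≠ 0 := by positivity
  cases a <;> cases b <;>
    simp only [if_true, if_false, Bool.false_eq_true, Bool.true_eq_false, Bool.not_true,
      Bool.not_false, wt_eq hq hxy, wt_eq hq (inv_ne_zero hxy), wt_eq hq hz,
      wt_eq hq (inv_ne_zero hz), refl_eq hq hx, refl_eq hq hy]
  all_goals
    field_simp
    ring

/-! ### Braids -/

/-- The crossing of two neighbouring lines followed by the exchange of their labels. Pulled through
the lattice, this operator interchanges the parameters of the two lines. -/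
noncomputable def braid (q : ℂ) (i j : ℕ) (z : ℂ) : Op := exchange i j * crossing q i j z

theorem exchange_crossing (hik : i ≠ k) (hjk : j ≠ k) (u : ℂ) :
    exchange i j * crossing q i k u = crossing q j k u * exchange i j := by
  have hs : ∀ s : Spins, (s ∘ Equiv.swap i j) ∘ Equiv.swap i k =
      (s ∘ Equiv.swap j k) ∘ Equiv.swap i j := by
    intro s
    ext m
    simp only [Function.comp_apply, Equiv.swap_apply_def]
    split_ifs <;> simp_all
  ext f s
  simp only [Module.End.mul_apply, crossing_apply, exchange_apply, hs]
  simp only [Function.comp_apply, Equiv.swap_apply_left,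
    Equiv.swap_apply_of_ne_of_ne hik.symm hjk.symm]

theorem exchange_crossing_self (u : ℂ) :
    exchange i j * crossing q i j u = crossing q i j u * exchange i j := by
  ext f s
  simp only [Module.End.mul_apply, crossing_apply, exchange_apply, Function.comp_apply,
    Equiv.swap_apply_left, Equiv.swap_apply_right, eq_comm]

theorem exchange_wall (x : ℂ) : exchange i j * wall q i x = wall q j x * exchange i j := by
  ext f s
  simp only [Module.End.mul_apply, wall_apply, exchange_apply, Function.comp_apply,
    Equiv.swap_apply_left]
  congr 3
  ext m
  simp only [Function.comp_apply, Function.update_apply, Equiv.swap_apply_def]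
  split_ifs <;> simp_all

theorem exchange_comm (i j : ℕ) : exchange i j = exchange j i := by
  ext f s
  simp only [exchange_apply, Equiv.swap_comm i j]

theorem exchange_commute (hik : i ≠ k) (hil : i ≠ l) (hjk : j ≠ k) (hjl : j ≠ l) (u : ℂ) :
    Commute (exchange i j) (crossing q k l u) := by
  have hs : ∀ s : Spins, (s ∘ Equiv.swap i j) ∘ Equiv.swap k l =
      (s ∘ Equiv.swap k l) ∘ Equiv.swap i j := by
    intro s
    ext m
    simp only [Function.comp_apply, Equiv.swap_apply_def]
    split_ifs <;> simp_all
  ext f s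
  simp only [Module.End.mul_apply, crossing_apply, exchange_apply, hs,
    comp_swap_apply_of_ne s hik.symm hjk.symm, comp_swap_apply_of_ne s hil.symm hjl.symm]

theorem exchange_wall_commute (hik : i ≠ k) (hjk : j ≠ k) (x : ℂ) :
    Commute (exchange i j) (wall q k x) := by
  ext f s
  simp only [Module.End.mul_apply, wall_apply, exchange_apply,
    comp_swap_apply_of_ne s hik.symm hjk.symm]
  congr 3
  ext m
  simp only [Function.comp_apply, Function.update_apply, Equiv.swap_apply_def]
  split_ifs <;> simp_all

theorem braid_commute (hik : i ≠ k) (hil : i ≠ l) (hjk : j ≠ k) (hjl : j ≠ l) (z u : ℂ) :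
    Commute (braid q i j z) (crossing q k l u) :=
  (exchange_commute hik hil hjk hjl u).mul_left (crossing_commute hik hil hjk hjl z u)

theorem braid_wall_commute (hik : i ≠ k) (hjk : j ≠ k) (z x : ℂ) :
    Commute (braid q i j z) (wall q k x) :=
  (exchange_wall_commute hik hjk x).mul_left (crossing_wall_commute hik hjk z x)

theorem braid_symm (q : ℂ) (i j : ℕ) (z : ℂ) : braid q i j z = braid q j i z := by
  rw [braid, braid, exchange_comm, crossing_symm]

theorem braid_crossing (hq : q ≠ 0) (hq4 : σ (q ^ 4) ≠ 0) (hij : i ≠ j) (hik : i ≠ k)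
    (hjk : j ≠ k) {z a b : ℂ} (hz : z ≠ 0) (hb : b ≠ 0) (h : a * q ^ 2 = z * b) :
    braid q i j z * (crossing q i k a * crossing q j k b) =
      crossing q i k b * crossing q j k a * braid q i j z := by
  have h1 := yang_baxter (q := q) hq hq4 hij hik hjk hz hb h
  have h2 : exchange i j * crossing q j k b = crossing q i k b * exchange i j := by
    rw [exchange_comm]; exact exchange_crossing hjk hik b
  calc _ = exchange i j * (crossing q i j z * crossing q i k a * crossing q j k b) := by
        simp only [braid, mul_assoc]
    _ = (exchange i j * crossing q j k b) * crossing q i k a * crossing q i j z := by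
        rw [h1]; simp only [mul_assoc]
    _ = crossing q i k b * (exchange i j * crossing q i k a) * crossing q i j z := by
        rw [h2]; simp only [mul_assoc]
    _ = _ := by
        rw [exchange_crossing hik hjk]; simp only [braid, mul_assoc]

theorem braid_wall (hq : q ≠ 0) (hq4 : σ (q ^ 4) ≠ 0) (hij : i ≠ j) {x y z : ℂ}
    (hx : x ≠ 0) (hy : y ≠ 0) (h : z * x = q ^ 2 * y) :
    braid q i j z * (wall q i y * crossing q i j (x * y) * wall q j x) =
      wall q i x * crossing q i j (x * y) * wall q j y * braid q i j z := by
  have h1 := reflection_equation (q := q) hq hq4 hij.symm hx hy h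
  simp only [crossing_symm q j i] at h1
  calc _ = exchange i j * (crossing q i j z * wall q i y * crossing q i j (x * y) *
          wall q j x) := by simp only [braid, mul_assoc]
    _ = (exchange i j * wall q j x) * crossing q i j (x * y) * wall q i y * crossing q i j z := by
        rw [← h1]; simp only [mul_assoc]
    _ = wall q i x * (exchange i j * crossing q i j (x * y)) * wall q i y * crossing q i j z := by
        rw [exchange_comm, exchange_wall, exchange_comm]; simp only [mul_assoc]
    _ = wall q i x * crossing q i j (x * y) * (exchange i j * wall q i y) * crossing q i j z := by
        rw [exchange_crossing_self]; simp only [mul_assoc]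
    _ = _ := by
        rw [exchange_wall]; simp only [braid, mul_assoc]

end

/-! ### The lattice -/

section

variable {q : ℂ}

/-- The crossings of the line `m` with the lines `0, …, k`, in this order. -/
noncomputable def sweepOut (q : ℂ) (y : ℕ → ℂ) (m : ℕ) : ℕ → Op
  | 0 => crossing q m 0 (y m * y 0)
  | k + 1 => crossing q m (k + 1) (y m * y (k + 1)) * sweepOut q y m k

/-- The crossings of the line `m` with the lines `k, …, 1`, in this order. -/
noncomputable def sweepIn (q : ℂ) (y : ℕ → ℂ) (m : ℕ) : ℕ → Op
  | 0 => 1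
  | k + 1 => sweepIn q y m k * crossing q m (k + 1) (y m * y (k + 1))⁻¹

/-- The lattice formed by the lines `0, …, m`, where `y k` is the parameter of the line `k`. The
line `m` is reflected at the left wall, crosses the columns of the lines `m - 1, …, 0` on the left
and in the centre and those of `1, …, m - 1` on the right, and is reflected at the right wall; the
lattice of the lines `0, …, m - 1` lies below its row. The crossing with the line `0` counts as
outgoing. -/
noncomputable def scattering (q : ℂ) (y : ℕ → ℂ) : ℕ → Op
  | 0 => 1
  | m + 1 => wall q (m + 1) (y (m + 1)) * sweepOut q y (m + 1) m * scattering q y m *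
      (sweepIn q y (m + 1) m * wall q (m + 1) (y (m + 1))⁻¹)

open Classical in
/-- The state in which the lines `1, …, n` enter with spin `false` and the line `0` with a free
spin. -/
noncomputable def incoming (n : ℕ) (s : Spins) : ℂ :=
  if ∀ k ∈ Finset.Icc 1 n, s k = false then 1 else 0

/-- The matrix element of the scattering between the incoming state and the state in which all lines
leave with spin `true`. -/
noncomputable def amplitude (q : ℂ) (n : ℕ) (y : ℕ → ℂ) : ℂ :=
  scattering q y n (incoming n) fun _ => true

theorem commute_sweepOut {X : Op} {y : ℕ → ℂ} {m k : ℕ}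
    (h : ∀ j ≤ k, Commute X (crossing q m j (y m * y j))) : Commute X (sweepOut q y m k) := by
  induction k with
  | zero => exact h 0 le_rfl
  | succ k ih => exact (h _ le_rfl).mul_right (ih fun j hj => h j (by omega))

theorem commute_sweepIn {X : Op} {y : ℕ → ℂ} {m k : ℕ}
    (h : ∀ j, 1 ≤ j → j ≤ k → Commute X (crossing q m j (y m * y j)⁻¹)) :
    Commute X (sweepIn q y m k) := by
  induction k with
  | zero => exact Commute.one_right X
  | succ k ih => exact (ih fun j h1 hj => h j h1 (by omega)).mul_right (h _ (by omega) le_rfl)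

theorem commute_scattering {X : Op} {y : ℕ → ℂ} {n : ℕ}
    (hX : ∀ i j, i ≤ n → j < i → ∀ u, Commute X (crossing q i j u))
    (hX' : ∀ i, 1 ≤ i → i ≤ n → ∀ x, Commute X (wall q i x)) :
    Commute X (scattering q y n) := by
  induction n with
  | zero => exact Commute.one_right X
  | succ n ih =>
    have h1 : Commute X (sweepOut q y (n + 1) n) :=
      commute_sweepOut fun j hj => hX _ _ le_rfl (by omega) _
    have h2 : Commute X (sweepIn q y (n + 1) n) :=
      commute_sweepIn fun j _ hj => hX _ _ le_rfl (by omega) _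
    have h3 := fun x => hX' (n + 1) (by omega) le_rfl x
    have h4 := ih (fun i j hi hj => hX i j (by omega) hj) (fun i h1 hi => hX' i h1 (by omega))
    exact (((h3 _).mul_right h1).mul_right h4).mul_right (h2.mul_right (h3 _))

theorem sweepOut_congr {y y' : ℕ → ℂ} {m k : ℕ} (hm : y m = y' m) (h : ∀ j ≤ k, y j = y' j) :
    sweepOut q y m k = sweepOut q y' m k := by
  induction k with
  | zero => rw [sweepOut, sweepOut, hm, h 0 le_rfl]
  | succ k ih =>
    rw [sweepOut, sweepOut, ih fun j hj => h j (by omega), hm, h _ le_rfl]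

theorem sweepIn_congr {y y' : ℕ → ℂ} {m k : ℕ} (hm : y m = y' m)
    (h : ∀ j, 1 ≤ j → j ≤ k → y j = y' j) : sweepIn q y m k = sweepIn q y' m k := by
  induction k with
  | zero => rfl
  | succ k ih =>
    rw [sweepIn, sweepIn, ih fun j h1 hj => h j h1 (by omega), hm, h _ (by omega) le_rfl]

theorem scattering_congr {y y' : ℕ → ℂ} {n : ℕ} (h : ∀ j ≤ n, y j = y' j) :
    scattering q y n = scattering q y' n := by
  induction n with
  | zero => rfl
  | succ n ih =>
    rw [scattering, scattering, ih fun j hj => h j (by omega), h _ le_rfl,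
      sweepOut_congr (h _ le_rfl) fun j hj => h j (by omega),
      sweepIn_congr (h _ le_rfl) fun j _ hj => h j (by omega)]

section exchange

variable {y : ℕ → ℂ} {p : ℕ}

/-! ### Braids pass through the lattice -/

/-- The parameters `y` with those of the lines `p + 1` and `p + 2` interchanged. -/
def swapParam (p : ℕ) (y : ℕ → ℂ) : ℕ → ℂ := y ∘ Equiv.swap (p + 1) (p + 2)

theorem swapParam_of_ne {j : ℕ} (h1 : j ≠ p + 1) (h2 : j ≠ p + 2) : swapParam p y j = y j := by
  simp [swapParam, Equiv.swap_apply_of_ne_of_ne h1 h2]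

@[simp] theorem swapParam_left : swapParam p y (p + 1) = y (p + 2) := by simp [swapParam]

@[simp] theorem swapParam_right : swapParam p y (p + 2) = y (p + 1) := by simp [swapParam]

/-- The parameter of the braid that interchanges the parameters of the lines `p + 1` and `p + 2`. -/
noncomputable def exchangeParam (q : ℂ) (y : ℕ → ℂ) (p : ℕ) : ℂ := q ^ 2 * y (p + 2) * (y (p + 1))⁻¹

/-- A braid of two lines passes through the row of a third line, by the Yang–Baxter equation. -/
theorem braid_sweepOut (hq : q ≠ 0) (hq4 : σ (q ^ 4) ≠ 0) (hy : ∀ j, y j ≠ 0) {m k : ℕ}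
    (hm : p + 2 < m) (hk : p + 2 ≤ k) (hkm : k < m) :
    braid q (p + 1) (p + 2) (exchangeParam q y p) * sweepOut q y m k =
      sweepOut q (swapParam p y) m k * braid q (p + 1) (p + 2) (exchangeParam q y p) := by
  have hym : swapParam p y m = y m := swapParam_of_ne (by omega) (by omega)
  induction k, hk using Nat.le_induction with
  | base =>
    have h1 : Commute (braid q (p + 1) (p + 2) (exchangeParam q y p)) (sweepOut q y m p) :=
      commute_sweepOut fun j hj =>
        braid_commute (by omega) (by omega) (by omega) (by omega) _ _
    have h2 : sweepOut q (swapParam p y) m p = sweepOut q y m p :=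
      sweepOut_congr hym fun j hj => swapParam_of_ne (by omega) (by omega)
    have h3 : braid q (p + 1) (p + 2) (exchangeParam q y p) *
        (crossing q m (p + 2) (y m * y (p + 2)) * crossing q m (p + 1) (y m * y (p + 1))) =
        crossing q (p + 2) m (y m * y (p + 1)) * crossing q (p + 1) m (y m * y (p + 2)) *
          braid q (p + 2) (p + 1) (exchangeParam q y p) := by
      rw [crossing_symm q m, crossing_symm q m, braid_symm]
      refine braid_crossing hq hq4 (by omega) (by omega) (by omega)
        (mul_ne_zero (mul_ne_zero (pow_ne_zero _ hq) (hy _)) (inv_ne_zero (hy _)))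
        (mul_ne_zero (hy _) (hy _)) ?_
      have := hy (p + 1)
      rw [exchangeParam]; field_simp
    rw [sweepOut, sweepOut, sweepOut, sweepOut, h2, swapParam_left, swapParam_right, hym,
      ← mul_assoc (crossing q m _ _), ← mul_assoc, h3, mul_assoc _ _ (sweepOut q y m p),
      braid_symm q (p + 2), h1.eq, crossing_symm q (p + 2), crossing_symm q (p + 1)]
    simp only [mul_assoc]
  | succ k hk ih =>
    have h1 : Commute (braid q (p + 1) (p + 2) (exchangeParam q y p))
        (crossing q m (k + 1) (y m * y (k + 1))) :=
      braid_commute (by omega) (by omega) (by omega) (by omega) _ _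
    rw [sweepOut, sweepOut, ← mul_assoc, h1.eq, mul_assoc, ih (by omega), hym,
      swapParam_of_ne (by omega) (by omega), mul_assoc]

theorem braid_sweepIn (hq : q ≠ 0) (hq4 : σ (q ^ 4) ≠ 0) (hy : ∀ j, y j ≠ 0) {m k : ℕ}
    (hm : p + 2 < m) (hk : p + 2 ≤ k) (hkm : k < m) :
    braid q (p + 1) (p + 2) (exchangeParam q y p) * sweepIn q y m k =
      sweepIn q (swapParam p y) m k * braid q (p + 1) (p + 2) (exchangeParam q y p) := by
  have hym : swapParam p y m = y m := swapParam_of_ne (by omega) (by omega)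
  induction k, hk using Nat.le_induction with
  | base =>
    have h1 : Commute (braid q (p + 1) (p + 2) (exchangeParam q y p)) (sweepIn q y m p) :=
      commute_sweepIn fun j _ hj =>
        braid_commute (by omega) (by omega) (by omega) (by omega) _ _
    have h2 : sweepIn q (swapParam p y) m p = sweepIn q y m p :=
      sweepIn_congr hym fun j _ hj => swapParam_of_ne (by omega) (by omega)
    have h3 : braid q (p + 1) (p + 2) (exchangeParam q y p) *
        (crossing q m (p + 1) (y m * y (p + 1))⁻¹ * crossing q m (p + 2) (y m * y (p + 2))⁻¹) =
        crossing q (p + 1) m (y m * y (p + 2))⁻¹ * crossing q (p + 2) m (y m * y (p + 1))⁻¹ *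
          braid q (p + 1) (p + 2) (exchangeParam q y p) := by
      rw [crossing_symm q m, crossing_symm q m]
      refine braid_crossing hq hq4 (by omega) (by omega) (by omega)
        (mul_ne_zero (mul_ne_zero (pow_ne_zero _ hq) (hy _)) (inv_ne_zero (hy _)))
        (inv_ne_zero (mul_ne_zero (hy _) (hy _))) ?_
      have := hy (p + 1)
      have := hy (p + 2)
      have := hy m
      rw [exchangeParam]; field_simp
    rw [sweepIn, sweepIn, sweepIn, sweepIn, h2, swapParam_left, swapParam_right, hym,
      mul_assoc (sweepIn q y m p), ← mul_assoc, h1.eq, mul_assoc, h3, crossing_symm q (p + 2),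
      crossing_symm q (p + 1)]
    simp only [mul_assoc]
  | succ k hk ih =>
    have h1 : Commute (braid q (p + 1) (p + 2) (exchangeParam q y p))
        (crossing q m (k + 1) (y m * y (k + 1))⁻¹) :=
      braid_commute (by omega) (by omega) (by omega) (by omega) _ _
    rw [sweepIn, sweepIn, ← mul_assoc, ih (by omega), mul_assoc, h1.eq, hym,
      swapParam_of_ne (by omega) (by omega), mul_assoc]

/-- A braid of two lines passes through their outgoing crossings with the lines `0, …, k`. -/
theorem braid_sweepOut_pair (hq : q ≠ 0) (hq4 : σ (q ^ 4) ≠ 0) (hy : ∀ j, y j ≠ 0) {k : ℕ}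
    (hk : k ≤ p) :
    braid q (p + 1) (p + 2) (exchangeParam q y p) *
        (sweepOut q y (p + 2) k * sweepOut q y (p + 1) k) =
      sweepOut q (swapParam p y) (p + 2) k * sweepOut q (swapParam p y) (p + 1) k *
        braid q (p + 1) (p + 2) (exchangeParam q y p) := by
  have h3 : ∀ j ≤ p, braid q (p + 1) (p + 2) (exchangeParam q y p) *
      (crossing q (p + 2) j (y (p + 2) * y j) * crossing q (p + 1) j (y (p + 1) * y j)) =
      crossing q (p + 2) j (swapParam p y (p + 2) * swapParam p y j) *
        crossing q (p + 1) j (swapParam p y (p + 1) * swapParam p y j) *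
        braid q (p + 1) (p + 2) (exchangeParam q y p) := by
    intro j hj
    rw [braid_symm, swapParam_left, swapParam_right,
      swapParam_of_ne (show j ≠ p + 1 by omega) (by omega)]
    refine braid_crossing hq hq4 (by omega) (by omega) (by omega)
      (mul_ne_zero (mul_ne_zero (pow_ne_zero _ hq) (hy _)) (inv_ne_zero (hy _)))
      (mul_ne_zero (hy _) (hy _)) ?_
    have := hy (p + 1)
    rw [exchangeParam]; field_simp
  induction k with
  | zero => exact h3 0 hk
  | succ k ih =>
    have hc : ∀ y' : ℕ → ℂ, Commute (crossing q (p + 1) (k + 1) (y' (p + 1) * y' (k + 1)))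
        (sweepOut q y' (p + 2) k) := fun y' => commute_sweepOut fun j hj =>
      crossing_commute (by omega) (by omega) (by omega) (by omega) _ _
    have hs : ∀ y' : ℕ → ℂ, sweepOut q y' (p + 2) (k + 1) * sweepOut q y' (p + 1) (k + 1) =
        (crossing q (p + 2) (k + 1) (y' (p + 2) * y' (k + 1)) *
          crossing q (p + 1) (k + 1) (y' (p + 1) * y' (k + 1))) *
        (sweepOut q y' (p + 2) k * sweepOut q y' (p + 1) k) := by
      intro y'
      rw [sweepOut, sweepOut, mul_assoc, ← mul_assoc (sweepOut q y' (p + 2) k), ← (hc y').eq]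
      simp only [mul_assoc]
    rw [hs, hs, ← mul_assoc, h3 _ hk, mul_assoc, ih (by omega)]
    simp only [mul_assoc]

/-- A braid of two lines passes through their incoming crossings with the lines `k, …, 1`. -/
theorem braid_sweepIn_pair (hq : q ≠ 0) (hq4 : σ (q ^ 4) ≠ 0) (hy : ∀ j, y j ≠ 0) {k : ℕ}
    (hk : k ≤ p) :
    braid q (p + 1) (p + 2) (exchangeParam q y p) *
        (sweepIn q y (p + 1) k * sweepIn q y (p + 2) k) =
      sweepIn q (swapParam p y) (p + 1) k * sweepIn q (swapParam p y) (p + 2) k *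
        braid q (p + 1) (p + 2) (exchangeParam q y p) := by
  have h3 : ∀ j ≤ p, braid q (p + 1) (p + 2) (exchangeParam q y p) *
      (crossing q (p + 1) j (y (p + 1) * y j)⁻¹ * crossing q (p + 2) j (y (p + 2) * y j)⁻¹) =
      crossing q (p + 1) j (swapParam p y (p + 1) * swapParam p y j)⁻¹ *
        crossing q (p + 2) j (swapParam p y (p + 2) * swapParam p y j)⁻¹ *
        braid q (p + 1) (p + 2) (exchangeParam q y p) := by
    intro j hj
    rw [swapParam_left, swapParam_right, swapParam_of_ne (show j ≠ p + 1 by omega) (by omega)]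
    refine braid_crossing hq hq4 (by omega) (by omega) (by omega)
      (mul_ne_zero (mul_ne_zero (pow_ne_zero _ hq) (hy _)) (inv_ne_zero (hy _)))
      (inv_ne_zero (mul_ne_zero (hy _) (hy _))) ?_
    have := hy (p + 1)
    have := hy (p + 2)
    have := hy j
    rw [exchangeParam]; field_simp
  induction k with
  | zero => simp [sweepIn]
  | succ k ih =>
    have hc : ∀ y' : ℕ → ℂ, Commute (crossing q (p + 1) (k + 1) (y' (p + 1) * y' (k + 1))⁻¹)
        (sweepIn q y' (p + 2) k) := fun y' => commute_sweepIn fun j _ hj =>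
      crossing_commute (by omega) (by omega) (by omega) (by omega) _ _
    have hs : ∀ y' : ℕ → ℂ, sweepIn q y' (p + 1) (k + 1) * sweepIn q y' (p + 2) (k + 1) =
        (sweepIn q y' (p + 1) k * sweepIn q y' (p + 2) k) *
        (crossing q (p + 1) (k + 1) (y' (p + 1) * y' (k + 1))⁻¹ *
          crossing q (p + 2) (k + 1) (y' (p + 2) * y' (k + 1))⁻¹) := by
      intro y'
      rw [sweepIn, sweepIn, mul_assoc, ← mul_assoc (crossing q _ _ _), (hc y').eq]
      simp only [mul_assoc]
    rw [hs, hs, ← mul_assoc, ih (by omega), mul_assoc, h3 _ hk]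
    simp only [mul_assoc]

/-- A braid of neighbouring lines passes through the whole lattice. For the rows of the two lines
themselves this combines the Yang–Baxter equation with the reflection equation at both walls. -/
theorem braid_scattering (hq : q ≠ 0) (hq4 : σ (q ^ 4) ≠ 0) (hy : ∀ j, y j ≠ 0) {n : ℕ}
    (hn : p + 2 ≤ n) :
    braid q (p + 1) (p + 2) (exchangeParam q y p) * scattering q y n =
      scattering q (swapParam p y) n * braid q (p + 1) (p + 2) (exchangeParam q y p) := by
  induction n, hn using Nat.le_induction with
  | base =>
    set E := braid q (p + 1) (p + 2) (exchangeParam q y p) with hE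
    -- The two rows regrouped: first both reflections at the left wall with the mutual crossing,
    -- then the crossings with the other lines, and finally both reflections at the right wall.
    have hs : ∀ y' : ℕ → ℂ, scattering q y' (p + 2) =
        (wall q (p + 2) (y' (p + 2)) * crossing q (p + 2) (p + 1) (y' (p + 2) * y' (p + 1)) *
          wall q (p + 1) (y' (p + 1))) * (sweepOut q y' (p + 2) p * sweepOut q y' (p + 1) p) *
        scattering q y' p * (sweepIn q y' (p + 1) p * sweepIn q y' (p + 2) p) *
        (wall q (p + 1) (y' (p + 1))⁻¹ *
          crossing q (p + 2) (p + 1) (y' (p + 2) * y' (p + 1))⁻¹ *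
          wall q (p + 2) (y' (p + 2))⁻¹) := by
      intro y'
      have c1 : Commute (wall q (p + 1) (y' (p + 1))) (sweepOut q y' (p + 2) p) :=
        commute_sweepOut fun j hj => (crossing_wall_commute (by omega) (by omega) _ _).symm
      have c2 : Commute (wall q (p + 1) (y' (p + 1))⁻¹) (sweepIn q y' (p + 2) p) :=
        commute_sweepIn fun j _ hj => (crossing_wall_commute (by omega) (by omega) _ _).symm
      rw [scattering, scattering, sweepOut, sweepIn]
      simp only [mul_assoc]
      rw [← mul_assoc (sweepOut q y' (p + 2) p), ← c1.eq, ← mul_assoc (wall q (p + 1) _⁻¹), c2.eq]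
      simp only [mul_assoc]
    have h1 : SemiconjBy E (wall q (p + 2) (y (p + 2)) *
        crossing q (p + 2) (p + 1) (y (p + 2) * y (p + 1)) * wall q (p + 1) (y (p + 1)))
        (wall q (p + 2) (y (p + 1)) *
        crossing q (p + 2) (p + 1) (y (p + 1) * y (p + 2)) * wall q (p + 1) (y (p + 2))) := by
      rw [hE, braid_symm, mul_comm (y (p + 2))]
      refine braid_wall hq hq4 (by omega) (hy _) (hy _) ?_
      have := hy (p + 1)
      rw [exchangeParam]; field_simp
    have h2 : SemiconjBy E (wall q (p + 1) (y (p + 1))⁻¹ *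
        crossing q (p + 2) (p + 1) (y (p + 2) * y (p + 1))⁻¹ * wall q (p + 2) (y (p + 2))⁻¹)
        (wall q (p + 1) (y (p + 2))⁻¹ *
        crossing q (p + 2) (p + 1) (y (p + 1) * y (p + 2))⁻¹ * wall q (p + 2) (y (p + 1))⁻¹) := by
      rw [mul_comm (y (p + 1)), crossing_symm, mul_inv]
      refine braid_wall hq hq4 (by omega) (inv_ne_zero (hy _)) (inv_ne_zero (hy _)) ?_
      have := hy (p + 1)
      have := hy (p + 2)
      rw [exchangeParam]; field_simp
    have h3 : SemiconjBy E _ _ := braid_sweepOut_pair hq hq4 hy (p := p) le_rfl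
    have h4 : SemiconjBy E _ _ := braid_sweepIn_pair hq hq4 hy (p := p) le_rfl
    have h5 : Commute E (scattering q y p) := commute_scattering
      (fun i j hi hj u => braid_commute (by omega) (by omega) (by omega) (by omega) _ _)
      (fun i _ hi x => braid_wall_commute (by omega) (by omega) _ _)
    have h6 : scattering q (swapParam p y) p = scattering q y p :=
      scattering_congr fun j hj => swapParam_of_ne (by omega) (by omega)
    rw [hs, hs, h6, swapParam_left, swapParam_right]
    exact (((h1.mul_right h3).mul_right h5).mul_right h4).mul_right h2
  | succ n hn ih =>
    set E := braid q (p + 1) (p + 2) (exchangeParam q y p) with hE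
    have h1 := braid_sweepOut hq hq4 hy (p := p) (m := n + 1) (k := n) (by omega) hn (by omega)
    have h2 := braid_sweepIn hq hq4 hy (p := p) (m := n + 1) (k := n) (by omega) hn (by omega)
    have h3 : ∀ x, Commute E (wall q (n + 1) x) :=
      fun x => braid_wall_commute (by omega) (by omega) _ _
    rw [scattering, scattering, swapParam_of_ne (show n + 1 ≠ p + 1 by omega) (by omega)]
    exact ((SemiconjBy.mul_right (h3 _) h1).mul_right ih).mul_right (SemiconjBy.mul_right h2 (h3 _))

end exchange

end

section

variable {q : ℂ}

/-! ### Symmetry of the amplitude -/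

theorem incoming_congr {n : ℕ} {s t : Spins} (h : ∀ k ∈ Finset.Icc 1 n, s k = t k) :
    incoming n s = incoming n t := by
  rw [incoming, incoming]
  congr 1
  exact propext (forall₂_congr fun k hk => by rw [h k hk])

theorem incoming_eq_zero {n k : ℕ} {s : Spins} (h1 : 1 ≤ k) (hk : k ≤ n) (hs : s k = true) :
    incoming n s = 0 := by
  rw [incoming, if_neg]
  intro h
  simp [h k (Finset.mem_Icc.2 ⟨h1, hk⟩)] at hs

theorem incoming_comp_swap {n i j : ℕ} (hi1 : 1 ≤ i) (hi : i ≤ n) (hj1 : 1 ≤ j) (hj : j ≤ n)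
    (s : Spins) : incoming n (s ∘ Equiv.swap i j) = incoming n s := by
  have key : ∀ t : Spins, (∀ k ∈ Finset.Icc 1 n, t k = false) →
      ∀ k ∈ Finset.Icc 1 n, (t ∘ Equiv.swap i j) k = false := by
    intro t ht k hk
    apply ht
    rw [Equiv.swap_apply_def]
    split_ifs
    · exact Finset.mem_Icc.2 ⟨hj1, hj⟩
    · exact Finset.mem_Icc.2 ⟨hi1, hi⟩
    · exact hk
  rw [incoming, incoming]
  congr 1
  refine propext ⟨fun h => ?_, key s⟩
  have := key _ h
  rwa [Function.comp_assoc, ← Equiv.coe_trans, Equiv.swap_swap] at this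

theorem amplitude_congr {y y' : ℕ → ℂ} {n : ℕ} (h : ∀ j ≤ n, y j = y' j) :
    amplitude q n y = amplitude q n y' := by
  rw [amplitude, amplitude, scattering_congr h]

/-- The amplitude is symmetric in the parameters of neighbouring reflected lines: the braid acts on
the incoming and on the outgoing state by the same scalar. -/
theorem amplitude_swapParam (hq : q ≠ 0) (hq4 : σ (q ^ 4) ≠ 0) {y : ℕ → ℂ} (hy : ∀ j, y j ≠ 0)
    {n p : ℕ} (hn : p + 2 ≤ n) (hz : wt q (exchangeParam q y p) ≠ 0) :
    amplitude q n (swapParam p y) = amplitude q n y := by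
  set z := exchangeParam q y p with hzdef
  -- The two lines have equal spins both in the incoming and in the outgoing state.
  have h1 : braid q (p + 1) (p + 2) z (incoming n) = wt q z • incoming n := by
    have hc : ∀ s, crossing q (p + 1) (p + 2) z (incoming n) s = wt q z * incoming n s := by
      intro s
      rw [crossing_apply]
      split_ifs with h
      · rfl
      · have h0 : incoming n s = 0 := by
          cases h1 : s (p + 1)
          · have h2 : s (p + 2) = true := by
              cases h2 : s (p + 2)
              · rw [h1, h2] at h; exact absurd rfl h
              · rfl
            exact incoming_eq_zero (by omega) hn h2
          · exact incoming_eq_zero (by omega) (by omega) h1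
        rw [incoming_comp_swap (by omega) (by omega) (by omega) hn, h0]
        ring
    ext s
    rw [braid, Module.End.mul_apply, exchange_apply, hc,
      incoming_comp_swap (by omega) (by omega) (by omega) hn]
    rfl
  have h2 : ∀ g : Spins → ℂ, braid q (p + 1) (p + 2) z g (fun _ => true) =
      wt q z * g fun _ => true := by
    intro g
    rw [braid, Module.End.mul_apply, exchange_apply, crossing_apply]
    simp only [Function.comp_apply, if_true]
    rfl
  have h3 := congrArg (fun X : Op => X (incoming n) fun _ => true) (braid_scattering hq hq4 hy hn)
  simp only [← hzdef, Module.End.mul_apply, h1, h2, map_smul, Pi.smul_apply, smul_eq_mul] at h3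
  exact (mul_left_cancel₀ hz h3).symm

/-! ### Reduction of the amplitude -/

/-- The crossings of the line `a`, carrying the parameter `x`, with the lines `1, …, k`, in this
order. -/
noncomputable def sweepLines (q : ℂ) (y : ℕ → ℂ) (x : ℂ) (a : ℕ) : ℕ → Op
  | 0 => 1
  | k + 1 => crossing q a (k + 1) (x * y (k + 1)) * sweepLines q y x a k

/-- The crossings of the line `0`, carrying the parameter `w`, with the lines `1, …, k`, in this
order. -/
noncomputable def centreExit (q : ℂ) (y : ℕ → ℂ) (w : ℂ) : ℕ → Op
  | 0 => 1
  | k + 1 => crossing q (k + 1) 0 (y (k + 1) * w) * centreExit q y w k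

theorem commute_sweepLines {X : Op} {y : ℕ → ℂ} {x : ℂ} {a k : ℕ}
    (h : ∀ j, 1 ≤ j → j ≤ k → Commute X (crossing q a j (x * y j))) :
    Commute X (sweepLines q y x a k) := by
  induction k with
  | zero => exact Commute.one_right X
  | succ k ih => exact (h _ (by omega) le_rfl).mul_right (ih fun j h1 hj => h j h1 (by omega))

theorem commute_centreExit {X : Op} {y : ℕ → ℂ} {w : ℂ} {k : ℕ}
    (h : ∀ j, 1 ≤ j → j ≤ k → Commute X (crossing q j 0 (y j * w))) :
    Commute X (centreExit q y w k) := by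
  induction k with
  | zero => exact Commute.one_right X
  | succ k ih => exact (h _ (by omega) le_rfl).mul_right (ih fun j h1 hj => h j h1 (by omega))

theorem sweepOut_eq (q : ℂ) (y : ℕ → ℂ) (m k : ℕ) :
    sweepOut q y m k = sweepLines q y (y m) m k * crossing q m 0 (y m * y 0) := by
  induction k with
  | zero => rw [sweepOut, sweepLines, one_mul]
  | succ k ih => rw [sweepOut, ih, sweepLines, mul_assoc]

theorem mul_mul_of_mul_eq {a b c d : Op} (h : a * b = c * d) (X : Op) :
    a * (b * X) = c * (d * X) := by
  rw [← mul_assoc, h, mul_assoc]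

/-- The line `0`, crossing the other lines once more with parameter `x`, passes through the outgoing
half of the row of the line `a`. The relation `x * y 0 = q²` makes the Yang–Baxter equation
applicable. -/
theorem sweepLines_zero_mul_sweepOut (hq : q ≠ 0) (hq4 : σ (q ^ 4) ≠ 0) {y : ℕ → ℂ}
    (hy : ∀ j, y j ≠ 0) {x : ℂ} (hx : x ≠ 0) (hxw : x * y 0 = q ^ 2) {a k : ℕ} (hk : k < a) :
    sweepLines q y x 0 k * sweepOut q y a k =
      crossing q a 0 (y a * y 0) * sweepLines q y (y a) a k * sweepLines q y x 0 k := by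
  induction k with
  | zero => simp [sweepLines, sweepOut]
  | succ k ih =>
    have c1 : Commute (crossing q a (k + 1) (y a * y (k + 1))) (sweepLines q y x 0 k) :=
      commute_sweepLines fun j h1 hj =>
        crossing_commute (by omega) (by omega) (by omega) (by omega) _ _
    have c2 : Commute (crossing q 0 (k + 1) (x * y (k + 1))) (sweepLines q y (y a) a k) :=
      commute_sweepLines fun j h1 hj =>
        crossing_commute (by omega) (by omega) (by omega) (by omega) _ _
    have h := yang_baxter (q := q) (i := a) (j := 0) (k := k + 1) hq hq4 (by omega) (by omega)
      (by omega) (a := y a * y 0) (b := y a * y (k + 1)) (c := x * y (k + 1))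
      (mul_ne_zero (hy _) (hy _)) (mul_ne_zero hx (hy _)) (by rw [← hxw]; ring)
    have ih' := ih (by omega)
    calc _ = crossing q 0 (k + 1) (x * y (k + 1)) * (sweepLines q y x 0 k *
          (crossing q a (k + 1) (y a * y (k + 1)) * sweepOut q y a k)) := by
          rw [sweepLines, sweepOut, mul_assoc]
      _ = (crossing q 0 (k + 1) (x * y (k + 1)) * crossing q a (k + 1) (y a * y (k + 1)) *
          crossing q a 0 (y a * y 0)) * (sweepLines q y (y a) a k * sweepLines q y x 0 k) := by
          rw [mul_mul_of_mul_eq c1.symm.eq, ih']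
          simp only [mul_assoc]
      _ = _ := by
          rw [← h, sweepLines, sweepLines]
          simp only [mul_assoc]
          rw [mul_mul_of_mul_eq c2.eq]

/-- The line `a` passes through the exit of the line `0`. -/
theorem crossing_mul_centreExit (hq : q ≠ 0) (hq4 : σ (q ^ 4) ≠ 0) {y : ℕ → ℂ}
    (hy : ∀ j, y j ≠ 0) {x : ℂ} (hx : x ≠ 0) (hxw : x * y 0 = q ^ 2) {a k : ℕ} (hk : k < a) :
    crossing q a 0 (y a * x) * sweepLines q y (y a) a k * centreExit q y (y 0) k =
      centreExit q y (y 0) k * (sweepLines q y (y a) a k * crossing q a 0 (y a * x)) := by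
  induction k with
  | zero => simp [sweepLines, centreExit]
  | succ k ih =>
    have c1 : Commute (crossing q (k + 1) 0 (y (k + 1) * y 0)) (sweepLines q y (y a) a k) :=
      commute_sweepLines fun j h1 hj =>
        crossing_commute (by omega) (by omega) (by omega) (by omega) _ _
    have c2 : Commute (crossing q a (k + 1) (y a * y (k + 1))) (centreExit q y (y 0) k) :=
      commute_centreExit fun j h1 hj =>
        crossing_commute (by omega) (by omega) (by omega) (by omega) _ _
    have h := yang_baxter (q := q) (i := a) (j := 0) (k := k + 1) hq hq4 (by omega) (by omega)
      (by omega) (a := y a * x) (b := y a * y (k + 1)) (c := y (k + 1) * y 0)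
      (mul_ne_zero (hy _) hx) (mul_ne_zero (hy _) (hy _)) (by rw [← hxw]; ring)
    rw [crossing_symm q 0 (k + 1)] at h
    have ih' := ih (by omega)
    calc _ = crossing q a 0 (y a * x) * (crossing q a (k + 1) (y a * y (k + 1)) *
          (sweepLines q y (y a) a k * (crossing q (k + 1) 0 (y (k + 1) * y 0) *
            centreExit q y (y 0) k))) := by
          rw [sweepLines, centreExit]; simp only [mul_assoc]
      _ = (crossing q a 0 (y a * x) * crossing q a (k + 1) (y a * y (k + 1)) *
          crossing q (k + 1) 0 (y (k + 1) * y 0)) *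
            (sweepLines q y (y a) a k * centreExit q y (y 0) k) := by
          rw [mul_mul_of_mul_eq c1.symm.eq]; simp only [mul_assoc]
      _ = crossing q (k + 1) 0 (y (k + 1) * y 0) * (crossing q a (k + 1) (y a * y (k + 1)) *
          (crossing q a 0 (y a * x) * sweepLines q y (y a) a k * centreExit q y (y 0) k)) := by
          rw [h]; simp only [mul_assoc]
      _ = _ := by
          rw [ih', mul_mul_of_mul_eq c2.eq, sweepLines, centreExit]; simp only [mul_assoc]

/-- If `x * y 0 = q²`, then a reflection of the line `0` with parameter `x`, after it has crossed
all the other lines, can be pulled back through the lattice. This changes the parameter of the line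
`0` in the lattice from `y 0` to `x` and leaves the crossings `centreExit` behind. -/
theorem wall_sweepLines_scattering (hq : q ≠ 0) (hq4 : σ (q ^ 4) ≠ 0) {y : ℕ → ℂ}
    (hy : ∀ j, y j ≠ 0) {x : ℂ} (hx : x ≠ 0) (hxw : x * y 0 = q ^ 2) (m : ℕ) :
    wall q 0 x * sweepLines q y x 0 m * scattering q y m =
      centreExit q y (y 0) m * scattering q (Function.update y 0 x) m * wall q 0 x := by
  induction m with
  | zero => simp [sweepLines, centreExit, scattering]
  | succ m ih =>
    have hu : ∀ j, Function.update y 0 x (j + 1) = y (j + 1) := fun j => by simp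
    set B := sweepIn q y (m + 1) m * wall q (m + 1) (y (m + 1))⁻¹ with hB
    have hB' : sweepIn q (Function.update y 0 x) (m + 1) m * wall q (m + 1) (y (m + 1))⁻¹ = B := by
      rw [hB, sweepIn_congr (y' := y) (hu _) fun j h1 _ => by
        obtain ⟨j, rfl⟩ := Nat.exists_eq_add_of_le' h1; exact hu j]
    have hsL : ∀ k, sweepLines q (Function.update y 0 x) (y (m + 1)) (m + 1) k =
        sweepLines q y (y (m + 1)) (m + 1) k := by
      intro k
      induction k with
      | zero => rfl
      | succ k ih => rw [sweepLines, sweepLines, ih, hu]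
    have hO : sweepOut q (Function.update y 0 x) (m + 1) m =
        sweepLines q y (y (m + 1)) (m + 1) m * crossing q (m + 1) 0 (y (m + 1) * x) := by
      rw [sweepOut_eq, hu, hsL]; simp
    have c1 : Commute (wall q (m + 1) (y (m + 1))) (sweepLines q y x 0 m) :=
      commute_sweepLines fun j h1 hj => (crossing_wall_commute (by omega) (by omega) _ _).symm
    have c2 : Commute (wall q 0 x) (sweepLines q y (y (m + 1)) (m + 1) m) :=
      commute_sweepLines fun j h1 hj => (crossing_wall_commute (by omega) (by omega) _ _).symm
    have c3 : Commute (wall q 0 x) B := (commute_sweepIn fun j h1 hj =>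
      (crossing_wall_commute (by omega) (by omega) _ _).symm).mul_right
        (wall_commute (by omega) _ _)
    have c4 : Commute (wall q (m + 1) (y (m + 1))) (centreExit q y (y 0) m) :=
      commute_centreExit fun j h1 hj => (crossing_wall_commute (by omega) (by omega) _ _).symm
    have h1 := sweepLines_zero_mul_sweepOut (a := m + 1) (k := m) hq hq4 hy hx hxw (by omega)
    have h2 := crossing_mul_centreExit (a := m + 1) (k := m) hq hq4 hy hx hxw (by omega)
    have h3 := reflection_equation (q := q) (i := 0) (j := m + 1) hq hq4 (by omega)
      (z := y (m + 1) * y 0) hx (hy (m + 1)) (by rw [← hxw]; ring)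
    rw [crossing_symm q 0 (m + 1) (y (m + 1) * y 0)] at h3
    rw [scattering, scattering, hu, hB', hO, sweepLines, centreExit, ← hB]
    set K := wall q 0 x
    set K' := wall q (m + 1) (y (m + 1))
    set L := sweepLines q y x 0 m
    set L' := sweepLines q y (y (m + 1)) (m + 1) m
    set E := centreExit q y (y 0) m
    calc _ = K * crossing q 0 (m + 1) (x * y (m + 1)) * (L * (K' *
          (sweepOut q y (m + 1) m * (scattering q y m * B)))) := by simp only [mul_assoc]
      _ = K * crossing q 0 (m + 1) (x * y (m + 1)) * K' * (L * sweepOut q y (m + 1) m) *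
          (scattering q y m * B) := by
          rw [mul_mul_of_mul_eq c1.symm.eq]; simp only [mul_assoc]
      _ = (K * crossing q 0 (m + 1) (x * y (m + 1)) * K' *
          crossing q (m + 1) 0 (y (m + 1) * y 0)) * L' * L * (scattering q y m * B) := by
          rw [h1]; simp only [mul_assoc]
      _ = crossing q (m + 1) 0 (y (m + 1) * y 0) * K' * crossing q 0 (m + 1) (x * y (m + 1)) *
          (K * (L' * (L * (scattering q y m * B)))) := by
          rw [h3]; simp only [mul_assoc]
      _ = crossing q (m + 1) 0 (y (m + 1) * y 0) * K' * crossing q 0 (m + 1) (x * y (m + 1)) * L' *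
          (K * L * scattering q y m) * B := by
          rw [mul_mul_of_mul_eq c2.eq]; simp only [mul_assoc]
      _ = crossing q (m + 1) 0 (y (m + 1) * y 0) * K' * (crossing q (m + 1) 0 (y (m + 1) * x) * L' *
          E) * scattering q (Function.update y 0 x) m * (K * B) := by
          rw [ih, mul_comm x, crossing_symm q 0]; simp only [mul_assoc]
      _ = crossing q (m + 1) 0 (y (m + 1) * y 0) * (K' * (E * (L' *
          (crossing q (m + 1) 0 (y (m + 1) * x) *
            (scattering q (Function.update y 0 x) m * (B * K)))))) := by
          rw [h2, c3.eq]; simp only [mul_assoc]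
      _ = _ := by
          rw [mul_mul_of_mul_eq c4.eq]; simp only [mul_assoc]

/-- At the parameter `q²` the two lines of a crossing simply exchange their spins, since `wt q q² =
1` and `wt q q⁻² = 0`. -/
theorem crossing_eq_exchange (hq4 : σ (q ^ 4) ≠ 0) (hq : q ≠ 0) (i j : ℕ) :
    crossing q i j (q ^ 2) = exchange i j := by
  have h1 : wt q (q ^ 2) = 1 := by
    rw [wt, ← pow_add]; exact div_self hq4
  have h2 : wt q (q ^ 2)⁻¹ = 0 := by
    rw [wt, mul_inv_cancel₀ (pow_ne_zero 2 hq)]; simp [σ]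
  ext f s
  rw [crossing_apply, exchange_apply, h1, h2]
  split_ifs with h
  · rw [one_mul]
    congr 1
    ext m
    simp only [Function.comp_apply, Equiv.swap_apply_def]
    split_ifs <;> simp_all
  · rw [zero_mul, zero_add]

/-- The restriction of a state to the spins with `true` on the line `n`. -/
noncomputable def restrictTrue (n : ℕ) : Op where
  toFun f s := if s n = true then f s else 0
  map_add' f g := by ext s; simp only [Pi.add_apply]; split_ifs <;> simp
  map_smul' c f := by
    ext s; simp only [Pi.smul_apply, smul_eq_mul, RingHom.id_apply]; split_ifs <;> simp

theorem restrictTrue_apply (n : ℕ) (f : Spins → ℂ) (s : Spins) :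
    restrictTrue n f s = if s n = true then f s else 0 := rfl

theorem restrictTrue_commute (y : ℕ → ℂ) {m n : ℕ} (h : m < n) :
    Commute (restrictTrue n) (scattering q y m) := by
  refine commute_scattering (fun i j hi hj u => ?_) fun i h1 hi x => ?_
  · ext f s
    simp only [Module.End.mul_apply, restrictTrue_apply, crossing_apply,
      comp_swap_apply_of_ne s (show n ≠ i by omega) (show n ≠ j by omega)]
    split_ifs <;> ring
  · ext f s
    simp only [Module.End.mul_apply, restrictTrue_apply, wall_apply,
      Function.update_of_ne (show n ≠ i by omega)]
    split_ifs <;> ring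

/-- If every line that the line `n` meets enters with spin `false`, then a line `n` that leaves with
spin `true` has crossed them without any exchange. -/
theorem sweepIn_apply {y : ℕ → ℂ} {n k : ℕ} (hk : k < n) {f : Spins → ℂ}
    (hf : ∀ s : Spins, (∃ j, 1 ≤ j ∧ j ≤ k ∧ s j = true) → f s = 0) {s : Spins}
    (hs : s n = true) :
    sweepIn q y n k f s = (∏ j ∈ Finset.Icc 1 k, wt q (y n * y j)) * f s := by
  induction k generalizing f with
  | zero => simp [sweepIn]
  | succ k ih =>
    rw [sweepIn, Module.End.mul_apply, ih (by omega), Finset.prod_Icc_succ_top (by omega),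
      mul_assoc]
    · congr 1
      rw [crossing_apply, hs]
      split_ifs with h
      · rw [hf s ⟨k + 1, by omega, le_rfl, h.symm⟩]; ring
      · rw [hf (s ∘ Equiv.swap n (k + 1)) ⟨k + 1, by omega, le_rfl, by simpa using hs⟩, inv_inv,
          add_zero]
    · rintro t ⟨j, h1, hj, ht⟩
      rw [crossing_apply, hf t ⟨j, h1, by omega, ht⟩, hf (t ∘ Equiv.swap n (k + 1))
        ⟨j, h1, by omega, by rw [comp_swap_apply_of_ne t (by omega) (by omega), ht]⟩]
      simp

/-- If the parameters of the outermost line and of the central line satisfy `y (m + 1) * y 0 = q²`,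
then these two lines exchange their spins where they cross, and the amplitude is that of a lattice
with one line fewer, in which the central line carries the parameter `y (m + 1)`, up to explicit
factors. -/
theorem amplitude_reduction (hq : q ≠ 0) (hq4 : σ (q ^ 4) ≠ 0) {y : ℕ → ℂ}
    (hy : ∀ j, y j ≠ 0) {m : ℕ} (h : y (m + 1) * y 0 = q ^ 2) :
    amplitude q (m + 1) y = (1 + refl q (y (m + 1))) * refl q (y (m + 1))⁻¹ *
      (∏ k ∈ Finset.Icc 1 m, wt q (y (m + 1) * y k)) * (∏ k ∈ Finset.Icc 1 m, wt q (y k * y 0)) *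
        amplitude q m (Function.update y 0 (y (m + 1))) := by
  set x := y (m + 1) with hx
  set B := sweepIn q y (m + 1) m * wall q (m + 1) x⁻¹ with hB
  have hP : ∀ k ≤ m, exchange 0 (m + 1) * sweepLines q y x 0 k =
      sweepLines q y x (m + 1) k * exchange 0 (m + 1) := by
    intro k hk
    induction k with
    | zero => simp [sweepLines]
    | succ k ih =>
      rw [sweepLines, sweepLines, ← mul_assoc, exchange_crossing (by omega) (by omega), mul_assoc,
        ih (by omega), mul_assoc]
  have c3 : Commute (wall q 0 x) B := (commute_sweepIn fun j h1 hj =>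
      (crossing_wall_commute (by omega) (by omega) _ _).symm).mul_right
        (wall_commute (by omega) _ _)
  -- The crossing of the lines `0` and `m + 1` is an exchange. Behind it, the outgoing half of the
  -- row of the line `m + 1` is continued by the line `0`, whose reflection is pulled through the
  -- lattice.
  have h1 : scattering q y (m + 1) = exchange 0 (m + 1) * (centreExit q y (y 0) m *
      (scattering q (Function.update y 0 x) m * (B * wall q 0 x))) := by
    rw [scattering, sweepOut_eq, ← hx, ← hB, h, crossing_symm, crossing_eq_exchange hq4 hq]
    calc _ = wall q (m + 1) x * (sweepLines q y x (m + 1) m * exchange 0 (m + 1)) *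
          (scattering q y m * B) := by simp only [mul_assoc]
      _ = (exchange 0 (m + 1) * wall q 0 x) * sweepLines q y x 0 m * (scattering q y m * B) := by
          rw [← hP m le_rfl, exchange_wall]; simp only [mul_assoc]
      _ = exchange 0 (m + 1) * (wall q 0 x * sweepLines q y x 0 m * scattering q y m) * B := by
          simp only [mul_assoc]
      _ = _ := by
          rw [wall_sweepLines_scattering hq hq4 hy (hx ▸ hy _) h, ← c3.eq]; simp only [mul_assoc]
  -- The incoming state does not depend on the spin of the line `0`.
  have h2 : wall q 0 x (incoming (m + 1)) = (1 + refl q x) • incoming (m + 1) := by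
    ext s
    rw [wall_apply, incoming_congr (s := Function.update s 0 _) (t := s) fun k hk =>
      Function.update_of_ne (Nat.one_le_iff_ne_zero.1 (Finset.mem_Icc.1 hk).1) _ _,
      Pi.smul_apply, smul_eq_mul]
    ring
  have h3 : ∀ (k : ℕ) (g : Spins → ℂ), centreExit q y (y 0) k g (fun _ => true) =
      (∏ j ∈ Finset.Icc 1 k, wt q (y j * y 0)) * g fun _ => true := by
    intro k g
    induction k with
    | zero => simp [centreExit]
    | succ k ih =>
      rw [centreExit, Module.End.mul_apply, crossing_apply, if_pos rfl, ih,
        Finset.prod_Icc_succ_top (by omega)]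
      ring
  -- The line `m + 1` has to leave with spin `true`, so it is reversed at the left wall.
  have h4 : restrictTrue (m + 1) (B (incoming (m + 1))) =
      (refl q x⁻¹ * ∏ j ∈ Finset.Icc 1 m, wt q (x * y j)) •
        restrictTrue (m + 1) (incoming m) := by
    ext s
    rw [restrictTrue_apply, Pi.smul_apply, restrictTrue_apply]
    split_ifs with hs
    · rw [hB, Module.End.mul_apply, sweepIn_apply (by omega) _ hs, wall_apply,
        incoming_eq_zero (by omega) le_rfl hs]
      · have : incoming (m + 1) (Function.update s (m + 1) (!s (m + 1))) = incoming m s := by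
          rw [incoming, incoming]
          congr 1
          refine propext ⟨fun h k hk => ?_, fun h k hk => ?_⟩
          · rw [Finset.mem_Icc] at hk
            rw [← h k (Finset.mem_Icc.2 ⟨hk.1, by omega⟩), Function.update_of_ne (by omega)]
          · rw [Finset.mem_Icc] at hk
            rcases eq_or_ne k (m + 1) with rfl | hk'
            · simp [hs]
            · rw [Function.update_of_ne hk', h k (Finset.mem_Icc.2 ⟨hk.1, by omega⟩)]
        rw [this, smul_eq_mul, ← hx]
        ring
      · rintro t ⟨j, h1, hj, ht⟩
        rw [wall_apply, incoming_eq_zero h1 (by omega) ht, incoming_eq_zero h1 (by omega)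
          (by rw [Function.update_of_ne (by omega)]; exact ht)]
        simp
    · simp
  have h5 : ∀ f : Spins → ℂ, scattering q (Function.update y 0 x) m f (fun _ => true) =
      scattering q (Function.update y 0 x) m (restrictTrue (m + 1) f) (fun _ => true) := by
    intro f
    rw [← Module.End.mul_apply, ← (restrictTrue_commute (q := q) _ (Nat.lt_succ_self m)).eq,
      Module.End.mul_apply, restrictTrue_apply, if_pos rfl]
  have h6 : ∀ g : Spins → ℂ, exchange 0 (m + 1) g (fun _ => true) = g fun _ => true := fun _ => rfl
  rw [amplitude, h1]
  simp only [Module.End.mul_apply]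
  rw [h6, h3, h2, map_smul, map_smul, Pi.smul_apply, h5, h4, map_smul, Pi.smul_apply, ← h5,
    ← amplitude, smul_eq_mul, smul_eq_mul]
  ring

/-! ### Parity of the amplitude -/

/-- The sign of the spin of the line `n`: `1` on `true` and `-1` on `false`. -/
noncomputable def spinSign (n : ℕ) : Op where
  toFun f s := (if s n = true then 1 else -1) * f s
  map_add' f g := by ext s; simp only [Pi.add_apply]; ring
  map_smul' c f := by ext s; simp only [Pi.smul_apply, smul_eq_mul, RingHom.id_apply]; ring

theorem spinSign_apply (n : ℕ) (f : Spins → ℂ) (s : Spins) :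
    spinSign n f s = (if s n = true then 1 else -1) * f s := rfl

theorem σ_neg (x : ℂ) : σ (-x) = -σ x := by
  unfold σ; rw [inv_neg]; ring

theorem wt_neg (u : ℂ) : wt q (-u) = -wt q u := by
  rw [wt, wt, mul_neg, σ_neg, neg_div]

theorem refl_neg (x : ℂ) : refl q (-x) = -refl q x := by
  rw [refl, refl, inv_neg, mul_neg, σ_neg, neg_div]

theorem crossing_neg_mul_spinSign {n k : ℕ} (u : ℂ) :
    crossing q n k (-u) * spinSign n = (-1 : ℂ) • (spinSign n * crossing q n k u) := by
  ext f s
  rw [LinearMap.smul_apply, Pi.smul_apply, smul_eq_mul]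
  simp only [Module.End.mul_apply, crossing_apply, spinSign_apply, Function.comp_apply,
    Equiv.swap_apply_left, inv_neg, wt_neg]
  cases s n <;> cases s k <;> (simp; try ring)

theorem wall_neg_mul_spinSign {n : ℕ} (x : ℂ) :
    wall q n (-x) * spinSign n = spinSign n * wall q n x := by
  ext f s
  simp only [Module.End.mul_apply, wall_apply, spinSign_apply, Function.update_self, refl_neg]
  cases s n <;> (simp; try ring)

theorem spinSign_commute (y : ℕ → ℂ) {m n : ℕ} (h : m < n) :
    Commute (spinSign n) (scattering q y m) := by
  refine commute_scattering (fun i j hi hj u => ?_) fun i h1 hi x => ?_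
  · ext f s
    simp only [Module.End.mul_apply, spinSign_apply, crossing_apply,
      comp_swap_apply_of_ne s (show n ≠ i by omega) (show n ≠ j by omega)]
    split_ifs <;> ring
  · ext f s
    simp only [Module.End.mul_apply, spinSign_apply, wall_apply,
      Function.update_of_ne (show n ≠ i by omega)]
    ring

/-- The amplitude is even in the parameter of the outermost line: conjugation by the sign of its
spin changes the sign of the parameter. There are `2m + 1` crossings, each of which contributes a
sign, and one more sign comes from the incoming state. -/
theorem amplitude_neg (y : ℕ → ℂ) (m : ℕ) :
    amplitude q (m + 1) (Function.update y (m + 1) (-y (m + 1))) = amplitude q (m + 1) y := by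
  set y' := Function.update y (m + 1) (-y (m + 1)) with hy'
  have hm : y' (m + 1) = -y (m + 1) := by simp [hy']
  have hj : ∀ j ≤ m, y' j = y j := fun j hj => by
    rw [hy', Function.update_of_ne (by omega)]
  set D := spinSign (m + 1)
  have h1 : ∀ k ≤ m, sweepOut q y' (m + 1) k * D =
      (-1 : ℂ) ^ (k + 1) • (D * sweepOut q y (m + 1) k) := by
    intro k hk
    induction k with
    | zero =>
      rw [sweepOut, sweepOut, hm, hj 0 hk, neg_mul, crossing_neg_mul_spinSign, zero_add,
        pow_one]
    | succ k ih =>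
      rw [sweepOut, sweepOut, hm, hj _ hk, mul_assoc, ih (by omega), neg_mul, mul_smul_comm,
        ← mul_assoc, crossing_neg_mul_spinSign, pow_succ _ (k + 1), smul_mul_assoc, smul_smul,
        mul_assoc]
  have h2 : ∀ k ≤ m, sweepIn q y' (m + 1) k * D =
      (-1 : ℂ) ^ k • (D * sweepIn q y (m + 1) k) := by
    intro k hk
    induction k with
    | zero => simp [sweepIn]
    | succ k ih =>
      rw [sweepIn, sweepIn, hm, hj _ hk, mul_assoc, neg_mul, inv_neg, crossing_neg_mul_spinSign,
        mul_smul_comm, ← mul_assoc, ih (by omega), pow_succ' _ k, smul_mul_assoc, smul_smul,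
        mul_assoc]
  have h3 : scattering q y' (m + 1) * D = (-1 : ℂ) • (D * scattering q y (m + 1)) := by
    rw [scattering, scattering, hm, inv_neg, scattering_congr hj]
    simp only [mul_assoc]
    rw [wall_neg_mul_spinSign, ← mul_assoc (sweepIn q y' _ _), h2 m le_rfl]
    simp only [mul_smul_comm, smul_mul_assoc, mul_assoc]
    rw [← mul_assoc (scattering q y m), ← (spinSign_commute (q := q) y (Nat.lt_succ_self m)).eq,
      ← mul_assoc (sweepOut q y' _ _), ← mul_assoc (sweepOut q y' _ _), h1 m le_rfl]
    simp only [mul_smul_comm, smul_mul_assoc, mul_assoc]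
    rw [← mul_assoc (wall q (m + 1) (-y (m + 1))), wall_neg_mul_spinSign, smul_smul, pow_succ,
      ← mul_assoc, ← mul_pow, mul_assoc D, neg_mul_neg, one_mul, one_pow, one_mul]
  have h4 : D (incoming (m + 1)) = -incoming (m + 1) := by
    ext s
    rw [spinSign_apply, Pi.neg_apply]
    split_ifs with h
    · rw [incoming_eq_zero (by omega) le_rfl h]; simp
    · ring
  have h5 := congrArg (fun X : Op => X (incoming (m + 1)) fun _ => true) h3
  simp only [Module.End.mul_apply, h4, map_neg, LinearMap.smul_apply, Pi.neg_apply, Pi.smul_apply,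
    smul_eq_mul] at h5
  rw [spinSign_apply, if_pos rfl, one_mul, neg_one_mul] at h5
  exact neg_injective h5

end

/-! ### Sums over spins on edges -/

section

variable {q : ℂ}

/-- A vertical (`Sum.inl`) or horizontal (`Sum.inr`) edge, named as in `vEdges` and `hEdges`. -/
abbrev Edge : Type := (ℕ × ℕ) ⊕ (ℕ × ℕ)

/-- The sum of `F` over all spins on the edges in `E`, where the spins on the other edges are given
by `ω`. -/
def spinSum (E : Finset Edge) (F : (Edge → Bool) → ℂ) (ω : Edge → Bool) : ℂ :=
  ∑ X ∈ E.powerset, F fun e => if e ∈ E then decide (e ∈ X) else ω e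

theorem spinSum_empty (F : (Edge → Bool) → ℂ) (ω : Edge → Bool) : spinSum ∅ F ω = F ω := by
  simp [spinSum]

theorem spinSum_insert {e : Edge} {E : Finset Edge} (he : e ∉ E) (F : (Edge → Bool) → ℂ)
    (ω : Edge → Bool) :
    spinSum (insert e E) F ω = ∑ b : Bool, spinSum E F (Function.update ω e b) := by
  rw [spinSum, Finset.sum_powerset_insert he, Fintype.sum_bool, add_comm, spinSum, spinSum]
  congr 1 <;> refine Finset.sum_congr rfl fun X hX => congrArg F (funext fun e' => ?_)
  · rcases eq_or_ne e' e with rfl | h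
    · simp [he]
    · simp [h]
  · have heX : e ∉ X := fun h => he (Finset.mem_powerset.1 hX h)
    rcases eq_or_ne e' e with rfl | h
    · simp [he, heX]
    · simp [h]

theorem spinSum_union {E₁ E₂ : Finset Edge} (h : Disjoint E₁ E₂) (F : (Edge → Bool) → ℂ)
    (ω : Edge → Bool) : spinSum (E₁ ∪ E₂) F ω = spinSum E₁ (spinSum E₂ F) ω := by
  induction E₁ using Finset.induction_on generalizing ω with
  | empty => rw [Finset.empty_union, spinSum_empty]
  | insert e E he ih =>
    rw [Finset.disjoint_insert_left] at h
    rw [Finset.insert_union, spinSum_insert (by simp [he, h.1]), spinSum_insert he]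
    simp only [ih h.2]

/-- The weight `w` does not depend on the spins on the edges in `E`. -/
def IndepOf (w : (Edge → Bool) → ℂ) (E : Finset Edge) : Prop :=
  ∀ ω ω' : Edge → Bool, (∀ e ∉ E, ω e = ω' e) → w ω = w ω'

theorem IndepOf.mul {w₁ w₂ : (Edge → Bool) → ℂ} {E : Finset Edge} (h₁ : IndepOf w₁ E)
    (h₂ : IndepOf w₂ E) : IndepOf (fun ω => w₁ ω * w₂ ω) E := fun ω ω' h => by
  simp only [h₁ ω ω' h, h₂ ω ω' h]

theorem IndepOf.prod {ι : Type*} {s : Finset ι} {w : ι → (Edge → Bool) → ℂ} {E : Finset Edge}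
    (h : ∀ i ∈ s, IndepOf (w i) E) : IndepOf (fun ω => ∏ i ∈ s, w i ω) E := fun ω ω' hω =>
  Finset.prod_congr rfl fun i hi => h i hi ω ω' hω

theorem spinSum_indep_mul {w : (Edge → Bool) → ℂ} {E : Finset Edge} (h : IndepOf w E)
    (G : (Edge → Bool) → ℂ) (ω : Edge → Bool) :
    spinSum E (fun ω => w ω * G ω) ω = w ω * spinSum E G ω := by
  rw [spinSum, spinSum, Finset.mul_sum]
  refine Finset.sum_congr rfl fun X _ => ?_
  rw [h _ ω fun e he => if_neg he]

/-- The operator `X` is the sum of the weight `w` over the spins on the edges in `E`. Here `inn k`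
and `out k` are the edges on which the line `k` enters and leaves this piece of the lattice; they
coincide if the line does not take part. -/
def Realizes (E : Finset Edge) (w : (Edge → Bool) → ℂ) (out inn : ℕ → Edge) (X : Op) : Prop :=
  ∀ (f : Spins → ℂ) (ω : Edge → Bool),
    X f (ω ∘ out) = spinSum E (fun ω' => w ω' * f (ω' ∘ inn)) ω

theorem Realizes.one (c : ℕ → Edge) : Realizes ∅ (fun _ => 1) c c 1 := fun f ω => by
  rw [spinSum_empty, one_mul]; rfl

/-- Pieces of the lattice are composed by summing over the edges that they share. -/
theorem Realizes.mul {E₁ E₂ : Finset Edge} {w₁ w₂ : (Edge → Bool) → ℂ} {c₀ c₁ c₂ : ℕ → Edge}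
    {X₁ X₂ : Op} (h₁ : Realizes E₁ w₁ c₀ c₁ X₁) (h₂ : Realizes E₂ w₂ c₁ c₂ X₂)
    (hE : Disjoint E₁ E₂) (hw : IndepOf w₁ E₂) :
    Realizes (E₁ ∪ E₂) (fun ω => w₁ ω * w₂ ω) c₀ c₂ (X₁ * X₂) := fun f ω => by
  rw [Module.End.mul_apply, h₁, spinSum_union hE]
  congr 1
  ext ω'
  rw [h₂, ← spinSum_indep_mul hw]
  simp only [mul_assoc]

/-- The matrix of a crossing: `a`, `b` are the incoming spins of the two lines and `a'`, `b'` the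
outgoing ones. -/
noncomputable def crossWeight (q u : ℂ) (a b a' b' : Bool) : ℂ :=
  if a' = b' then (if a = a' ∧ b = b' then wt q u else 0)
  else if a = a' ∧ b = b' then wt q u⁻¹ else if a = b' ∧ b = a' then 1 else 0

/-- The matrix of a reflection, with incoming spin `a` and outgoing spin `a'`. -/
noncomputable def wallWeight (q x : ℂ) (a a' : Bool) : ℂ := if a = a' then 1 else refl q x

theorem Realizes.crossing {i j : ℕ} (hij : i ≠ j) (u : ℂ) {out inn : ℕ → Edge}
    (hi : inn i ≠ inn j) (hc : ∀ k, out k ≠ inn i ∧ out k ≠ inn j)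
    (ho : ∀ k, k ≠ i → k ≠ j → out k = inn k) :
    Realizes {inn i, inn j}
      (fun ω => crossWeight q u (ω (inn i)) (ω (inn j)) (ω (out i)) (ω (out j))) out inn
      (crossing q i j u) := fun f ω => by
  have hs : ∀ a b, (Function.update (Function.update ω (inn i) a) (inn j) b) ∘ inn =
      Function.update (Function.update (ω ∘ out) i a) j b := by
    intro a b
    ext k
    rcases eq_or_ne k j with rfl | hkj
    · simp
    rcases eq_or_ne k i with rfl | hki
    · simp [hkj, hi]
    · have h1 := hc k
      rw [ho k hki hkj] at h1
      simp [hkj, hki, h1.1, h1.2, ho k hki hkj]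
  rw [spinSum_insert (by simpa using hi)]
  simp only [← insert_empty_eq, spinSum_insert (Finset.notMem_empty _), spinSum_empty,
    Fintype.sum_bool, hs]
  simp only [Function.update_self, Function.update_of_ne hi, Function.update_of_ne (hc i).1,
    Function.update_of_ne (hc i).2, Function.update_of_ne (hc j).1, Function.update_of_ne (hc j).2]
  have hu : ∀ a b, (ω ∘ out) i = a → (ω ∘ out) j = b →
      Function.update (Function.update (ω ∘ out) i a) j b = ω ∘ out := by
    rintro a b rfl rfl; rw [Function.update_eq_self, Function.update_eq_self]
  have hsw : (ω ∘ out) ∘ Equiv.swap i j =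
      Function.update (Function.update (ω ∘ out) i ((ω ∘ out) j)) j ((ω ∘ out) i) := by
    ext k
    simp only [Function.comp_apply, Function.update_apply, Equiv.swap_apply_def]
    split_ifs <;> simp_all
  rw [crossing_apply, hsw]
  have hu' := hu _ _ rfl rfl
  simp only [Function.comp_apply] at hu' ⊢
  cases h1 : ω (out i) <;> cases h2 : ω (out j) <;> rw [h1, h2] at hu' <;>
    (simp [crossWeight, hu']; try ring)

theorem Realizes.wall {i : ℕ} (x : ℂ) {out inn : ℕ → Edge} (hc : ∀ k, out k ≠ inn i)
    (ho : ∀ k, k ≠ i → out k = inn k) :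
    Realizes {inn i} (fun ω => wallWeight q x (ω (inn i)) (ω (out i))) out inn
      (wall q i x) := fun f ω => by
  have hs : ∀ a, (Function.update ω (inn i) a) ∘ inn = Function.update (ω ∘ out) i a := by
    intro a
    ext k
    rcases eq_or_ne k i with rfl | hki
    · simp
    · have h1 := hc k
      rw [ho k hki] at h1
      simp [hki, h1, ho k hki]
  simp only [← insert_empty_eq, spinSum_insert (Finset.notMem_empty _), spinSum_empty,
    Fintype.sum_bool, hs]
  simp only [Function.update_self, Function.update_of_ne (hc i)]
  have hu : Function.update (ω ∘ out) i (ω (out i)) = ω ∘ out := by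
    exact Function.update_eq_self i (ω ∘ out)
  rw [wall_apply]
  simp only [Function.comp_apply]
  cases h1 : ω (out i) <;> rw [h1] at hu <;> simp [wallWeight, hu, add_comm]

end

/-! ### The lattice as a sum over spins -/

section

variable {q : ℂ}

/-- The vertical edge above the vertex `(i, j)`. -/
abbrev vert (i j : ℕ) : Edge := Sum.inl (i, j)

/-- The horizontal edge to the right of the vertex `(i, j)`. -/
abbrev horiz (i j : ℕ) : Edge := Sum.inr (i, j)

/-- The edge by which the line `k ≤ m` leaves the rows of the lines `1, …, m`: the one above the row
`n + 1 - m` in the column `n + 1 + k`. The lines with `k > m` are given an edge of their own row,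
which only serves as a label. -/
def topCut (n m : ℕ) (k : ℕ) : Edge :=
  if m < k then horiz (n + 1 - k) n else vert (n + 1 - m) (n + 1 + k)

/-- The edges that carry the spins of the lines when the line `m` has crossed the lines `0, …, c -
1`: it is on the horizontal edge between the columns `n + c` and `n + c + 1`, the lines `k < c` are
above its row and the lines `c ≤ k < m` below it. -/
def rightCut (n m c : ℕ) (k : ℕ) : Edge :=
  if m < k then horiz (n + 1 - k) n else if k = m then horiz (n + 1 - m) (n + c)
  else if k < c then vert (n + 1 - m) (n + 1 + k) else vert (n + 2 - m) (n + 1 + k)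

/-- The edge by which the line `k ≤ m` enters the rows of the lines `1, …, m`: the one above the row
`n + 1 - m` in the column `n + 1 - k`, or the lowest edge of the central column if `k = 0`. -/
def sourceCut (n m : ℕ) (k : ℕ) : Edge :=
  if k = 0 then vert (n + 1) (n + 1) else if m < k then horiz (n + 1 - k) n
  else vert (n + 1 - m) (n + 1 - k)

/-- The edges that carry the spins of the lines when the line `m` has yet to cross the lines `c, …,
1` on the left: it is on the horizontal edge between the columns `n - c` and `n - c + 1`, the lines
`1 ≤ k ≤ c` are above its row and the lines `c < k < m` below it. -/
def leftCut (n m c : ℕ) (k : ℕ) : Edge :=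
  if k = 0 then vert (n + 1) (n + 1) else if m < k then horiz (n + 1 - k) n
  else if k = m then horiz (n + 1 - m) (n - c)
  else if k ≤ c then vert (n + 1 - m) (n + 1 - k) else vert (n + 2 - m) (n + 1 - k)

/-- The weight of the crossing of the line `m` with the line `k` at the vertex `(n + 1 - m, n + 1 +
k)`. -/
noncomputable def outWeight (q : ℂ) (n : ℕ) (y : ℕ → ℂ) (m k : ℕ) (ω : Edge → Bool) : ℂ :=
  crossWeight q (y m * y k) (ω (horiz (n + 1 - m) (n + k))) (ω (vert (n + 2 - m) (n + 1 + k)))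
    (ω (horiz (n + 1 - m) (n + 1 + k))) (ω (vert (n + 1 - m) (n + 1 + k)))

/-- The weight of the crossing of the line `m` with the line `k` at the vertex `(n + 1 - m, n + 1 -
k)`. The line `m` travels to the right and the line `k` downwards, whence the inverse parameter. -/
noncomputable def inWeight (q : ℂ) (n : ℕ) (y : ℕ → ℂ) (m k : ℕ) (ω : Edge → Bool) : ℂ :=
  crossWeight q (y m * y k)⁻¹ (ω (horiz (n + 1 - m) (n - k))) (ω (vert (n + 1 - m) (n + 1 - k)))
    (ω (horiz (n + 1 - m) (n + 1 - k))) (ω (vert (n + 2 - m) (n + 1 - k)))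

open Classical in
/-- The edges of the grid that satisfy `P`. -/
noncomputable def edgesWhere (n : ℕ) (P : Edge → Prop) : Finset Edge :=
  ((vEdges n).disjSum (hEdges n)).filter P

theorem vert_mem_edgesWhere {n i j : ℕ} {P : Edge → Prop} :
    vert i j ∈ edgesWhere n P ↔
      (1 ≤ i ∧ i ≤ n + 1 ∧ i ≤ j ∧ i + j ≤ 2 * n + 2) ∧ P (vert i j) := by
  simp only [edgesWhere, vert, Finset.mem_filter, Finset.inl_mem_disjSum, vEdges,
    Finset.mem_product, Finset.mem_Icc]
  refine and_congr_left fun _ => ?_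
  omega

theorem horiz_mem_edgesWhere {n i j : ℕ} {P : Edge → Prop} :
    horiz i j ∈ edgesWhere n P ↔
      (1 ≤ i ∧ i ≤ n ∧ i ≤ j ∧ i + j ≤ 2 * n + 1) ∧ P (horiz i j) := by
  simp only [edgesWhere, horiz, Finset.mem_filter, Finset.inr_mem_disjSum, hEdges,
    Finset.mem_product, Finset.mem_Icc]
  refine and_congr_left fun _ => ?_
  omega

/-- The condition on edges given by `p` for vertical edges and by `r` for horizontal ones. -/
def edgeCond (p r : ℕ → ℕ → Prop) : Edge → Prop := Sum.elim (fun e => p e.1 e.2) fun e => r e.1 e.2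

/-- The edges by which the lines enter the crossings of the line `m` with the lines `0, …, c - 1`.
-/
noncomputable def outEdges (n m c : ℕ) : Finset Edge := edgesWhere n (edgeCond
  (fun i j => i = n + 2 - m ∧ n < j ∧ j < n + 1 + c) fun i j => i = n + 1 - m ∧ n ≤ j ∧ j < n + c)

/-- The edges by which the lines enter the crossings of the line `m` with the lines `c, …, 1`. -/
noncomputable def inEdges (n m c : ℕ) : Finset Edge := edgesWhere n (edgeCond
  (fun i j => i = n + 1 - m ∧ j ≤ n ∧ n < j + c) fun i j => i = n + 1 - m ∧ j < n ∧ n ≤ j + c)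

theorem edge_ext {E F : Finset Edge} (hv : ∀ i j, vert i j ∈ E ↔ vert i j ∈ F)
    (hh : ∀ i j, horiz i j ∈ E ↔ horiz i j ∈ F) : E = F := by
  ext e
  rcases e with ⟨i, j⟩ | ⟨i, j⟩
  exacts [hv i j, hh i j]

theorem edge_disjoint {E F : Finset Edge} (hv : ∀ i j, vert i j ∈ E → vert i j ∉ F)
    (hh : ∀ i j, horiz i j ∈ E → horiz i j ∉ F) : Disjoint E F := by
  refine Finset.disjoint_left.2 fun e he => ?_
  rcases e with ⟨i, j⟩ | ⟨i, j⟩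
  exacts [hv i j he, hh i j he]

theorem crossWeight_indepOf {u : ℂ} {e₁ e₂ e₃ e₄ : Edge} {E : Finset Edge} (h₁ : e₁ ∉ E)
    (h₂ : e₂ ∉ E) (h₃ : e₃ ∉ E) (h₄ : e₄ ∉ E) :
    IndepOf (fun ω => crossWeight q u (ω e₁) (ω e₂) (ω e₃) (ω e₄)) E := fun ω ω' h => by
  simp only [h _ h₁, h _ h₂, h _ h₃, h _ h₄]

theorem wallWeight_indepOf {x : ℂ} {e₁ e₂ : Edge} {E : Finset Edge} (h₁ : e₁ ∉ E)
    (h₂ : e₂ ∉ E) : IndepOf (fun ω => wallWeight q x (ω e₁) (ω e₂)) E := fun ω ω' h => by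
  simp only [h _ h₁, h _ h₂]

theorem realizes_sweepOut (y : ℕ → ℂ) {n m k : ℕ} (hm : m ≤ n) (hk : k < m) :
    Realizes (outEdges n m (k + 1)) (fun ω => ∏ j ∈ Finset.range (k + 1), outWeight q n y m j ω)
      (rightCut n m (k + 1)) (topCut n (m - 1)) (sweepOut q y m k) := by
  have hcut : rightCut n m 0 = topCut n (m - 1) := by
    ext j : 1
    simp only [rightCut, topCut]
    split_ifs <;> first | rfl | omega | (simp; done) | (simp; omega)
  have step : ∀ c < m, Realizes {horiz (n + 1 - m) (n + c), vert (n + 2 - m) (n + 1 + c)}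
      (outWeight q n y m c) (rightCut n m (c + 1)) (rightCut n m c)
      (crossing q m c (y m * y c)) := by
    intro c hc
    have e1 : rightCut n m c m = horiz (n + 1 - m) (n + c) := by simp [rightCut]
    have e2 : rightCut n m c c = vert (n + 2 - m) (n + 1 + c) := by
      simp [rightCut, hc.ne, hc.not_gt]
    have e3 : rightCut n m (c + 1) m = horiz (n + 1 - m) (n + 1 + c) := by
      simp [rightCut]; omega
    have e4 : rightCut n m (c + 1) c = vert (n + 1 - m) (n + 1 + c) := by
      simp [rightCut, hc.ne, hc.not_gt]
    have h := Realizes.crossing (q := q) (i := m) (j := c) (by omega) (y m * y c)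
      (out := rightCut n m (c + 1)) (inn := rightCut n m c) ?_ ?_ ?_
    · rw [e1, e2, e3, e4] at h
      exact h
    · rw [e1, e2]; simp
    · intro k
      rw [e1, e2]
      simp only [rightCut]
      split_ifs <;> first | rfl | omega | (simp; done) | (simp; omega)
    · intro k h1 h2
      simp only [rightCut]
      split_ifs <;> first | rfl | omega
  induction k with
  | zero =>
    have h := step 0 hk
    rw [hcut] at h
    simp only [Finset.range_one, Finset.prod_singleton, zero_add]
    convert h using 1
    · refine edge_ext (fun i j => ?_) fun i j => ?_
      · rw [outEdges, vert_mem_edgesWhere]; simp [edgeCond]; omega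
      · rw [outEdges, horiz_mem_edgesWhere]; simp [edgeCond]; omega
    · rfl
  | succ k ih =>
    have h := (step (k + 1) hk).mul (ih (by omega)) ?_ ?_
    · simp only [Finset.prod_range_succ _ (k + 1), mul_comm _ (outWeight q n y m (k + 1) _)]
      convert h using 1
      · refine edge_ext (fun i j => ?_) fun i j => ?_
        · rw [outEdges, outEdges, Finset.mem_union, vert_mem_edgesWhere, vert_mem_edgesWhere]
          simp [edgeCond]; omega
        · rw [outEdges, outEdges, Finset.mem_union, horiz_mem_edgesWhere, horiz_mem_edgesWhere]
          simp [edgeCond]; omega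
      · rfl
    · rw [Finset.disjoint_insert_left, Finset.disjoint_singleton_left, outEdges,
        vert_mem_edgesWhere, horiz_mem_edgesWhere]
      simp [edgeCond]
    · apply crossWeight_indepOf <;> rw [outEdges] <;>
        first | rw [vert_mem_edgesWhere] | rw [horiz_mem_edgesWhere]
      all_goals simp [edgeCond]; try omega

theorem realizes_sweepIn (y : ℕ → ℂ) {n m k : ℕ} (hm : m ≤ n) (hk : k < m) :
    Realizes (inEdges n m k) (fun ω => ∏ j ∈ Finset.range k, inWeight q n y m (j + 1) ω)
      (sourceCut n (m - 1)) (leftCut n m k) (sweepIn q y m k) := by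
  have hcut : leftCut n m 0 = sourceCut n (m - 1) := by
    ext j : 1
    simp only [leftCut, sourceCut]
    split_ifs <;> first | rfl | omega | (simp; done) | (simp; omega)
  have step : ∀ c, c + 1 < m → Realizes {horiz (n + 1 - m) (n - (c + 1)), vert (n + 1 - m) (n - c)}
      (inWeight q n y m (c + 1)) (leftCut n m c) (leftCut n m (c + 1))
      (crossing q m (c + 1) (y m * y (c + 1))⁻¹) := by
    intro c hc
    have e1 : leftCut n m (c + 1) m = horiz (n + 1 - m) (n - (c + 1)) := by
      simp [leftCut]; omega
    have e2 : leftCut n m (c + 1) (c + 1) = vert (n + 1 - m) (n - c) := by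
      simp [leftCut, hc.ne, hc.not_gt]
    have e3 : leftCut n m c m = horiz (n + 1 - m) (n - c) := by
      simp [leftCut]; omega
    have e4 : leftCut n m c (c + 1) = vert (n + 2 - m) (n - c) := by
      simp [leftCut, hc.ne, hc.not_gt]
    have h := Realizes.crossing (q := q) (i := m) (j := c + 1) (by omega) (y m * y (c + 1))⁻¹
      (out := leftCut n m c) (inn := leftCut n m (c + 1)) ?_ ?_ ?_
    · rw [e1, e2, e3, e4] at h
      have e5 : n + 1 - (c + 1) = n - c := by omega
      change Realizes _ (fun ω => inWeight q n y m (c + 1) ω) _ _ _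
      simp only [inWeight, e5]
      exact h
    · rw [e1, e2]; simp
    · intro k
      rw [e1, e2]
      simp only [leftCut]
      split_ifs <;> first | rfl | omega | (simp; done) | (simp; omega)
    · intro k h1 h2
      simp only [leftCut]
      split_ifs <;> first | rfl | omega
  induction k with
  | zero =>
    rw [hcut]
    have h := Realizes.one (sourceCut n (m - 1))
    simp only [Finset.range_zero, Finset.prod_empty]
    convert h using 1
    · refine edge_ext (fun i j => ?_) fun i j => ?_
      · rw [inEdges, vert_mem_edgesWhere]; simp [edgeCond]
      · rw [inEdges, horiz_mem_edgesWhere]; simp [edgeCond]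
    · rfl
  | succ k ih =>
    have h := (ih (by omega)).mul (step k hk) ?_ ?_
    · simp only [Finset.prod_range_succ _ k]
      convert h using 1
      · refine edge_ext (fun i j => ?_) fun i j => ?_
        · rw [inEdges, inEdges, Finset.mem_union, vert_mem_edgesWhere, vert_mem_edgesWhere]
          simp [edgeCond]; omega
        · rw [inEdges, inEdges, Finset.mem_union, horiz_mem_edgesWhere, horiz_mem_edgesWhere]
          simp [edgeCond]; omega
      · rfl
    · rw [Finset.disjoint_insert_right, Finset.disjoint_singleton_right, inEdges,
        vert_mem_edgesWhere, horiz_mem_edgesWhere]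
      simp [edgeCond]; omega
    · refine IndepOf.prod fun j hj => ?_
      rw [Finset.mem_range] at hj
      apply crossWeight_indepOf <;> simp <;> omega

/-- The edges in and below the rows of the lines `1, …, m`, including those by which the lines enter
these rows and excluding those by which they leave. -/
noncomputable def innerEdges (n m : ℕ) : Finset Edge := edgesWhere n (edgeCond
  (fun i j => (j ≤ n ∧ n + 1 ≤ i + m) ∨ (n < j ∧ n + 2 ≤ i + m)) fun i _ => n + 1 ≤ i + m)

/-- The weight of the row of the line `m`. -/
noncomputable def rowWeight (q : ℂ) (n : ℕ) (y : ℕ → ℂ) (m : ℕ) (ω : Edge → Bool) : ℂ :=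
  wallWeight q (y m) (ω (horiz (n + 1 - m) (n + m))) (ω (vert (n + 1 - m) (n + 1 + m))) *
    (∏ j ∈ Finset.range m, outWeight q n y m j ω) *
    ((∏ j ∈ Finset.range (m - 1), inWeight q n y m (j + 1) ω) *
      wallWeight q (y m)⁻¹ (ω (vert (n + 1 - m) (n + 1 - m))) (ω (horiz (n + 1 - m) (n + 1 - m))))

/-- The right half of a row, with its central vertex. -/
theorem realizes_rowOut (y : ℕ → ℂ) {n m : ℕ} (hm : m + 1 ≤ n) :
    Realizes ({horiz (n + 1 - (m + 1)) (n + (m + 1))} ∪ outEdges n (m + 1) (m + 1))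
      (fun ω => wallWeight q (y (m + 1)) (ω (horiz (n + 1 - (m + 1)) (n + (m + 1))))
          (ω (vert (n + 1 - (m + 1)) (n + 1 + (m + 1)))) *
        ∏ j ∈ Finset.range (m + 1), outWeight q n y (m + 1) j ω)
      (topCut n (m + 1)) (topCut n m)
      (wall q (m + 1) (y (m + 1)) * sweepOut q y (m + 1) m) := by
  have w1 : Realizes {horiz (n + 1 - (m + 1)) (n + (m + 1))}
      (fun ω => wallWeight q (y (m + 1)) (ω (horiz (n + 1 - (m + 1)) (n + (m + 1))))
        (ω (vert (n + 1 - (m + 1)) (n + 1 + (m + 1)))))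
      (topCut n (m + 1)) (rightCut n (m + 1) (m + 1)) (wall q (m + 1) (y (m + 1))) := by
    have e1 : rightCut n (m + 1) (m + 1) (m + 1) = horiz (n + 1 - (m + 1)) (n + (m + 1)) := by
      simp [rightCut]
    have e2 : topCut n (m + 1) (m + 1) = vert (n + 1 - (m + 1)) (n + 1 + (m + 1)) := by
      simp [topCut]
    have h := Realizes.wall (q := q) (i := m + 1) (y (m + 1)) (out := topCut n (m + 1))
      (inn := rightCut n (m + 1) (m + 1)) ?_ ?_
    · rw [e1, e2] at h; exact h
    · intro k
      rw [e1]
      simp only [topCut]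
      split_ifs <;> first | rfl | omega | simp
    · intro k hk
      simp only [topCut, rightCut]
      split_ifs <;> first | rfl | omega
  refine w1.mul (realizes_sweepOut (q := q) y (m := m + 1) (k := m) hm (by omega)) ?_ ?_
  · rw [Finset.disjoint_singleton_left, outEdges, horiz_mem_edgesWhere]
    simp [edgeCond]
  · apply wallWeight_indepOf
    · rw [outEdges, horiz_mem_edgesWhere]
      simp [edgeCond]
    · rw [outEdges, vert_mem_edgesWhere]
      simp [edgeCond]

/-- The left half of a row. -/
theorem realizes_rowIn (y : ℕ → ℂ) {n m : ℕ} (hm : m + 1 ≤ n) :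
    Realizes (inEdges n (m + 1) m ∪ {vert (n + 1 - (m + 1)) (n + 1 - (m + 1))})
      (fun ω => (∏ j ∈ Finset.range m, inWeight q n y (m + 1) (j + 1) ω) *
        wallWeight q (y (m + 1))⁻¹ (ω (vert (n + 1 - (m + 1)) (n + 1 - (m + 1))))
          (ω (horiz (n + 1 - (m + 1)) (n + 1 - (m + 1)))))
      (sourceCut n m) (sourceCut n (m + 1))
      (sweepIn q y (m + 1) m * wall q (m + 1) (y (m + 1))⁻¹) := by
  have w2 : Realizes {vert (n + 1 - (m + 1)) (n + 1 - (m + 1))}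
      (fun ω => wallWeight q (y (m + 1))⁻¹ (ω (vert (n + 1 - (m + 1)) (n + 1 - (m + 1))))
        (ω (horiz (n + 1 - (m + 1)) (n + 1 - (m + 1)))))
      (leftCut n (m + 1) m) (sourceCut n (m + 1)) (wall q (m + 1) (y (m + 1))⁻¹) := by
    have e1 : sourceCut n (m + 1) (m + 1) = vert (n + 1 - (m + 1)) (n + 1 - (m + 1)) := by
      simp [sourceCut]
    have e2 : leftCut n (m + 1) m (m + 1) = horiz (n + 1 - (m + 1)) (n + 1 - (m + 1)) := by
      simp [leftCut]
    have h := Realizes.wall (q := q) (i := m + 1) (y (m + 1))⁻¹ (out := leftCut n (m + 1) m)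
      (inn := sourceCut n (m + 1)) ?_ ?_
    · rw [e1, e2] at h; exact h
    · intro k
      rw [e1]
      simp only [leftCut]
      split_ifs <;> first | rfl | omega | (simp; done) | (simp; omega)
    · intro k hk
      simp only [leftCut, sourceCut]
      split_ifs <;> first | rfl | omega
  refine (realizes_sweepIn (q := q) y (m := m + 1) (k := m) hm (by omega)).mul w2 ?_ ?_
  · rw [Finset.disjoint_singleton_right, inEdges, vert_mem_edgesWhere]
    simp [edgeCond]
    omega
  · refine IndepOf.prod fun j hj => ?_
    rw [Finset.mem_range] at hj
    apply crossWeight_indepOf <;> simp <;> omega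

/-- The scattering of the lines `0, …, m` is the sum over the spins on the edges in the last `m`
rows. -/
theorem realizes_scattering (y : ℕ → ℂ) {n m : ℕ} (hm : m ≤ n) :
    Realizes (innerEdges n m) (fun ω => ∏ j ∈ Finset.range m, rowWeight q n y (j + 1) ω)
      (topCut n m) (sourceCut n m) (scattering q y m) := by
  induction m with
  | zero =>
    have hcut : topCut n 0 = sourceCut n 0 := by
      ext j : 1
      simp only [topCut, sourceCut]
      split_ifs <;> first | rfl | omega | (simp; done) | (simp; omega)
    rw [hcut]
    have h := Realizes.one (sourceCut n 0)
    simp only [Finset.range_zero, Finset.prod_empty]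
    convert h using 1
    · refine edge_ext (fun i j => ?_) fun i j => ?_
      · rw [innerEdges, vert_mem_edgesWhere]; simp [edgeCond]; omega
      · rw [innerEdges, horiz_mem_edgesWhere]; simp [edgeCond]; omega
    · rfl
  | succ m ih =>
    have r3 := (realizes_rowOut (q := q) y hm).mul (ih (by omega)) ?_ ?_
    · have r4 := r3.mul (realizes_rowIn (q := q) y hm) ?_ ?_
      · rw [scattering]
        convert r4 using 1
        · refine edge_ext (fun i j => ?_) fun i j => ?_
          · simp only [Finset.mem_union, innerEdges, outEdges, inEdges, vert_mem_edgesWhere,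
              Finset.mem_singleton]
            simp [edgeCond]; omega
          · simp only [Finset.mem_union, innerEdges, outEdges, inEdges, horiz_mem_edgesWhere,
              Finset.mem_singleton]
            simp [edgeCond]; omega
        · ext ω
          rw [Finset.prod_range_succ, rowWeight, Nat.add_sub_cancel]
          ring
      · refine edge_disjoint (fun i j => ?_) fun i j => ?_
        · simp only [Finset.mem_union, innerEdges, outEdges, inEdges, vert_mem_edgesWhere,
            Finset.mem_singleton]
          simp [edgeCond]
          omega
        · simp only [Finset.mem_union, innerEdges, outEdges, inEdges, horiz_mem_edgesWhere,
            Finset.mem_singleton]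
          simp [edgeCond]
          omega
      · have hv : ∀ i j, n < j ∨ n + 2 ≤ i + (m + 1) →
            vert i j ∉ inEdges n (m + 1) m ∪ {vert (n + 1 - (m + 1)) (n + 1 - (m + 1))} := by
          intro i j h
          simp only [Finset.mem_union, inEdges, vert_mem_edgesWhere, Finset.mem_singleton]
          simp [edgeCond]
          omega
        have hh : ∀ i j, n ≤ j ∨ n + 2 ≤ i + (m + 1) →
            horiz i j ∉ inEdges n (m + 1) m ∪ {vert (n + 1 - (m + 1)) (n + 1 - (m + 1))} := by
          intro i j h
          simp only [Finset.mem_union, inEdges, horiz_mem_edgesWhere, Finset.mem_singleton]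
          simp [edgeCond]
          omega
        refine (IndepOf.mul (wallWeight_indepOf (hh _ _ (by omega)) (hv _ _ (by omega)))
          (IndepOf.prod fun j hj => crossWeight_indepOf (hh _ _ (by omega)) (hv _ _ (by omega))
            (hh _ _ (by omega)) (hv _ _ (by omega)))).mul (IndepOf.prod fun j hj => ?_)
        have hj := Finset.mem_range.1 hj
        exact IndepOf.mul
          (IndepOf.mul (wallWeight_indepOf (hh _ _ (by omega)) (hv _ _ (by omega)))
            (IndepOf.prod fun k hk => crossWeight_indepOf (hh _ _ (by omega)) (hv _ _ (by omega))
              (hh _ _ (by omega)) (hv _ _ (by omega))))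
          (IndepOf.mul (IndepOf.prod fun k hk => crossWeight_indepOf (hh _ _ (by omega))
            (hv _ _ (by omega)) (hh _ _ (by omega)) (hv _ _ (by omega)))
            (wallWeight_indepOf (hv _ _ (by omega)) (hh _ _ (by omega))))
    · refine edge_disjoint (fun i j => ?_) fun i j => ?_
      · simp only [Finset.mem_union, innerEdges, outEdges, vert_mem_edgesWhere,
          Finset.mem_singleton]
        simp [edgeCond]
        omega
      · simp only [Finset.mem_union, innerEdges, outEdges, horiz_mem_edgesWhere,
          Finset.mem_singleton]
        simp [edgeCond]
        omega
    · have hv : ∀ i j, n < j → i + m ≤ n + 1 → vert i j ∉ innerEdges n m := by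
        intro i j h h'
        simp only [innerEdges, vert_mem_edgesWhere]
        simp [edgeCond]
        omega
      have hh : ∀ i j, i + m ≤ n → horiz i j ∉ innerEdges n m := by
        intro i j h
        simp only [innerEdges, horiz_mem_edgesWhere]
        simp [edgeCond]
        omega
      exact IndepOf.mul (wallWeight_indepOf (hh _ _ (by omega)) (hv _ _ (by omega) (by omega)))
        (IndepOf.prod fun j hj => crossWeight_indepOf (hh _ _ (by omega))
          (hv _ _ (by omega) (by omega)) (hh _ _ (by omega)) (hv _ _ (by omega) (by omega)))

end

/-! ### The partition function as an amplitude -/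

section

variable {q : ℂ}

/-- The bulk weight at the vertex `(i, j)`, extended by `0` to orientations violating the six-vertex
rule. -/
noncomputable def ruleWeight (q u : ℂ) (C : Orientation) (i j : ℕ) : ℂ :=
  if SixVertexRule C i j then
    bulkWeight q u (leftIn C i j) (bottomIn C i j) (rightIn C i j) (topIn C i j) else 0

theorem crossWeight_eq_right (q u : ℂ) (a b a' b' : Bool) :
    crossWeight q u a b a' b' =
      if a.toNat + b.toNat + (!a').toNat + (!b').toNat = 2 then
        bulkWeight q u a b (!a') (!b') else 0 := by
  cases a <;> cases b <;> cases a' <;> cases b' <;> simp [crossWeight, bulkWeight, wt]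

theorem crossWeight_eq_left (q u : ℂ) (a b a' b' : Bool) :
    crossWeight q u⁻¹ a b a' b' =
      if a.toNat + (!b').toNat + (!a').toNat + b.toNat = 2 then
        bulkWeight q u a (!b') (!a') b else 0 := by
  cases a <;> cases b <;> cases a' <;> cases b' <;> simp [crossWeight, bulkWeight, wt]

theorem wallWeight_eq_right (q u : ℂ) (a a' : Bool) :
    wallWeight q u a a' = rightWeight q u a (!a') := by
  cases a <;> cases a' <;> simp [wallWeight, rightWeight, refl]

theorem wallWeight_eq_left (q u : ℂ) (a a' : Bool) :
    wallWeight q u⁻¹ a a' = leftWeight q u (!a') a := by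
  cases a <;> cases a' <;> simp [wallWeight, leftWeight, refl]

open Classical in
/-- The spins which are `true` on the inner edges in `X` and on all edges that are not inner. -/
noncomputable def spinsOn (n : ℕ) (X : Finset Edge) (e : Edge) : Bool :=
  if e ∈ innerEdges n n then decide (e ∈ X) else true

open Classical in
/-- The orientation encoded by a set `X` of inner edges with spin `true`. On horizontal edges and in
the columns `j > n` the lines travel rightwards and upwards, so that spin `true` is the direction
recorded by an `Orientation`; in the columns `j ≤ n` they travel downwards. The top edges of the
columns `j > n` are not inner and are directed upwards. -/
noncomputable def orientationOf (n : ℕ) (X : Finset Edge) : Orientation :=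
  ((vEdges n).filter fun e => if e.2 ≤ n then Sum.inl e ∉ X else e.1 = 1 ∨ Sum.inl e ∈ X,
    (hEdges n).filter fun e => Sum.inr e ∈ X)

open Classical in
/-- The inner edges with spin `true` in the orientation `C`. -/
noncomputable def alongEdges (n : ℕ) (C : Orientation) : Finset Edge :=
  (innerEdges n n).filter
    (Sum.elim (fun e => if e.2 ≤ n then e ∉ C.1 else e ∈ C.1) fun e => e ∈ C.2)

theorem vert_mem_inner {n i j : ℕ} : vert i j ∈ innerEdges n n ↔
    (1 ≤ i ∧ i ≤ n + 1 ∧ i ≤ j ∧ i + j ≤ 2 * n + 2) ∧ (n < j → i ≠ 1) := by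
  rw [innerEdges, vert_mem_edgesWhere]
  simp only [edgeCond, Sum.elim_inl]
  omega

theorem horiz_mem_inner {n i j : ℕ} : horiz i j ∈ innerEdges n n ↔
    (1 ≤ i ∧ i ≤ n ∧ i ≤ j ∧ i + j ≤ 2 * n + 1) := by
  rw [innerEdges, horiz_mem_edgesWhere]
  simp only [edgeCond, Sum.elim_inr]
  omega

theorem mem_vEdges {n i j : ℕ} : (i, j) ∈ vEdges n ↔
    1 ≤ i ∧ i ≤ n + 1 ∧ i ≤ j ∧ i + j ≤ 2 * n + 2 := by
  simp only [vEdges, Finset.mem_filter, Finset.mem_product, Finset.mem_Icc]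
  omega

theorem mem_hEdges {n i j : ℕ} : (i, j) ∈ hEdges n ↔
    1 ≤ i ∧ i ≤ n ∧ i ≤ j ∧ i + j ≤ 2 * n + 1 := by
  simp only [hEdges, Finset.mem_filter, Finset.mem_product, Finset.mem_Icc]
  omega

theorem spinsOn_vert_left {n i j : ℕ} {X : Finset Edge} (hi : 1 ≤ i) (hij : i ≤ j) (hj : j ≤ n) :
    spinsOn n X (vert i j) = !decide ((i, j) ∈ (orientationOf n X).1) := by
  have h : vert i j ∈ innerEdges n n := vert_mem_inner.2 ⟨by omega, by omega⟩
  have h' : (i, j) ∈ vEdges n := mem_vEdges.2 (by omega)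
  rw [spinsOn, if_pos h]
  simp [orientationOf, h', hj]

theorem spinsOn_vert_right {n i j : ℕ} {X : Finset Edge} (hi : 1 ≤ i) (hj : n < j)
    (hij : i + j ≤ 2 * n + 2) :
    spinsOn n X (vert i j) = decide ((i, j) ∈ (orientationOf n X).1) := by
  have h' : (i, j) ∈ vEdges n := mem_vEdges.2 (by omega)
  rcases eq_or_ne i 1 with rfl | h1
  · rw [spinsOn, if_neg fun h => (vert_mem_inner.1 h).2 hj rfl]
    simp [orientationOf, h', hj.not_ge]
  · rw [spinsOn, if_pos (vert_mem_inner.2 ⟨by omega, fun _ => h1⟩)]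
    simp [orientationOf, h', hj.not_ge, h1]

theorem spinsOn_horiz {n i j : ℕ} {X : Finset Edge} (hi : 1 ≤ i) (hn : i ≤ n) (hij : i ≤ j)
    (hj : i + j ≤ 2 * n + 1) :
    spinsOn n X (horiz i j) = decide ((i, j) ∈ (orientationOf n X).2) := by
  have h : horiz i j ∈ innerEdges n n := horiz_mem_inner.2 (by omega)
  have h' : (i, j) ∈ hEdges n := mem_hEdges.2 (by omega)
  rw [spinsOn, if_pos h]
  simp [orientationOf, h']

theorem outWeight_spinsOn {n m k : ℕ} (u : ℕ → ℂ) (X : Finset Edge) (hm : m ≤ n) (hk : k < m) :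
    outWeight q n (fun k => u (n + 1 - k)) m k (spinsOn n X) =
      ruleWeight q (u (n + 1 - m) * u (min (n + 1 + k) (2 * n + 2 - (n + 1 + k))))
        (orientationOf n X) (n + 1 - m) (n + 1 + k) := by
  have h1 : min (n + 1 + k) (2 * n + 2 - (n + 1 + k)) = n + 1 - k := by omega
  have h2 : n + 1 + k - 1 = n + k := by omega
  have h3 : n + 1 - m + 1 = n + 2 - m := by omega
  rw [outWeight, spinsOn_horiz (by omega) (by omega) (by omega) (by omega),
    spinsOn_horiz (by omega) (by omega) (by omega) (by omega),
    spinsOn_vert_right (by omega) (by omega) (by omega),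
    spinsOn_vert_right (by omega) (by omega) (by omega), crossWeight_eq_right, h1]
  simp only [ruleWeight, SixVertexRule, leftIn, rightIn, topIn, bottomIn, h2, h3, decide_not]

theorem inWeight_spinsOn {n m k : ℕ} (u : ℕ → ℂ) (X : Finset Edge) (hm : m ≤ n) (h1 : 1 ≤ k)
    (hk : k < m) :
    inWeight q n (fun k => u (n + 1 - k)) m k (spinsOn n X) =
      ruleWeight q (u (n + 1 - m) * u (min (n + 1 - k) (2 * n + 2 - (n + 1 - k))))
        (orientationOf n X) (n + 1 - m) (n + 1 - k) := by
  have h1 : min (n + 1 - k) (2 * n + 2 - (n + 1 - k)) = n + 1 - k := by omega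
  have h2 : n + 1 - k - 1 = n - k := by omega
  have h3 : n + 1 - m + 1 = n + 2 - m := by omega
  rw [inWeight, spinsOn_horiz (by omega) (by omega) (by omega) (by omega),
    spinsOn_horiz (by omega) (by omega) (by omega) (by omega),
    spinsOn_vert_left (by omega) (by omega) (by omega),
    spinsOn_vert_left (by omega) (by omega) (by omega), crossWeight_eq_left, h1]
  simp only [ruleWeight, SixVertexRule, leftIn, rightIn, topIn, bottomIn, h2, h3, decide_not,
    Bool.not_not]

/-- A product over a row, split at the central column. -/
theorem prod_row (n m : ℕ) (hm : m + 1 ≤ n) (g : ℕ → ℂ) :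
    ∏ j ∈ Finset.Icc (n - m + 1) (n + 1 + m), g j =
      (∏ j ∈ Finset.range (m + 1), g (n + 1 + j)) * ∏ j ∈ Finset.range m, g (n + 1 - (j + 1)) := by
  induction m with
  | zero => simp
  | succ m ih =>
    have h1 : n - (m + 1) + 1 = n - m := by omega
    have h2 : Finset.Icc (n - m) (n + 1 + m) =
        insert (n - m) (Finset.Icc (n - m + 1) (n + 1 + m)) := by
      ext j; simp only [Finset.mem_Icc, Finset.mem_insert]; omega
    have h3 : n + 1 - (m + 1) = n - m := by omega
    rw [h1, ← add_assoc, Finset.prod_Icc_succ_top (by omega), h2,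
      Finset.prod_insert (by simp), ih (by omega), Finset.prod_range_succ _ (m + 1),
      Finset.prod_range_succ _ m,
      Finset.prod_range_succ (fun j => g (n + 1 - (j + 1))) m, h3, ← add_assoc]
    ring

theorem rowWeight_spinsOn {n m i : ℕ} (u : ℕ → ℂ) (X : Finset Edge) (hm : m + 1 ≤ n)
    (hi : n + 1 - (m + 1) = i) :
    rowWeight q n (fun k => u (n + 1 - k)) (m + 1) (spinsOn n X) =
      leftWeight q (u i) (rightIn (orientationOf n X) i i) (topIn (orientationOf n X) i i) *
      (∏ j ∈ Finset.Icc (i + 1) (2 * n + 1 - i),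
        ruleWeight q (u i * u (min j (2 * n + 2 - j))) (orientationOf n X) i j) *
      rightWeight q (u i) (leftIn (orientationOf n X) i (2 * n + 2 - i))
        (topIn (orientationOf n X) i (2 * n + 2 - i)) := by
  have e1 : 2 * n + 1 - i = n + 1 + m := by omega
  have e2 : 2 * n + 2 - i = n + 1 + (m + 1) := by omega
  have e3 : i + 1 = n - m + 1 := by omega
  have e4 : n + 1 + (m + 1) - 1 = n + (m + 1) := by omega
  have h1 : ∏ j ∈ Finset.range (m + 1),
      outWeight q n (fun k => u (n + 1 - k)) (m + 1) j (spinsOn n X) =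
      ∏ j ∈ Finset.range (m + 1), ruleWeight q (u i * u (min (n + 1 + j)
        (2 * n + 2 - (n + 1 + j)))) (orientationOf n X) i (n + 1 + j) :=
    Finset.prod_congr rfl fun j hj => by
      rw [Finset.mem_range] at hj
      rw [outWeight_spinsOn u X hm hj, hi]
  have h2 : ∏ j ∈ Finset.range m,
      inWeight q n (fun k => u (n + 1 - k)) (m + 1) (j + 1) (spinsOn n X) =
      ∏ j ∈ Finset.range m, ruleWeight q (u i * u (min (n + 1 - (j + 1))
        (2 * n + 2 - (n + 1 - (j + 1))))) (orientationOf n X) i (n + 1 - (j + 1)) :=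
    Finset.prod_congr rfl fun j hj => by
      rw [Finset.mem_range] at hj
      rw [inWeight_spinsOn u X hm (by omega) (by omega), hi]
  rw [rowWeight, Nat.add_sub_cancel, h1, h2, e1, e3,
    prod_row n m hm fun j => ruleWeight q (u i * u (min j (2 * n + 2 - j))) (orientationOf n X) i j,
    hi, e2, spinsOn_horiz (by omega) (by omega) (by omega) (by omega),
    spinsOn_horiz (by omega) (by omega) (by omega) (by omega),
    spinsOn_vert_right (by omega) (by omega) (by omega),
    spinsOn_vert_left (by omega) (by omega) (by omega), wallWeight_eq_right, wallWeight_eq_left]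
  simp only [rightIn, leftIn, topIn, e4, decide_not]
  ring

/-- The contribution of the configuration `C` to the partition function. -/
noncomputable def configurationWeight (n : ℕ) (q : ℂ) (u : ℕ → ℂ) (C : Orientation) : ℂ :=
  ∏ i ∈ Finset.Icc 1 n,
    leftWeight q (u i) (rightIn C i i) (topIn C i i) *
    (∏ j ∈ Finset.Icc (i + 1) (2 * n + 1 - i),
      bulkWeight q (u i * u (min j (2 * n + 2 - j)))
        (leftIn C i j) (bottomIn C i j) (rightIn C i j) (topIn C i j)) *
    rightWeight q (u i) (leftIn C i (2 * n + 2 - i)) (topIn C i (2 * n + 2 - i))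

open Classical in
/-- The product of the row weights and of the incoming state is the weight of the corresponding
orientation, and it vanishes unless that orientation is a configuration. -/
theorem prod_rowWeight_mul_incoming (n : ℕ) (u : ℕ → ℂ) (X : Finset Edge) :
    (∏ m ∈ Finset.range n, rowWeight q n (fun k => u (n + 1 - k)) (m + 1) (spinsOn n X)) *
        incoming n (spinsOn n X ∘ sourceCut n n) =
      if IsConfiguration n (orientationOf n X) then
        configurationWeight n q u (orientationOf n X) else 0 := by
  set C := orientationOf n X with hC
  have h1 : ∏ m ∈ Finset.range n, rowWeight q n (fun k => u (n + 1 - k)) (m + 1) (spinsOn n X) =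
      ∏ i ∈ Finset.Icc 1 n, if ∀ j ∈ Finset.Icc (i + 1) (2 * n + 1 - i), SixVertexRule C i j then
        leftWeight q (u i) (rightIn C i i) (topIn C i i) *
        (∏ j ∈ Finset.Icc (i + 1) (2 * n + 1 - i),
          bulkWeight q (u i * u (min j (2 * n + 2 - j)))
            (leftIn C i j) (bottomIn C i j) (rightIn C i j) (topIn C i j)) *
        rightWeight q (u i) (leftIn C i (2 * n + 2 - i)) (topIn C i (2 * n + 2 - i)) else 0 := by
    refine Finset.prod_nbij' (fun m => n - m) (fun i => n - i) ?_ ?_ ?_ ?_ ?_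
    · intro m hm; rw [Finset.mem_range] at hm; rw [Finset.mem_Icc]; omega
    · intro m hm; rw [Finset.mem_Icc] at hm; rw [Finset.mem_range]; omega
    · intro m hm; rw [Finset.mem_range] at hm; omega
    · intro m hm; rw [Finset.mem_Icc] at hm; omega
    · intro m hm
      rw [Finset.mem_range] at hm
      rw [rowWeight_spinsOn u X (by omega) (show n + 1 - (m + 1) = n - m by omega)]
      simp only [ruleWeight, Finset.prod_ite_zero, ← hC]
      split_ifs
      · rfl
      · ring
  have h2 : (∀ k ∈ Finset.Icc 1 n, (spinsOn n X ∘ sourceCut n n) k = false) ↔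
      ∀ j ∈ Finset.Icc 1 (2 * n + 1), (1, j) ∈ C.1 := by
    have h3 : ∀ k ∈ Finset.Icc 1 n, ((spinsOn n X ∘ sourceCut n n) k = false ↔
        (1, n + 1 - k) ∈ C.1) := by
      intro k hk
      rw [Finset.mem_Icc] at hk
      have : sourceCut n n k = vert 1 (n + 1 - k) := by
        rw [sourceCut, if_neg (by omega), if_neg (by omega), show n + 1 - n = 1 by omega]
      rw [Function.comp_apply, this, spinsOn_vert_left le_rfl (by omega) (by omega)]
      simp [hC]
    refine ⟨fun h j hj => ?_, fun h k hk => (h3 k hk).2 (h _ ?_)⟩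
    · rw [Finset.mem_Icc] at hj
      rcases le_or_gt j n with hjn | hjn
      · have := (h3 (n + 1 - j) (Finset.mem_Icc.2 (by omega))).1
          (h _ (Finset.mem_Icc.2 (by omega)))
        rwa [show n + 1 - (n + 1 - j) = j by omega] at this
      · rw [hC, orientationOf, Finset.mem_filter]
        refine ⟨mem_vEdges.2 (by omega), ?_⟩
        simp [hjn.not_ge]
    · rw [Finset.mem_Icc] at hk ⊢; omega
  rw [h1, incoming]
  by_cases h3 : ∀ j ∈ Finset.Icc 1 (2 * n + 1), (1, j) ∈ C.1
  swap
  · rw [if_neg (mt h2.1 h3), if_neg fun h : IsConfiguration n C => h3 h.1, mul_zero]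
  by_cases h4 : ∀ i ∈ Finset.Icc 1 n, ∀ j ∈ Finset.Icc (i + 1) (2 * n + 1 - i),
      SixVertexRule C i j
  · rw [if_pos (h2.2 h3), if_pos (show IsConfiguration n C from ⟨h3, h4⟩), mul_one]
    exact Finset.prod_congr rfl fun i hi => if_pos (h4 i hi)
  · rw [if_neg fun h : IsConfiguration n C => h4 h.2]
    simp only [not_forall] at h4
    obtain ⟨i, hi, h5⟩ := h4
    rw [Finset.prod_eq_zero hi (if_neg (not_forall₂.2 h5)), zero_mul]

theorem orientationOf_mem_orientations (n : ℕ) (X : Finset Edge) :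
    orientationOf n X ∈ orientations n := by
  simp [orientationOf, orientations, Finset.filter_subset]

theorem alongEdges_orientationOf {n : ℕ} {X : Finset Edge} (hX : X ⊆ innerEdges n n) :
    alongEdges n (orientationOf n X) = X := by
  classical
  refine edge_ext (fun i j => ?_) fun i j => ?_
  · rw [alongEdges, Finset.mem_filter]
    refine ⟨fun ⟨h1, h2⟩ => ?_, fun h => ⟨hX h, ?_⟩⟩
    · have h3 := vert_mem_inner.1 h1
      have h4 : (i, j) ∈ vEdges n := mem_vEdges.2 h3.1
      simp only [Sum.elim_inl, orientationOf, Finset.mem_filter, h4, true_and] at h2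
      by_cases hj : j ≤ n
      · simpa [hj] using h2
      · simp only [hj, if_false] at h2
        exact h2.resolve_left (h3.2 (by omega))
    · have h4 : (i, j) ∈ vEdges n := mem_vEdges.2 (vert_mem_inner.1 (hX h)).1
      simp only [Sum.elim_inl, orientationOf, Finset.mem_filter, h4, true_and]
      by_cases hj : j ≤ n
      · simpa [hj] using h
      · simpa [hj] using Or.inr h
  · rw [alongEdges, Finset.mem_filter]
    refine ⟨fun ⟨h1, h2⟩ => ?_, fun h => ⟨hX h, ?_⟩⟩
    · simp only [Sum.elim_inr, orientationOf, Finset.mem_filter] at h2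
      exact h2.2
    · have h4 : (i, j) ∈ hEdges n := mem_hEdges.2 (horiz_mem_inner.1 (hX h))
      simp only [Sum.elim_inr, orientationOf, Finset.mem_filter, h4, true_and]
      exact h

theorem orientationOf_alongEdges {n : ℕ} {C : Orientation} (hC : C ∈ configurations n) :
    orientationOf n (alongEdges n C) = C := by
  rw [configurations, Finset.mem_filter, orientations, Finset.mem_product, Finset.mem_powerset,
    Finset.mem_powerset] at hC
  obtain ⟨⟨hv, hh⟩, htop, -⟩ := hC
  refine Prod.ext ?_ ?_
  · ext ⟨i, j⟩
    simp only [orientationOf, Finset.mem_filter, alongEdges, Sum.elim_inl]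
    by_cases hij : (i, j) ∈ vEdges n
    swap
    · exact ⟨fun h => absurd h.1 hij, fun h => absurd (hv h) hij⟩
    have h1 := mem_vEdges.1 hij
    by_cases hj : j ≤ n
    · have h2 : (Sum.inl (i, j) : Edge) ∈ innerEdges n n := vert_mem_inner.2 ⟨h1, by omega⟩
      simp [hij, hj, h2]
    · by_cases hi : i = 1
      · subst hi
        have h3 := htop j (Finset.mem_Icc.2 (by omega))
        simp [hij, hj, h3]
      · have h2 : (Sum.inl (i, j) : Edge) ∈ innerEdges n n := vert_mem_inner.2 ⟨h1, fun _ => hi⟩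
        simp [hij, hj, h2, hi]
  · ext ⟨i, j⟩
    simp only [orientationOf, Finset.mem_filter, alongEdges, Sum.elim_inr]
    by_cases hij : (i, j) ∈ hEdges n
    swap
    · exact ⟨fun h => absurd h.1 hij, fun h => absurd (hh h) hij⟩
    have h2 : (Sum.inr (i, j) : Edge) ∈ innerEdges n n := horiz_mem_inner.2 (mem_hEdges.1 hij)
    simp [hij, h2]

/-- The partition function is a scattering amplitude. The line `k` is made up of the row `n + 1 - k`
and of the two columns that end in it, the line `0` is the central column. -/
theorem Z_eq_amplitude (n : ℕ) (q : ℂ) (u : ℕ → ℂ) :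
    Z n q u = amplitude q n fun k => u (n + 1 - k) := by
  classical
  have h := realizes_scattering (q := q) (fun k => u (n + 1 - k)) (le_refl n) (incoming n)
    (fun _ => true)
  rw [amplitude, show (fun _ : ℕ => true) = (fun _ : Edge => true) ∘ topCut n n from rfl, h,
    spinSum]
  have h1 : ∀ X ∈ (innerEdges n n).powerset,
      (fun ω : Edge → Bool =>
        (∏ j ∈ Finset.range n, rowWeight q n (fun k => u (n + 1 - k)) (j + 1) ω) *
          incoming n (ω ∘ sourceCut n n))
        (fun e => if e ∈ innerEdges n n then decide (e ∈ X) else true) =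
      if IsConfiguration n (orientationOf n X) then
        configurationWeight n q u (orientationOf n X) else 0 := by
    intro X _
    rw [← prod_rowWeight_mul_incoming]
    have : (fun e => if e ∈ innerEdges n n then decide (e ∈ X) else true) = spinsOn n X := by
      ext e; rw [spinsOn]
    rw [this]
  rw [Finset.sum_congr rfl h1, ← Finset.sum_filter]
  symm
  refine Finset.sum_nbij' (orientationOf n) (alongEdges n) ?_ ?_ ?_ ?_ ?_
  · intro X hX
    rw [configurations, Finset.mem_filter]
    exact ⟨orientationOf_mem_orientations n X, (Finset.mem_filter.1 hX).2⟩
  · intro C hC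
    rw [Finset.mem_filter, orientationOf_alongEdges hC, Finset.mem_powerset]
    exact ⟨Finset.filter_subset _ _, (Finset.mem_filter.1 hC).2⟩
  · intro X hX
    exact alongEdges_orientationOf (Finset.mem_powerset.1 (Finset.mem_filter.1 hX).1)
  · intro C hC
    exact orientationOf_alongEdges hC
  · intro X _
    rfl

end

/-! ### Reflection in the central column -/

section

variable {q : ℂ}

/-- The reflection of a configuration in the central column. The direction of horizontal edges is
reversed. -/
def mirror (n : ℕ) (C : Orientation) : Orientation :=
  ((vEdges n).filter fun e => (e.1, 2 * n + 2 - e.2) ∈ C.1,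
    (hEdges n).filter fun e => (e.1, 2 * n + 1 - e.2) ∉ C.2)

section mirror
variable {n i j : ℕ} {C : Orientation}

theorem mem_mirror_fst (h1 : 1 ≤ i) (h2 : i ≤ n + 1) (h3 : i ≤ j) (h4 : i + j ≤ 2 * n + 2) :
    (i, j) ∈ (mirror n C).1 ↔ (i, 2 * n + 2 - j) ∈ C.1 := by
  have h : (i, j) ∈ vEdges n := mem_vEdges.2 ⟨h1, h2, h3, h4⟩
  simp [mirror, h]

theorem mem_mirror_snd (h1 : 1 ≤ i) (h2 : i ≤ n) (h3 : i ≤ j) (h4 : i + j ≤ 2 * n + 1) :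
    (i, j) ∈ (mirror n C).2 ↔ (i, 2 * n + 1 - j) ∉ C.2 := by
  have h : (i, j) ∈ hEdges n := mem_hEdges.2 ⟨h1, h2, h3, h4⟩
  simp [mirror, h]

theorem mirror_mirror (hC : C ∈ configurations n) : mirror n (mirror n C) = C := by
  rw [configurations, Finset.mem_filter, orientations, Finset.mem_product, Finset.mem_powerset,
    Finset.mem_powerset] at hC
  obtain ⟨⟨hv, hh⟩, -⟩ := hC
  refine Prod.ext ?_ ?_
  · ext ⟨i, j⟩
    by_cases hij : (i, j) ∈ vEdges n
    · have h := mem_vEdges.1 hij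
      rw [mem_mirror_fst (by omega) (by omega) (by omega) (by omega),
        mem_mirror_fst (by omega) (by omega) (by omega) (by omega),
        show 2 * n + 2 - (2 * n + 2 - j) = j by omega]
    · exact ⟨fun h => absurd (Finset.mem_filter.1 h).1 hij, fun h => absurd (hv h) hij⟩
  · ext ⟨i, j⟩
    by_cases hij : (i, j) ∈ hEdges n
    · have h := mem_hEdges.1 hij
      rw [mem_mirror_snd (by omega) (by omega) (by omega) (by omega),
        mem_mirror_snd (by omega) (by omega) (by omega) (by omega),
        show 2 * n + 1 - (2 * n + 1 - j) = j by omega, not_not]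
    · exact ⟨fun h => absurd (Finset.mem_filter.1 h).1 hij, fun h => absurd (hh h) hij⟩

theorem topIn_mirror (h1 : 1 ≤ i) (h2 : i ≤ n) (h3 : i ≤ j) (h4 : i + j ≤ 2 * n + 2) :
    topIn (mirror n C) i j = topIn C i (2 * n + 2 - j) := by
  simp only [topIn, mem_mirror_fst h1 (by omega : i ≤ n + 1) h3 h4]

theorem bottomIn_mirror (h2 : i ≤ n) (h3 : i + 1 ≤ j) (h4 : i + j ≤ 2 * n + 1) :
    bottomIn (mirror n C) i j = bottomIn C i (2 * n + 2 - j) := by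
  simp only [bottomIn, mem_mirror_fst (by omega : 1 ≤ i + 1) (by omega : i + 1 ≤ n + 1) h3
    (by omega)]

theorem leftIn_mirror (h1 : 1 ≤ i) (h2 : i ≤ n) (h3 : i + 1 ≤ j) (h4 : i + j ≤ 2 * n + 2) :
    leftIn (mirror n C) i j = rightIn C i (2 * n + 2 - j) := by
  simp only [leftIn, rightIn, mem_mirror_snd h1 h2 (by omega : i ≤ j - 1) (by omega),
    show 2 * n + 1 - (j - 1) = 2 * n + 2 - j by omega]

theorem rightIn_mirror (h1 : 1 ≤ i) (h2 : i ≤ n) (h3 : i ≤ j) (h4 : i + j ≤ 2 * n + 1) :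
    rightIn (mirror n C) i j = leftIn C i (2 * n + 2 - j) := by
  simp only [leftIn, rightIn, mem_mirror_snd h1 h2 h3 h4, not_not,
    show 2 * n + 2 - j - 1 = 2 * n + 1 - j by omega]

theorem sixVertexRule_mirror (h1 : 1 ≤ i) (h2 : i ≤ n) (h3 : i + 1 ≤ j)
    (h4 : i + j ≤ 2 * n + 1) :
    SixVertexRule (mirror n C) i j ↔ SixVertexRule C i (2 * n + 2 - j) := by
  rw [SixVertexRule, SixVertexRule, topIn_mirror h1 h2 (by omega) (by omega),
    bottomIn_mirror h2 h3 h4, leftIn_mirror h1 h2 h3 (by omega), rightIn_mirror h1 h2 (by omega) h4]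
  omega

theorem mirror_mem_configurations (hC : C ∈ configurations n) :
    mirror n C ∈ configurations n := by
  rw [configurations, Finset.mem_filter] at hC ⊢
  refine ⟨by simp [mirror, orientations, Finset.filter_subset], fun j hj => ?_, fun i hi j hj => ?_⟩
  · rw [Finset.mem_Icc] at hj
    rw [mem_mirror_fst (by omega) (by omega) (by omega) (by omega)]
    exact hC.2.1 _ (Finset.mem_Icc.2 (by omega))
  · rw [Finset.mem_Icc] at hi hj
    rw [sixVertexRule_mirror (by omega) (by omega) (by omega) (by omega)]
    exact hC.2.2 i (Finset.mem_Icc.2 hi) _ (Finset.mem_Icc.2 (by omega))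

theorem bulkWeight_swap (q x : ℂ) {l b r t : Bool}
    (h : l.toNat + b.toNat + r.toNat + t.toNat = 2) :
    bulkWeight q x⁻¹ r b l t = bulkWeight q x l b r t := by
  cases l <;> cases b <;> cases r <;> cases t <;> simp_all [bulkWeight]

theorem configurationWeight_mirror (u : ℕ → ℂ) (hC : C ∈ configurations n) :
    configurationWeight n q (fun i => (u i)⁻¹) (mirror n C) = configurationWeight n q u C := by
  rw [configurations, Finset.mem_filter] at hC
  refine Finset.prod_congr rfl fun i hi => ?_
  have hi' := Finset.mem_Icc.1 hi
  have h1 : ∏ j ∈ Finset.Icc (i + 1) (2 * n + 1 - i),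
      bulkWeight q ((u i)⁻¹ * (u (min j (2 * n + 2 - j)))⁻¹) (leftIn (mirror n C) i j)
        (bottomIn (mirror n C) i j) (rightIn (mirror n C) i j) (topIn (mirror n C) i j) =
      ∏ j ∈ Finset.Icc (i + 1) (2 * n + 1 - i), bulkWeight q (u i * u (min j (2 * n + 2 - j)))
        (leftIn C i j) (bottomIn C i j) (rightIn C i j) (topIn C i j) := by
    refine Finset.prod_nbij' (fun j => 2 * n + 2 - j) (fun j => 2 * n + 2 - j) ?_ ?_ ?_ ?_ ?_
    · intro j hj; rw [Finset.mem_Icc] at hj ⊢; omega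
    · intro j hj; rw [Finset.mem_Icc] at hj ⊢; omega
    · intro j hj; rw [Finset.mem_Icc] at hj; omega
    · intro j hj; rw [Finset.mem_Icc] at hj; omega
    · intro j hj
      have hr := hC.2.2 i hi (2 * n + 2 - j) (by rw [Finset.mem_Icc] at hj ⊢; omega)
      rw [Finset.mem_Icc] at hj
      rw [topIn_mirror (by omega) (by omega) (by omega) (by omega),
        bottomIn_mirror (by omega) (by omega) (by omega),
        leftIn_mirror (by omega) (by omega) (by omega) (by omega),
        rightIn_mirror (by omega) (by omega) (by omega) (by omega), ← mul_inv,
        bulkWeight_swap _ _ hr, show 2 * n + 2 - (2 * n + 2 - j) = j by omega, min_comm]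
  rw [h1, rightIn_mirror (by omega) (by omega) (by omega) (by omega),
    topIn_mirror (by omega) (by omega) (by omega) (by omega),
    leftIn_mirror (by omega) (by omega) (by omega) (by omega),
    topIn_mirror (by omega) (by omega) (by omega) (by omega),
    show 2 * n + 2 - (2 * n + 2 - i) = i by omega]
  simp only [leftWeight, rightWeight, inv_inv]
  ring

/-- Reflection in the central column inverts all parameters. -/
theorem Z_inv (n : ℕ) (q : ℂ) (u : ℕ → ℂ) : Z n q (fun i => (u i)⁻¹) = Z n q u := by
  symm
  refine Finset.sum_nbij' (mirror n) (mirror n) (fun C hC => mirror_mem_configurations hC)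
    (fun C hC => mirror_mem_configurations hC) (fun C hC => mirror_mirror hC)
    (fun C hC => mirror_mirror hC) fun C hC => ?_
  exact (configurationWeight_mirror u hC).symm

end mirror

/-! ### Functions that agree with polynomials -/

open Polynomial in
/-- Away from `0`, the function `g` agrees with a polynomial of degree at most `d`. -/
def IsPoly (d : ℕ) (g : ℂ → ℂ) : Prop :=
  ∃ P : ℂ[X], P.natDegree ≤ d ∧ ∀ w, w ≠ 0 → g w = P.eval w

namespace IsPoly
open Polynomial
variable {d e : ℕ} {g h : ℂ → ℂ}

theorem const (c : ℂ) : IsPoly 0 fun _ => c := ⟨C c, by simp, by simp⟩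

theorem id : IsPoly 1 fun w => w := ⟨X, by simp, by simp⟩

theorem mono (hg : IsPoly d g) (hde : d ≤ e) : IsPoly e g :=
  let ⟨P, h1, h2⟩ := hg; ⟨P, h1.trans hde, h2⟩

theorem congr (hg : IsPoly d g) (hgh : ∀ w, w ≠ 0 → h w = g w) : IsPoly d h :=
  let ⟨P, h1, h2⟩ := hg; ⟨P, h1, fun w hw => (hgh w hw).trans (h2 w hw)⟩

theorem add (hg : IsPoly d g) (hh : IsPoly d h) : IsPoly d fun w => g w + h w :=
  let ⟨P, h1, h2⟩ := hg
  let ⟨Q, h3, h4⟩ := hh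
  ⟨P + Q, natDegree_add_le_of_degree_le h1 h3, fun w hw => by
    simp only [h2 w hw, h4 w hw, eval_add]⟩

theorem mul (hg : IsPoly d g) (hh : IsPoly e h) : IsPoly (d + e) fun w => g w * h w :=
  let ⟨P, h1, h2⟩ := hg
  let ⟨Q, h3, h4⟩ := hh
  ⟨P * Q, natDegree_mul_le_of_le h1 h3, fun w hw => by simp only [h2 w hw, h4 w hw, eval_mul]⟩

theorem const_mul (c : ℂ) (hg : IsPoly d g) : IsPoly d fun w => c * g w :=
  ((const c).mul hg).mono (by omega)

theorem sub (hg : IsPoly d g) (hh : IsPoly d h) : IsPoly d fun w => g w - h w :=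
  (hg.add (hh.const_mul (-1))).congr fun w _ => by ring

theorem pow (hg : IsPoly d g) (k : ℕ) : IsPoly (k * d) fun w => g w ^ k := by
  induction k with
  | zero => simpa using const 1
  | succ k ih =>
    simp only [pow_succ]
    exact (ih.mul hg).mono (by rw [Nat.succ_mul])

theorem sum {ι : Type*} {s : Finset ι} {g : ι → ℂ → ℂ} (hg : ∀ i ∈ s, IsPoly d (g i)) :
    IsPoly d fun w => ∑ i ∈ s, g i w := by
  classical
  induction s using Finset.induction_on with
  | empty => simpa using (const 0).mono (Nat.zero_le d)
  | insert a s ha ih =>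
    simp only [Finset.sum_insert ha]
    exact (hg a (Finset.mem_insert_self a s)).add
      (ih fun i hi => hg i (Finset.mem_insert_of_mem hi))

theorem prod {ι : Type*} {s : Finset ι} {g : ι → ℂ → ℂ} (hg : ∀ i ∈ s, IsPoly d (g i)) :
    IsPoly (s.card * d) fun w => ∏ i ∈ s, g i w := by
  classical
  induction s using Finset.induction_on with
  | empty => simpa using const 1
  | insert a s ha ih =>
    simp only [Finset.prod_insert ha, Finset.card_insert_of_notMem ha]
    exact ((hg a (Finset.mem_insert_self a s)).mul
      (ih fun i hi => hg i (Finset.mem_insert_of_mem hi))).mono (by rw [Nat.succ_mul, add_comm])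

/-- A function which agrees with a polynomial of degree less than `2N` and vanishes at all square
roots of `N` distinct nonzero numbers is zero. -/
theorem eq_zero_of_roots {ι : Type*} [Fintype ι] {t : ι → ℂ} (ht : Function.Injective t)
    (ht0 : ∀ i, t i ≠ 0) (hg : IsPoly d g) (hd : d < 2 * Fintype.card ι)
    (hr : ∀ i r, r ^ 2 = t i → g r = 0) {w : ℂ} (hw : w ≠ 0) : g w = 0 := by
  classical
  obtain ⟨P, hP, hgP⟩ := hg
  have hs : ∀ i, ∃ r : ℂ, r ^ 2 = t i := fun i => by
    obtain ⟨r, hr⟩ := IsAlgClosed.exists_pow_nat_eq (t i) (n := 2) (by norm_num)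
    exact ⟨r, hr⟩
  choose r hr2 using hs
  have hr0 : ∀ i, r i ≠ 0 := fun i h => ht0 i (by rw [← hr2, h]; simp)
  have hinj : Function.Injective (fun x : ι × Bool => if x.2 then r x.1 else -r x.1) := by
    rintro ⟨i, a⟩ ⟨j, b⟩ hab
    have hij : i = j := by
      apply ht
      rw [← hr2, ← hr2]
      have := congrArg (· ^ 2) hab
      cases a <;> cases b <;> simpa using this
    subst hij
    have h2 : r i ≠ -r i := fun h => hr0 i (by linear_combination h / 2)
    cases a <;> cases b <;> simp_all [eq_comm]
  -- The `2N` points `±r i` are distinct zeros of `P`.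
  have hP0 : P = 0 := by
    refine P.eq_zero_of_natDegree_lt_card_of_eval_eq_zero hinj ?_ ?_
    · rintro ⟨i, a⟩
      have hne : (if a then r i else -r i) ≠ 0 := by
        cases a <;> simp [hr0]
      rw [← hgP _ hne]
      refine hr i _ ?_
      cases a <;> simp [hr2]
    · rw [Fintype.card_prod, Fintype.card_bool]
      omega
  rw [hgP w hw, hP0, eval_zero]

end IsPoly

/-! ### The partition function as a polynomial in the last parameter -/

theorem isPoly_mul_σ (a : ℂ) : IsPoly 2 fun w => w * σ (a * w) := by
  refine (((IsPoly.id.pow 2).const_mul a).sub ((IsPoly.const a⁻¹).mono (by omega))).congr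
    fun w hw => ?_
  unfold σ
  rw [mul_inv]
  field_simp

theorem isPoly_mul_σ_inv (a : ℂ) : IsPoly 2 fun w => w * σ (a * w⁻¹) := by
  refine (((IsPoly.const a).mono (by omega)).sub ((IsPoly.id.pow 2).const_mul a⁻¹)).congr
    fun w hw => ?_
  unfold σ
  rw [mul_inv, inv_inv]
  field_simp

theorem isPoly_bulkWeight (q x : ℂ) (l b r t : Bool) :
    IsPoly 2 fun w => w * bulkWeight q (x * w) l b r t := by
  unfold bulkWeight
  split_ifs
  · simpa using IsPoly.id.mono (by omega)
  · exact ((isPoly_mul_σ (q ^ 2 * x)).const_mul (σ (q ^ 4))⁻¹).congr fun w _ => by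
      rw [div_eq_mul_inv, mul_assoc (q ^ 2)]; ring
  · exact ((isPoly_mul_σ_inv (q ^ 2 * x⁻¹)).const_mul (σ (q ^ 4))⁻¹).congr fun w _ => by
      rw [div_eq_mul_inv, mul_inv, mul_assoc (q ^ 2)]; ring
  · simpa using (IsPoly.const 0).mono (by omega)

/-- Each row contains exactly one vertex whose weight depends on the last parameter. -/
theorem isPoly_Z (n : ℕ) (q : ℂ) (u : ℕ → ℂ) :
    IsPoly (n * 2) fun w => w ^ n * Z n q (Function.update u (n + 1) w) := by
  unfold Z
  simp only [Finset.mul_sum]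
  refine IsPoly.sum fun C _ => ?_
  have hcard : (Finset.Icc 1 n).card = n := by simp
  have h : ∀ w : ℂ, w ^ n = ∏ _i ∈ Finset.Icc 1 n, w := fun w => by
    rw [Finset.prod_const, hcard]
  simp only [h, ← Finset.prod_mul_distrib]
  rw [← hcard]
  conv => enter [2, w]; rw [hcard]
  refine IsPoly.prod fun i hi => ?_
  rw [Finset.mem_Icc] at hi
  have hmem : n + 1 ∈ Finset.Icc (i + 1) (2 * n + 1 - i) := Finset.mem_Icc.2 (by omega)
  have h1 : min (n + 1) (2 * n + 2 - (n + 1)) = n + 1 := by omega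
  refine (((isPoly_bulkWeight q (u i) (leftIn C i (n + 1)) (bottomIn C i (n + 1))
    (rightIn C i (n + 1)) (topIn C i (n + 1))).const_mul
      (leftWeight q (u i) (rightIn C i i) (topIn C i i) *
      (∏ j ∈ (Finset.Icc (i + 1) (2 * n + 1 - i)).erase (n + 1),
        bulkWeight q (u i * u (min j (2 * n + 2 - j)))
          (leftIn C i j) (bottomIn C i j) (rightIn C i j) (topIn C i j)) *
      rightWeight q (u i) (leftIn C i (2 * n + 2 - i)) (topIn C i (2 * n + 2 - i))))).congr
    fun w _ => ?_
  have h2 : ∏ j ∈ (Finset.Icc (i + 1) (2 * n + 1 - i)).erase (n + 1),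
        bulkWeight q (u i * Function.update u (n + 1) w (min j (2 * n + 2 - j)))
          (leftIn C i j) (bottomIn C i j) (rightIn C i j) (topIn C i j) =
      ∏ j ∈ (Finset.Icc (i + 1) (2 * n + 1 - i)).erase (n + 1),
        bulkWeight q (u i * u (min j (2 * n + 2 - j)))
          (leftIn C i j) (bottomIn C i j) (rightIn C i j) (topIn C i j) := by
    refine Finset.prod_congr rfl fun j hj => ?_
    rw [Finset.mem_erase, Finset.mem_Icc] at hj
    rw [Function.update_of_ne (by omega)]
  rw [Function.update_of_ne (show i ≠ n + 1 by omega), ← Finset.mul_prod_erase _ _ hmem, h1,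
    Function.update_self, h2]
  ring

end

/-! ### The two sides of the formula -/

section

variable {q : ℂ} {n : ℕ} {u : ℕ → ℂ} {w : ℂ}

/-- The denominator `σ(q²ab) σ(q²a⁻¹b⁻¹)` of the kernel. -/
noncomputable def den (q a b : ℂ) : ℂ := σ (q ^ 2 * a * b) * σ (q ^ 2 * a⁻¹ * b⁻¹)

/-- The numerator `q² + q⁻² + a² + b⁻²` of the kernel. -/
noncomputable def num (q a b : ℂ) : ℂ := q ^ 2 + q⁻¹ ^ 2 + a ^ 2 + b⁻¹ ^ 2

/-- The column of the kernel that belongs to the value `w` of the parameter. -/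
noncomputable def kernelColumn (n : ℕ) (q : ℂ) (u : ℕ → ℂ) (w : ℂ) (r : Fin (n + 1)) : ℂ :=
  if r.val + 1 ≤ n then num q (u (r.val + 1)) w / den q (u (r.val + 1)) w else (w ^ 2 - 1)⁻¹

/-- The matrix of the first determinant in the formula, without the factor `u_{n+1} - 1` of its last
row. The second determinant comes from the same matrix at the inverse parameters. -/
noncomputable def kernel (n : ℕ) (q : ℂ) (u : ℕ → ℂ) : Matrix (Fin (n + 1)) (Fin (n + 1)) ℂ :=
  Matrix.of fun r c => kernelColumn n q u (u (c.val + 1)) r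

/-- The part of the prefactor of the determinants that does not involve `u_{n+1}`. -/
noncomputable def prefactor (n : ℕ) (q : ℂ) (u : ℕ → ℂ) : ℂ :=
  σ (q ^ 2) ^ n / (σ q ^ (2 * n) * σ (q ^ 4) ^ (n ^ 2)) *
    (∏ i ∈ Finset.Icc 1 n, σ (u i) * σ (q * u i) * σ (q * (u i)⁻¹)) *
    ∏ i ∈ Finset.Icc 1 n, ∏ j ∈ Finset.Icc (i + 1) n,
      (den q (u i) (u j) / σ (u i * (u j)⁻¹)) ^ 2

/-- The determinant formula for the partition function. -/
noncomputable def determinantFormula (n : ℕ) (q : ℂ) (u : ℕ → ℂ) : ℂ :=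
  prefactor n q u *
    (∏ i ∈ Finset.Icc 1 n, den q (u i) (u (n + 1)) / σ (u i * (u (n + 1))⁻¹)) *
    ((u (n + 1) - 1) * (kernel n q u).det + ((u (n + 1))⁻¹ - 1) * (kernel n q u⁻¹).det)

/-- The column of the kernel at the value `w`, multiplied by `w² - 1` and by `∏ₖ w² den(u_k, w)` to
clear its denominators. -/
noncomputable def column₁ (n : ℕ) (q : ℂ) (u : ℕ → ℂ) (w : ℂ) (r : Fin (n + 1)) : ℂ :=
  if r.val + 1 ≤ n then (w ^ 2 - 1) * (w ^ 2 * num q (u (r.val + 1)) w) *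
    ∏ k ∈ (Finset.Icc 1 n).erase (r.val + 1), w ^ 2 * den q (u k) w
  else ∏ k ∈ Finset.Icc 1 n, w ^ 2 * den q (u k) w

/-- The column of the kernel at the inverse parameters and the value `w⁻¹`, multiplied by `(w⁻¹ -
1)(w + 1)` and by `∏ₖ w² den(u_k, w)` to clear its denominators. -/
noncomputable def column₂ (n : ℕ) (q : ℂ) (u : ℕ → ℂ) (w : ℂ) (r : Fin (n + 1)) : ℂ :=
  if r.val + 1 ≤ n then (1 - w ^ 2) * (w * num q (u (r.val + 1))⁻¹ w⁻¹) *
    ∏ k ∈ (Finset.Icc 1 n).erase (r.val + 1), w ^ 2 * den q (u k) w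
  else w * ∏ k ∈ Finset.Icc 1 n, w ^ 2 * den q (u k) w

/-- The difference of the two sides of the determinant formula at `u_{n+1} = w`, multiplied by
`w^{2n} (w + 1) ∏ᵢ σ(uᵢ w⁻¹)`. The determinants, which depend on `w` through their last column, are
written as components of `Matrix.cramer`. This makes sense for all `w ≠ 0`, see `defect_eq`. -/
noncomputable def defect (n : ℕ) (q : ℂ) (u : ℕ → ℂ) (w : ℂ) : ℂ :=
  w ^ n * Z n q (Function.update u (n + 1) w) * (∏ i ∈ Finset.Icc 1 n, w * σ (u i * w⁻¹)) *
      (w + 1) -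
    prefactor n q u * ((kernel n q u).cramer (column₁ n q u w) (Fin.last n) +
      (kernel n q u⁻¹).cramer (column₂ n q u w) (Fin.last n))

theorem isPoly_den (q a : ℂ) : IsPoly 4 fun w => w ^ 2 * den q a w :=
  ((isPoly_mul_σ (q ^ 2 * a)).mul (isPoly_mul_σ_inv (q ^ 2 * a⁻¹))).congr fun w _ => by
    rw [den]; ring

/-- Cramer's map is linear in the column. -/
theorem isPoly_cramer {m d : ℕ} {A : Matrix (Fin m) (Fin m) ℂ} {b : ℂ → Fin m → ℂ}
    (hb : ∀ r, IsPoly d fun w => b w r) (i : Fin m) : IsPoly d fun w => A.cramer (b w) i := by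
  refine (IsPoly.sum (s := Finset.univ) fun r _ =>
    (hb r).const_mul (A.cramer (fun j => if r = j then 1 else 0) i)).congr fun w _ => ?_
  rw [LinearMap.pi_apply_eq_sum_univ A.cramer (b w), Finset.sum_apply]
  refine Finset.sum_congr rfl fun r _ => ?_
  rw [Pi.smul_apply, smul_eq_mul, mul_comm]

/-- The defect is a polynomial in `w` of degree at most `4n + 1`. -/
theorem isPoly_defect (hn : 1 ≤ n) (q : ℂ) (u : ℕ → ℂ) :
    IsPoly (4 * n + 1) (defect n q u) := by
  have hw : IsPoly 2 fun w : ℂ => w ^ 2 - 1 :=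
    (IsPoly.id.pow 2).sub ((IsPoly.const 1).mono (by omega))
  have hcard : (Finset.Icc 1 n).card = n := by simp
  have hp : ∀ s : Finset ℕ, IsPoly (s.card * 4) fun w => ∏ k ∈ s, w ^ 2 * den q (u k) w :=
    fun s => IsPoly.prod fun k _ => isPoly_den q (u k)
  have he : ∀ r : Fin (n + 1), r.val + 1 ≤ n →
      ((Finset.Icc 1 n).erase (r.val + 1)).card = n - 1 := fun r hr => by
    rw [Finset.card_erase_of_mem (Finset.mem_Icc.2 (by omega)), hcard]
  have hc₁ : ∀ r, IsPoly (4 * n + 1) fun w => column₁ n q u w r := by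
    intro r
    unfold column₁
    split_ifs with h
    · have h1 : IsPoly 2 fun w => w ^ 2 * num q (u (r.val + 1)) w :=
        (((IsPoly.id.pow 2).const_mul (q ^ 2 + q⁻¹ ^ 2 + u (r.val + 1) ^ 2)).add
          ((IsPoly.const 1).mono (by omega))).congr fun w hw => by
            rw [num]; field_simp
      exact ((hw.mul h1).mul (hp _)).mono (by rw [he r h]; omega)
    · exact (hp _).mono (by rw [hcard]; omega)
  have hc₂ : ∀ r, IsPoly (4 * n + 1) fun w => column₂ n q u w r := by
    intro r
    unfold column₂
    split_ifs with h
    · have h1 : IsPoly 3 fun w => w * num q (u (r.val + 1))⁻¹ w⁻¹ :=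
        ((IsPoly.id.const_mul (q ^ 2 + q⁻¹ ^ 2 + (u (r.val + 1))⁻¹ ^ 2)).mono (by omega)
          |>.add (IsPoly.id.pow 3)).congr fun w hw => by
            rw [num, inv_inv]; ring
      have hw' : IsPoly 2 fun w : ℂ => 1 - w ^ 2 :=
        ((IsPoly.const 1).mono (by omega)).sub (IsPoly.id.pow 2)
      exact ((hw'.mul h1).mul (hp _)).mono (by rw [he r h]; omega)
    · exact (IsPoly.id.mul (hp _)).mono (by rw [hcard]; omega)
  have h1 : IsPoly ((Finset.Icc 1 n).card * 2)
      fun w => ∏ i ∈ Finset.Icc 1 n, w * σ (u i * w⁻¹) :=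
    IsPoly.prod fun i _ => isPoly_mul_σ_inv (u i)
  have h2 : IsPoly 1 fun w : ℂ => w + 1 := IsPoly.id.add ((IsPoly.const 1).mono (by omega))
  exact ((((isPoly_Z n q u).mul h1).mul h2).mono (by rw [hcard]; omega)).sub
    (((isPoly_cramer hc₁ _).add (isPoly_cramer hc₂ _)).const_mul _)

theorem kernelColumn_congr {v : ℕ → ℂ} (hv : ∀ k ∈ Finset.Icc 1 n, v k = u k) :
    kernelColumn n q v w = kernelColumn n q u w := by
  ext r
  unfold kernelColumn
  split_ifs with h
  · rw [hv _ (Finset.mem_Icc.2 (by omega))]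
  · rfl

theorem kernel_update (q : ℂ) (u : ℕ → ℂ) (w : ℂ) (b : Fin (n + 1) → ℂ) :
    (kernel n q (Function.update u (n + 1) w)).cramer b (Fin.last n) =
      (kernel n q u).cramer b (Fin.last n) := by
  rw [Matrix.cramer_apply, Matrix.cramer_apply]
  congr 1
  ext r c
  rcases eq_or_ne c (Fin.last n) with rfl | hc
  · simp
  · have hc' : c.val ≠ n := fun h => hc (Fin.ext h)
    rw [Matrix.updateCol_ne hc, Matrix.updateCol_ne hc]
    simp only [kernel, Matrix.of_apply]
    rw [Function.update_of_ne (show c.val + 1 ≠ n + 1 by omega), kernelColumn_congr fun k hk =>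
      Function.update_of_ne (by rw [Finset.mem_Icc] at hk; omega) _ _]

theorem den_inv (q a b : ℂ) : den q a⁻¹ b⁻¹ = den q a b := by
  rw [den, den, inv_inv, inv_inv, mul_comm]

theorem den_neg_left (q a b : ℂ) : den q (-a) b = den q a b := by
  rw [den, den, inv_neg, mul_neg, neg_mul, mul_neg, neg_mul, σ_neg, σ_neg, neg_mul_neg]

theorem den_neg_right (q a b : ℂ) : den q a (-b) = den q a b := by
  rw [den, den, inv_neg, mul_neg, mul_neg, σ_neg, σ_neg, neg_mul_neg]

theorem den_comm (q a b : ℂ) : den q a b = den q b a := by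
  rw [den, den, mul_right_comm, mul_right_comm _ a⁻¹]

theorem mul_prod_erase_den {k : ℕ} (hk : k ∈ Finset.Icc 1 n) (c : ℂ) (h : den q (u k) w ≠ 0)
    (hw : w ≠ 0) :
    (∏ k ∈ Finset.Icc 1 n, w ^ 2 * den q (u k) w) * (c / den q (u k) w) =
      w ^ 2 * c * ∏ k ∈ (Finset.Icc 1 n).erase k, w ^ 2 * den q (u k) w := by
  rw [← Finset.mul_prod_erase _ _ hk]
  field_simp

theorem column₁_eq (hw : w ≠ 0) (hw1 : w ^ 2 ≠ 1)
    (hE : ∀ k ∈ Finset.Icc 1 n, den q (u k) w ≠ 0) :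
    column₁ n q u w = ((w ^ 2 - 1) * ∏ k ∈ Finset.Icc 1 n, w ^ 2 * den q (u k) w) •
      kernelColumn n q u w := by
  ext r
  rw [Pi.smul_apply, smul_eq_mul, kernelColumn, column₁]
  split_ifs with h
  · have hr : r.val + 1 ∈ Finset.Icc 1 n := Finset.mem_Icc.2 (by omega)
    rw [mul_assoc (w ^ 2 - 1) (∏ k ∈ Finset.Icc 1 n, w ^ 2 * den q (u k) w),
      mul_prod_erase_den hr _ (hE _ hr) hw]
    ring
  · have : w ^ 2 - 1 ≠ 0 := sub_ne_zero.2 hw1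
    field_simp

theorem column₂_eq (hw : w ≠ 0) (hw1 : w ^ 2 ≠ 1)
    (hE : ∀ k ∈ Finset.Icc 1 n, den q (u k) w ≠ 0) :
    column₂ n q u w = ((w⁻¹ - 1) * (w + 1) * ∏ k ∈ Finset.Icc 1 n, w ^ 2 * den q (u k) w) •
      kernelColumn n q u⁻¹ w⁻¹ := by
  ext r
  rw [Pi.smul_apply, smul_eq_mul, kernelColumn, column₂]
  simp only [Pi.inv_apply]
  split_ifs with h
  · have hr : r.val + 1 ∈ Finset.Icc 1 n := Finset.mem_Icc.2 (by omega)
    rw [den_inv, mul_assoc ((w⁻¹ - 1) * (w + 1)), mul_prod_erase_den hr _ (hE _ hr) hw]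
    field_simp
    ring
  · have h1 : 1 - w ^ 2 ≠ 0 := sub_ne_zero.2 hw1.symm
    have h2 : w⁻¹ ^ 2 - 1 = (1 - w ^ 2) / w ^ 2 := by field_simp
    rw [h2]
    field_simp
    ring

/-- Replacing a column of the kernel by another of its columns makes the determinant vanish. -/
theorem cramer_kernel_column (v : ℕ → ℂ) (c : Fin (n + 1)) :
    (kernel n q v).cramer (kernelColumn n q v (v (c.val + 1))) = Pi.single c (kernel n q v).det :=
  Matrix.cramer_row_self _ _ c fun _ => rfl

/-- Where no denominator vanishes, the defect is the difference of the two sides of the formula up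
to the factors that clear the denominators. -/
theorem defect_eq (hw : w ≠ 0) (hw1 : w ^ 2 ≠ 1) (hE : ∀ k ∈ Finset.Icc 1 n, den q (u k) w ≠ 0) :
    defect n q u w = w ^ (2 * n) * (w + 1) * (Z n q (Function.update u (n + 1) w) *
      (∏ i ∈ Finset.Icc 1 n, σ (u i * w⁻¹)) -
      prefactor n q u * (∏ i ∈ Finset.Icc 1 n, den q (u i) w) *
        ((w - 1) * (kernel n q (Function.update u (n + 1) w)).det +
          (w⁻¹ - 1) * (kernel n q (Function.update u (n + 1) w)⁻¹).det)) := by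
  have hv : ∀ k ∈ Finset.Icc 1 n, Function.update u (n + 1) w k = u k := fun k hk =>
    Function.update_of_ne (by rw [Finset.mem_Icc] at hk; omega) _ _
  have hinv : (Function.update u (n + 1) w)⁻¹ = Function.update u⁻¹ (n + 1) w⁻¹ := by
    ext i
    rcases eq_or_ne i (n + 1) with rfl | hi <;> simp [*]
  have h1 : kernelColumn n q u w = kernelColumn n q (Function.update u (n + 1) w)
      (Function.update u (n + 1) w ((Fin.last n).val + 1)) := by
    rw [Fin.val_last, Function.update_self, kernelColumn_congr hv]
  have h2 : kernelColumn n q u⁻¹ w⁻¹ = kernelColumn n q (Function.update u⁻¹ (n + 1) w⁻¹)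
      (Function.update u⁻¹ (n + 1) w⁻¹ ((Fin.last n).val + 1)) := by
    rw [Fin.val_last, Function.update_self, ← hinv, kernelColumn_congr]
    exact fun k hk => congrArg Inv.inv (hv k hk).symm
  have hP : ∀ f : ℕ → ℂ, ∏ k ∈ Finset.Icc 1 n, w * f k = w ^ n * ∏ k ∈ Finset.Icc 1 n, f k :=
    fun f => by rw [Finset.prod_mul_distrib, Finset.prod_const]; simp
  have hP2 : ∏ k ∈ Finset.Icc 1 n, w ^ 2 * den q (u k) w =
      w ^ (2 * n) * ∏ k ∈ Finset.Icc 1 n, den q (u k) w := by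
    rw [Finset.prod_mul_distrib, Finset.prod_const, ← pow_mul]; simp
  rw [defect, ← kernel_update q u w, ← kernel_update q u⁻¹ w⁻¹, column₁_eq hw hw1 hE,
    column₂_eq hw hw1 hE, h1, h2, map_smul, map_smul, Pi.smul_apply, Pi.smul_apply,
    cramer_kernel_column, cramer_kernel_column, Pi.single_eq_same, Pi.single_eq_same,
    hP2, hP, smul_eq_mul, smul_eq_mul, two_mul, pow_add, hinv]
  ring

end

/-! ### Symmetries and zeros of the defect -/

section

variable {q : ℂ} {n : ℕ} {u v : ℕ → ℂ} {w x : ℂ}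

theorem num_congr_sq {a b c d : ℂ} (h : a ^ 2 = c ^ 2) (h' : b ^ 2 = d ^ 2) :
    num q a b = num q c d := by
  rw [num, num, inv_pow b, inv_pow d, h, h']

theorem den_congr_sq {a b c d : ℂ} (h : a ^ 2 = c ^ 2) (h' : b ^ 2 = d ^ 2) :
    den q a b = den q c d := by
  rcases sq_eq_sq_iff_eq_or_eq_neg.1 h with rfl | rfl <;>
    rcases sq_eq_sq_iff_eq_or_eq_neg.1 h' with rfl | rfl <;>
    simp only [den_neg_left, den_neg_right]

theorem kernelColumn_congr_sq (h : ∀ k, u k ^ 2 = v k ^ 2) (h' : w ^ 2 = x ^ 2) :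
    kernelColumn n q u w = kernelColumn n q v x := by
  ext r
  rw [kernelColumn, kernelColumn, num_congr_sq (h _) h', den_congr_sq (h _) h', h']

theorem kernel_congr_sq (h : ∀ k, u k ^ 2 = v k ^ 2) : kernel n q u = kernel n q v := by
  ext r c
  rw [kernel, kernel, Matrix.of_apply, Matrix.of_apply, kernelColumn_congr_sq h (h _)]

theorem column₁_congr_sq (h : ∀ k, u k ^ 2 = v k ^ 2) : column₁ n q u w = column₁ n q v w := by
  ext r
  rw [column₁, column₁, num_congr_sq (h _) rfl]
  simp only [fun k => den_congr_sq (q := q) (h k) (rfl : w ^ 2 = w ^ 2)]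

theorem column₂_congr_sq (h : ∀ k, u k ^ 2 = v k ^ 2) : column₂ n q u w = column₂ n q v w := by
  ext r
  have h' : (u (r.val + 1))⁻¹ ^ 2 = (v (r.val + 1))⁻¹ ^ 2 := by rw [inv_pow, inv_pow, h]
  rw [column₂, column₂, num_congr_sq h' rfl]
  simp only [fun k => den_congr_sq (q := q) (h k) (rfl : w ^ 2 = w ^ 2)]

theorem inv_congr_sq (h : ∀ k, u k ^ 2 = v k ^ 2) (k : ℕ) : u⁻¹ k ^ 2 = v⁻¹ k ^ 2 := by
  rw [Pi.inv_apply, Pi.inv_apply, inv_pow, inv_pow, h]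

/-- Generic parameters `u 1, …, u n`: no denominator of the formula that involves only these
parameters vanishes, and the nodes of the interpolation are distinct. All `u i` are required to be
nonzero, also for `i` outside `1, …, n`. -/
structure Generic (n : ℕ) (q : ℂ) (u : ℕ → ℂ) : Prop where
  ne_zero : ∀ i, u i ≠ 0
  sq_ne_one : ∀ i ∈ Finset.Icc 1 n, u i ^ 2 ≠ 1
  sq_ne_sq : ∀ i ∈ Finset.Icc 1 n, ∀ j ∈ Finset.Icc 1 n, i ≠ j → u i ^ 2 ≠ u j ^ 2
  mul_ne_one : ∀ i ∈ Finset.Icc 1 n, ∀ j ∈ Finset.Icc 1 n, q ^ 4 * u i ^ 2 * u j ^ 2 ≠ 1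
  mul_ne_pow : ∀ i ∈ Finset.Icc 1 n, ∀ j ∈ Finset.Icc 1 n, u i ^ 2 * u j ^ 2 ≠ q ^ 4
  shift_ne_sq : ∀ i ∈ Finset.Icc 1 n, ∀ j ∈ Finset.Icc 1 n, q ^ 8 * u i ^ 2 ≠ u j ^ 2

namespace Generic

theorem congr_sq (hu : Generic n q u) (h : ∀ k, u k ^ 2 = v k ^ 2) : Generic n q v where
  ne_zero i hi := hu.ne_zero i (by have := h i; rw [hi] at this; simpa using this)
  sq_ne_one i hi := by rw [← h]; exact hu.sq_ne_one i hi
  sq_ne_sq i hi j hj := by rw [← h, ← h]; exact hu.sq_ne_sq i hi j hj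
  mul_ne_one i hi j hj := by rw [← h, ← h]; exact hu.mul_ne_one i hi j hj
  mul_ne_pow i hi j hj := by rw [← h, ← h]; exact hu.mul_ne_pow i hi j hj
  shift_ne_sq i hi j hj := by rw [← h, ← h]; exact hu.shift_ne_sq i hi j hj

theorem inv (hu : Generic n q u) : Generic n q u⁻¹ := by
  have h0 := hu.ne_zero
  refine ⟨fun i => inv_ne_zero (h0 i), fun i hi h => hu.sq_ne_one i hi ?_,
    fun i hi j hj hij h => hu.sq_ne_sq i hi j hj hij ?_,
    fun i hi j hj h => hu.mul_ne_pow i hi j hj ?_,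
    fun i hi j hj h => hu.mul_ne_one i hi j hj ?_, fun i hi j hj h => hu.shift_ne_sq j hj i hi ?_⟩
  · simpa using h
  · simpa using h
  · have := h0 i; have := h0 j
    simp only [Pi.inv_apply] at h
    field_simp at h
    exact h.symm
  · have := h0 i; have := h0 j
    simp only [Pi.inv_apply] at h
    field_simp at h
    linear_combination -h
  · have := h0 i; have := h0 j
    simp only [Pi.inv_apply] at h
    field_simp at h
    exact h

theorem comp (hu : Generic n q u) {m : ℕ} {f : ℕ → ℕ}
    (hf : ∀ i ∈ Finset.Icc 1 m, f i ∈ Finset.Icc 1 n)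
    (hf' : ∀ i ∈ Finset.Icc 1 m, ∀ j ∈ Finset.Icc 1 m, i ≠ j → f i ≠ f j) :
    Generic m q (u ∘ f) where
  ne_zero _ := hu.ne_zero _
  sq_ne_one i hi := hu.sq_ne_one _ (hf i hi)
  sq_ne_sq i hi j hj hij := hu.sq_ne_sq _ (hf i hi) _ (hf j hj) (hf' i hi j hj hij)
  mul_ne_one i hi j hj := hu.mul_ne_one _ (hf i hi) _ (hf j hj)
  mul_ne_pow i hi j hj := hu.mul_ne_pow _ (hf i hi) _ (hf j hj)
  shift_ne_sq i hi j hj := hu.shift_ne_sq _ (hf i hi) _ (hf j hj)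

end Generic

theorem σ_eq_zero (hx : x ≠ 0) : σ x = 0 ↔ x ^ 2 = 1 := by
  rw [σ_eq hx, div_eq_zero_iff, sub_eq_zero]
  tauto

theorem den_ne_zero (hq : q ≠ 0) {a b : ℂ} (ha : a ≠ 0) (hb : b ≠ 0)
    (h1 : q ^ 4 * a ^ 2 * b ^ 2 ≠ 1) (h2 : a ^ 2 * b ^ 2 ≠ q ^ 4) : den q a b ≠ 0 := by
  rw [den, mul_ne_zero_iff, Ne, Ne, σ_eq_zero (by positivity), σ_eq_zero (by positivity)]
  refine ⟨fun h => h1 (by linear_combination h), fun h => h2 ?_⟩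
  field_simp at h
  linear_combination -h

/-- The defect vanishes at `w = ±u_k`: the factor `σ(u_k w⁻¹)` kills the partition function, and the
determinants have two equal columns, as the kernel is even in each parameter. -/
theorem defect_eq_zero_of_sq_eq (hq : q ≠ 0) (hu : Generic n q u) {k : ℕ} (hk : k ∈ Finset.Icc 1 n)
    (h : w ^ 2 = u k ^ 2) : defect n q u w = 0 := by
  have hk' := Finset.mem_Icc.1 hk
  have hw : w ≠ 0 := fun h0 => hu.ne_zero k (by rw [h0] at h; simpa using h.symm)
  have hE : ∀ i ∈ Finset.Icc 1 n, den q (u i) w ≠ 0 := fun i hi =>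
    den_ne_zero hq (hu.ne_zero i) hw (by rw [h]; exact hu.mul_ne_one i hi k hk)
      (by rw [h]; exact hu.mul_ne_pow i hi k hk)
  have hw1 : w ^ 2 ≠ 1 := by rw [h]; exact hu.sq_ne_one k hk
  have hP : ∏ i ∈ Finset.Icc 1 n, w * σ (u i * w⁻¹) = 0 := by
    refine Finset.prod_eq_zero hk ?_
    rw [(σ_eq_zero (mul_ne_zero (hu.ne_zero k) (inv_ne_zero hw))).2
      (by rw [mul_pow, ← h]; field_simp), mul_zero]
  have hc : ∀ (v : ℕ → ℂ) (x : ℂ), x ^ 2 = v k ^ 2 →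
      (kernel n q v).cramer (kernelColumn n q v x) (Fin.last n) = 0 := by
    intro v x hx
    have hkk : k - 1 + 1 = k := by omega
    have := cramer_kernel_column (q := q) v (⟨k - 1, by omega⟩ : Fin (n + 1))
    rw [show v ((⟨k - 1, by omega⟩ : Fin (n + 1)).val + 1) = v k by simp only [hkk],
      ← kernelColumn_congr_sq (fun _ => rfl) hx] at this
    rw [this, Pi.single_eq_of_ne]
    exact fun h => by have := congrArg Fin.val h; rw [Fin.val_last] at this; dsimp at this; omega
  rw [defect, hP, column₁_eq hw hw1 hE, column₂_eq hw hw1 hE, map_smul, map_smul, Pi.smul_apply,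
    Pi.smul_apply, hc u w h, hc u⁻¹ w⁻¹ (by rw [inv_pow, h, Pi.inv_apply, inv_pow])]
  simp

theorem prefactor_inv (n : ℕ) (q : ℂ) (u : ℕ → ℂ) :
    prefactor n q u⁻¹ = (-1) ^ n * prefactor n q u := by
  have hσ : ∀ x : ℂ, σ x⁻¹ = -σ x := fun x => by unfold σ; rw [inv_inv]; ring
  have h1 : ∏ i ∈ Finset.Icc 1 n, σ (u⁻¹ i) * σ (q * u⁻¹ i) * σ (q * (u⁻¹ i)⁻¹) =
      (-1) ^ n * ∏ i ∈ Finset.Icc 1 n, σ (u i) * σ (q * u i) * σ (q * (u i)⁻¹) := by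
    have hcard : (-1 : ℂ) ^ n = ∏ _i ∈ Finset.Icc 1 n, (-1 : ℂ) := by simp
    rw [hcard, ← Finset.prod_mul_distrib]
    refine Finset.prod_congr rfl fun i _ => ?_
    rw [Pi.inv_apply, hσ, inv_inv]
    ring
  have h2 : ∀ i j, (den q (u⁻¹ i) (u⁻¹ j) / σ (u⁻¹ i * (u⁻¹ j)⁻¹)) ^ 2 =
      (den q (u i) (u j) / σ (u i * (u j)⁻¹)) ^ 2 := by
    intro i j
    rw [Pi.inv_apply, Pi.inv_apply, den_inv, ← mul_inv, hσ, div_neg, neg_sq]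
  rw [prefactor, prefactor, h1]
  simp only [h2]
  ring

theorem column₁_inv (hw : w ≠ 0) :
    column₁ n q u⁻¹ w⁻¹ = w⁻¹ ^ (4 * n + 1) • column₂ n q u w := by
  have hP : ∀ s : Finset ℕ, ∏ k ∈ s, w⁻¹ ^ 2 * den q (u⁻¹ k) w⁻¹ =
      w⁻¹ ^ (4 * s.card) * ∏ k ∈ s, w ^ 2 * den q (u k) w := by
    intro s
    rw [pow_mul, ← Finset.prod_const, ← Finset.prod_mul_distrib]
    refine Finset.prod_congr rfl fun k _ => ?_
    rw [Pi.inv_apply, den_inv]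
    field_simp
  ext r
  rw [Pi.smul_apply, column₁, column₂, hP, hP, smul_eq_mul]
  split_ifs with h
  · obtain ⟨m, rfl⟩ : ∃ m, n = m + 1 := ⟨n - 1, by omega⟩
    rw [Finset.card_erase_of_mem (Finset.mem_Icc.2 (by omega)), Nat.card_Icc,
      show 4 * (m + 1 + 1 - 1 - 1) = 4 * m by omega, show 4 * (m + 1) + 1 = 4 * m + 5 by ring,
      pow_add, Pi.inv_apply]
    field_simp
  · rw [Nat.card_Icc, Nat.add_sub_cancel, pow_succ w⁻¹ (4 * n)]
    field_simp

theorem column₂_inv (hw : w ≠ 0) :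
    column₂ n q u⁻¹ w⁻¹ = w⁻¹ ^ (4 * n + 1) • column₁ n q u w := by
  have h := column₁_inv (n := n) (q := q) (u := u⁻¹) (inv_ne_zero hw)
  rw [inv_inv, inv_inv] at h
  rw [h, smul_smul, ← mul_pow, inv_mul_cancel₀ hw, one_pow, one_smul]

/-- Inverting all parameters interchanges the two determinants. -/
theorem defect_inv (hw : w ≠ 0) :
    defect n q u⁻¹ w⁻¹ = (-1) ^ n * w⁻¹ ^ (4 * n + 1) * defect n q u w := by
  have hσ : ∀ x : ℂ, σ x⁻¹ = -σ x := fun x => by unfold σ; rw [inv_inv]; ring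
  have hZ : Z n q (Function.update u⁻¹ (n + 1) w⁻¹) = Z n q (Function.update u (n + 1) w) := by
    rw [← Z_inv n q (Function.update u (n + 1) w)]
    congr 1
    ext i
    rcases eq_or_ne i (n + 1) with rfl | hi <;> simp [*]
  have hP : ∏ i ∈ Finset.Icc 1 n, w⁻¹ * σ (u⁻¹ i * w⁻¹⁻¹) =
      (-1) ^ n * w⁻¹ ^ (2 * n) * ∏ i ∈ Finset.Icc 1 n, w * σ (u i * w⁻¹) := by
    have hcard : (-1) ^ n * w⁻¹ ^ (2 * n) = ∏ _i ∈ Finset.Icc 1 n, -w⁻¹ ^ 2 := by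
      rw [Finset.prod_const, Nat.card_Icc, Nat.add_sub_cancel, pow_mul, ← mul_pow, neg_one_mul]
    rw [hcard, ← Finset.prod_mul_distrib]
    refine Finset.prod_congr rfl fun i _ => ?_
    rw [Pi.inv_apply, ← mul_inv, hσ]
    field_simp
  rw [defect, defect, hZ, hP, prefactor_inv, column₁_inv hw, column₂_inv hw, inv_inv, map_smul,
    map_smul, Pi.smul_apply, Pi.smul_apply, show 4 * n + 1 = n + 2 * n + n + 1 by ring]
  simp only [smul_eq_mul, pow_add]
  have h1 : w⁻¹ + 1 = w⁻¹ * (w + 1) := by field_simp; ring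
  have h2 : w⁻¹ ^ n * w ^ n = 1 := by rw [← mul_pow, inv_mul_cancel₀ hw, one_pow]
  rw [h1]
  linear_combination (-1 : ℂ) ^ n * w⁻¹ ^ n * w⁻¹ ^ (2 * n) * w⁻¹ * (w + 1) *
    Z n q (Function.update u (n + 1) w) * (∏ i ∈ Finset.Icc 1 n, w * σ (u i * w⁻¹)) * (-h2)

/-- The defect is odd in `u_1`. -/
theorem defect_neg (q : ℂ) (u : ℕ → ℂ) (w : ℂ) :
    defect (n + 1) q (Function.update u 1 (-u 1)) w = -defect (n + 1) q u w := by
  set u' := Function.update u 1 (-u 1) with hu'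
  have h1 : u' 1 = -u 1 := by simp [hu']
  have hj : ∀ j, j ≠ 1 → u' j = u j := fun j hj => by rw [hu', Function.update_of_ne hj]
  have hsq : ∀ k, u' k ^ 2 = u k ^ 2 := fun k => by
    rcases eq_or_ne k 1 with rfl | hk
    · rw [h1, neg_sq]
    · rw [hj k hk]
  have hprod : ∀ f : ℂ → ℂ, f (-u 1) = -f (u 1) →
      ∏ i ∈ Finset.Icc 1 (n + 1), f (u' i) = -∏ i ∈ Finset.Icc 1 (n + 1), f (u i) := by
    intro f hf
    have hmem : 1 ∈ Finset.Icc 1 (n + 1) := Finset.mem_Icc.2 (by omega)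
    rw [← Finset.mul_prod_erase _ _ hmem, ← Finset.mul_prod_erase _ _ hmem, h1, hf, neg_mul,
      Finset.prod_congr rfl fun i hi => by rw [hj i (Finset.ne_of_mem_erase hi)]]
  have hZ : Z (n + 1) q (Function.update u' (n + 1 + 1) w) =
      Z (n + 1) q (Function.update u (n + 1 + 1) w) := by
    rw [Z_eq_amplitude, Z_eq_amplitude, ← amplitude_neg]
    refine amplitude_congr fun j hjn => ?_
    rcases eq_or_ne j (n + 1) with rfl | hj1
    · simp [h1]
    · rw [Function.update_of_ne hj1]
      rcases eq_or_ne j 0 with rfl | hj0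
      · simp
      · rw [Function.update_of_ne (by omega), Function.update_of_ne (by omega), hj _ (by omega)]
  have hpre : prefactor (n + 1) q u' = -prefactor (n + 1) q u := by
    have hpair : ∀ i j, (den q (u' i) (u' j) / σ (u' i * (u' j)⁻¹)) ^ 2 =
        (den q (u i) (u j) / σ (u i * (u j)⁻¹)) ^ 2 := by
      intro i j
      have hs : σ (u' i * (u' j)⁻¹) ^ 2 = σ (u i * (u j)⁻¹) ^ 2 := by
        rcases eq_or_ne i 1 with rfl | hi <;> rcases eq_or_ne j 1 with rfl | hj' <;>
          simp [*, inv_neg, σ_neg]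
      rw [div_pow, div_pow, hs, den_congr_sq (hsq i) (hsq j)]
    rw [prefactor, prefactor, hprod (fun x => σ x * σ (q * x) * σ (q * x⁻¹))]
    · simp only [hpair]
      ring
    · rw [inv_neg, mul_neg, mul_neg, σ_neg, σ_neg, σ_neg]
      ring
  rw [defect, defect, hZ, hpre, hprod fun x => w * σ (x * w⁻¹), kernel_congr_sq hsq,
    kernel_congr_sq (inv_congr_sq hsq), column₁_congr_sq hsq, column₂_congr_sq hsq]
  · ring
  · rw [neg_mul, σ_neg, mul_neg]

end

/-! ### Permutations of the parameters -/

section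

variable {q : ℂ} {n : ℕ} {u v : ℕ → ℂ} {w x : ℂ}

/-- A product of symmetric factors over all pairs `i < j` is invariant under involutions. -/
theorem prod_pairs_comp {M : Type*} [CommMonoid M] {g : ℕ → ℕ → M} (hg : ∀ i j, g i j = g j i)
    {s : ℕ → ℕ} (hs : Function.Involutive s)
    (hsn : ∀ i ∈ Finset.Icc 1 n, s i ∈ Finset.Icc 1 n) :
    ∏ i ∈ Finset.Icc 1 n, ∏ j ∈ Finset.Icc (i + 1) n, g (s i) (s j) =
      ∏ i ∈ Finset.Icc 1 n, ∏ j ∈ Finset.Icc (i + 1) n, g i j := by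
  rw [Finset.prod_sigma', Finset.prod_sigma']
  have hmem : ∀ x : (_ : ℕ) × ℕ, x ∈ (Finset.Icc 1 n).sigma (fun i => Finset.Icc (i + 1) n) ↔
      1 ≤ x.1 ∧ x.1 < x.2 ∧ x.2 ≤ n := fun x => by
    rw [Finset.mem_sigma, Finset.mem_Icc, Finset.mem_Icc]; omega
  have hmap : ∀ x ∈ (Finset.Icc 1 n).sigma (fun i => Finset.Icc (i + 1) n),
      (⟨min (s x.1) (s x.2), max (s x.1) (s x.2)⟩ : (_ : ℕ) × ℕ) ∈
        (Finset.Icc 1 n).sigma (fun i => Finset.Icc (i + 1) n) := by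
    intro x hx
    rw [hmem] at hx ⊢
    have h1 := Finset.mem_Icc.1 (hsn x.1 (Finset.mem_Icc.2 (by omega)))
    have h2 := Finset.mem_Icc.1 (hsn x.2 (Finset.mem_Icc.2 (by omega)))
    have h3 : s x.1 ≠ s x.2 := fun h => by have := hs.injective h; omega
    dsimp only
    omega
  have hinv : ∀ x ∈ (Finset.Icc 1 n).sigma (fun i => Finset.Icc (i + 1) n),
      (⟨min (s (min (s x.1) (s x.2))) (s (max (s x.1) (s x.2))),
        max (s (min (s x.1) (s x.2))) (s (max (s x.1) (s x.2)))⟩ : (_ : ℕ) × ℕ) = x := by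
    rintro ⟨i, j⟩ hx
    rw [hmem] at hx
    dsimp only at hx ⊢
    rcases le_total (s i) (s j) with h | h
    · rw [min_eq_left h, max_eq_right h, hs, hs, min_eq_left hx.2.1.le, max_eq_right hx.2.1.le]
    · rw [min_eq_right h, max_eq_left h, hs, hs, min_eq_right hx.2.1.le, max_eq_left hx.2.1.le]
  refine Finset.prod_nbij' (fun x => ⟨min (s x.1) (s x.2), max (s x.1) (s x.2)⟩)
    (fun x => ⟨min (s x.1) (s x.2), max (s x.1) (s x.2)⟩) hmap hmap hinv hinv fun x _ => ?_
  rcases le_total (s x.1) (s x.2) with h | h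
  · simp only [min_eq_left h, max_eq_right h]
  · simp only [min_eq_right h, max_eq_left h, hg]

theorem prefactor_comp {s : Equiv.Perm ℕ} (hs : Function.Involutive s)
    (hsn : ∀ i, i ∈ Finset.Icc 1 n ↔ s i ∈ Finset.Icc 1 n) :
    prefactor n q (u ∘ s) = prefactor n q u := by
  have hσ : ∀ x : ℂ, σ x⁻¹ = -σ x := fun x => by unfold σ; rw [inv_inv]; ring
  have h1 : ∏ i ∈ Finset.Icc 1 n, σ ((u ∘ s) i) * σ (q * (u ∘ s) i) * σ (q * ((u ∘ s) i)⁻¹) =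
      ∏ i ∈ Finset.Icc 1 n, σ (u i) * σ (q * u i) * σ (q * (u i)⁻¹) :=
    Finset.prod_equiv s hsn fun _ _ => rfl
  have h2 := prod_pairs_comp (g := fun i j => (den q (u i) (u j) / σ (u i * (u j)⁻¹)) ^ 2)
    (fun i j => by
      rw [den_comm, ← inv_inv (u i * (u j)⁻¹), hσ, div_neg, neg_sq, mul_inv, inv_inv, mul_comm])
    hs fun i hi => (hsn i).1 hi
  rw [prefactor, prefactor, h1]
  simp only [Function.comp_apply] at h2 ⊢
  rw [h2]

section
variable {s : Equiv.Perm ℕ} {e : Equiv.Perm (Fin (n + 1))}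

theorem kernel_comp (he : ∀ r, (e r).val + 1 = s (r.val + 1))
    (hen : ∀ r : Fin (n + 1), s (r.val + 1) ≤ n ↔ r.val + 1 ≤ n) :
    kernel n q (u ∘ s) = (kernel n q u).submatrix e e := by
  ext r c
  simp only [kernel, kernelColumn, Matrix.of_apply, Matrix.submatrix_apply, Function.comp_apply,
    hen, he]

theorem prod_erase_comp (hsn : ∀ i, i ∈ Finset.Icc 1 n ↔ s i ∈ Finset.Icc 1 n) (k : ℕ)
    (f : ℕ → ℂ) :
    ∏ i ∈ (Finset.Icc 1 n).erase k, f (s i) = ∏ i ∈ (Finset.Icc 1 n).erase (s k), f i :=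
  Finset.prod_equiv s (fun i => by
    rw [Finset.mem_erase, Finset.mem_erase, hsn, s.injective.ne_iff]) fun _ _ => rfl

theorem column₁_comp (he : ∀ r, (e r).val + 1 = s (r.val + 1))
    (hen : ∀ r : Fin (n + 1), s (r.val + 1) ≤ n ↔ r.val + 1 ≤ n)
    (hsn : ∀ i, i ∈ Finset.Icc 1 n ↔ s i ∈ Finset.Icc 1 n) :
    column₁ n q (u ∘ s) w = column₁ n q u w ∘ e := by
  ext r
  simp only [column₁, Function.comp_apply, hen, he]
  rw [prod_erase_comp hsn (r.val + 1) fun i => w ^ 2 * den q (u i) w,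
    Finset.prod_equiv s (t := Finset.Icc 1 n) (g := fun i => w ^ 2 * den q (u i) w) hsn
      fun _ _ => rfl]

theorem column₂_comp (he : ∀ r, (e r).val + 1 = s (r.val + 1))
    (hen : ∀ r : Fin (n + 1), s (r.val + 1) ≤ n ↔ r.val + 1 ≤ n)
    (hsn : ∀ i, i ∈ Finset.Icc 1 n ↔ s i ∈ Finset.Icc 1 n) :
    column₂ n q (u ∘ s) w = column₂ n q u w ∘ e := by
  ext r
  simp only [column₂, Function.comp_apply, hen, he]
  rw [prod_erase_comp hsn (r.val + 1) fun i => w ^ 2 * den q (u i) w,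
    Finset.prod_equiv s (t := Finset.Icc 1 n) (g := fun i => w ^ 2 * den q (u i) w) hsn
      fun _ _ => rfl]

end

theorem Z_swap (hq : q ≠ 0) (hq4 : σ (q ^ 4) ≠ 0) (hu : Generic n q u) (hw : w ≠ 0) {p : ℕ}
    (hp : 1 ≤ p) (hpn : p + 1 ≤ n) :
    Z n q (Function.update (u ∘ Equiv.swap p (p + 1)) (n + 1) w) =
      Z n q (Function.update u (n + 1) w) := by
  rw [Z_eq_amplitude, Z_eq_amplitude]
  set y : ℕ → ℂ := fun k => Function.update u (n + 1) w (n + 1 - k) with hy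
  have hy0 : ∀ j, y j ≠ 0 := fun j => by
    rw [hy]
    dsimp only
    rcases eq_or_ne (n + 1 - j) (n + 1) with h | h
    · rw [h, Function.update_self]; exact hw
    · rw [Function.update_of_ne h]; exact hu.ne_zero _
  have hy' : ∀ j, 1 ≤ j → y j = u (n + 1 - j) := fun j hj => by
    rw [hy]
    exact Function.update_of_ne (by omega) _ _
  obtain ⟨k, hk⟩ : ∃ k, k + 1 + p = n := ⟨n - p - 1, by omega⟩
  have h1 : y (k + 1) = u (p + 1) := by rw [hy' _ (by omega)]; congr 1; omega
  have h2 : y (k + 2) = u p := by rw [hy' _ (by omega)]; congr 1; omega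
  rw [← amplitude_swapParam (p := k) hq hq4 hy0 (by omega)]
  · refine amplitude_congr fun j hj => ?_
    rcases eq_or_ne j 0 with rfl | hj0
    · rw [swapParam_of_ne (by omega) (by omega)]
      simp [hy]
    · rw [Function.update_of_ne (by omega), Function.comp_apply]
      rcases eq_or_ne j (k + 1) with rfl | hj1
      · rw [swapParam_left, h2, show n + 1 - (k + 1) = p + 1 by omega, Equiv.swap_apply_right]
      · rcases eq_or_ne j (k + 2) with rfl | hj2
        · rw [swapParam_right, h1, show n + 1 - (k + 2) = p by omega, Equiv.swap_apply_left]
        · rw [swapParam_of_ne hj1 hj2, hy' _ (by omega),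
            Equiv.swap_apply_of_ne_of_ne (by omega) (by omega)]
  · have h3 := hu.ne_zero p
    have h4 := hu.ne_zero (p + 1)
    rw [wt, exchangeParam, h1, h2]
    refine div_ne_zero (fun h => ?_) hq4
    rw [σ_eq_zero (by positivity)] at h
    refine hu.shift_ne_sq p (Finset.mem_Icc.2 (by omega)) (p + 1) (Finset.mem_Icc.2 (by omega)) ?_
    field_simp at h
    linear_combination h

/-- The defect is symmetric in `u_1, …, u_n`. -/
theorem defect_swap (hq : q ≠ 0) (hq4 : σ (q ^ 4) ≠ 0) (hu : Generic n q u) (hw : w ≠ 0) {p : ℕ}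
    (hp : 1 ≤ p) (hpn : p + 1 ≤ n) :
    defect n q (u ∘ Equiv.swap p (p + 1)) w = defect n q u w := by
  set s := Equiv.swap p (p + 1) with hs
  -- The induced permutation of the rows and columns of the kernel, which are numbered from `0`.
  let e : Equiv.Perm (Fin (n + 1)) := Equiv.swap ⟨p - 1, by omega⟩ ⟨p, by omega⟩
  have hsd : ∀ i, s i = if i = p then p + 1 else if i = p + 1 then p else i :=
    fun i => Equiv.swap_apply_def _ _ _
  have he : ∀ r, (e r).val + 1 = s (r.val + 1) := fun r => by
    rw [hsd, Equiv.swap_apply_def]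
    split_ifs <;> simp_all [Fin.ext_iff]
    omega
  have hsn : ∀ i, i ∈ Finset.Icc 1 n ↔ s i ∈ Finset.Icc 1 n := fun i => by
    rw [hsd, Finset.mem_Icc, Finset.mem_Icc]
    split_ifs <;> omega
  have hen : ∀ r : Fin (n + 1), s (r.val + 1) ≤ n ↔ r.val + 1 ≤ n := fun r => by
    have := hsn (r.val + 1)
    rw [Finset.mem_Icc, Finset.mem_Icc] at this
    have := he r
    omega
  have hel : e (Fin.last n) = Fin.last n := by
    have := hen (Fin.last n)
    rw [← he, Fin.val_last] at this
    exact Fin.ext (by rw [Fin.val_last]; omega)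
  have hcr : ∀ (A : Matrix (Fin (n + 1)) (Fin (n + 1)) ℂ) (b : Fin (n + 1) → ℂ),
      (A.submatrix e e).cramer (b ∘ e) (Fin.last n) = A.cramer b (Fin.last n) := fun A b => by
    have hb : (b ∘ e) ∘ e.symm = b := funext fun r => by simp
    rw [Matrix.cramer_submatrix_equiv, Function.comp_apply, hel, hb]
  have hinv : (u ∘ s)⁻¹ = u⁻¹ ∘ s := rfl
  have hP : ∏ i ∈ Finset.Icc 1 n, w * σ ((u ∘ s) i * w⁻¹) =
      ∏ i ∈ Finset.Icc 1 n, w * σ (u i * w⁻¹) := Finset.prod_equiv s hsn fun _ _ => rfl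
  have hss : Function.Involutive s := fun i => by
    rw [hs, ← Equiv.Perm.mul_apply, Equiv.swap_mul_self, Equiv.Perm.one_apply]
  rw [defect, defect, Z_swap hq hq4 hu hw hp hpn, prefactor_comp hss hsn, hinv,
    kernel_comp he hen, kernel_comp he hen, column₁_comp he hen hsn, column₂_comp he hen hsn,
    hcr, hcr, hP]

end

/-! ### The recursion -/

section

variable {q : ℂ} {n m : ℕ} {u v : ℕ → ℂ} {w x : ℂ}

/-- The parameters `u_2, …, u_{m+1}, u_1` of the smaller system to which the reduction leads. -/
def rotate (m : ℕ) (u : ℕ → ℂ) (j : ℕ) : ℂ := if j ≤ m then u (j + 1) else u 1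

theorem prod_Icc_shift (a b : ℕ) (f : ℕ → ℂ) :
    ∏ i ∈ Finset.Icc (a + 1) (b + 1), f i = ∏ i ∈ Finset.Icc a b, f (i + 1) := by
  rw [← Finset.image_add_right_Icc, Finset.prod_image (by simp)]

theorem prod_erase_one (m : ℕ) (f : ℕ → ℂ) :
    ∏ i ∈ (Finset.Icc 1 (m + 1)).erase 1, f i = ∏ i ∈ Finset.Icc 1 m, f (i + 1) := by
  rw [Finset.Icc_erase_left, ← prod_Icc_shift]
  exact Finset.prod_congr (by ext; simp only [Finset.mem_Ioc, Finset.mem_Icc]; omega) fun _ _ => rfl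

theorem prod_Icc_one_succ (m : ℕ) (f : ℕ → ℂ) :
    ∏ i ∈ Finset.Icc 1 (m + 1), f i = f 1 * ∏ i ∈ Finset.Icc 1 m, f (i + 1) := by
  rw [← Finset.mul_prod_erase _ f (Finset.mem_Icc.2 (by omega) : 1 ∈ Finset.Icc 1 (m + 1)),
    prod_erase_one]

theorem prod_Icc_reflect (m : ℕ) (f : ℕ → ℂ) :
    ∏ k ∈ Finset.Icc 1 m, f (m + 2 - k) = ∏ k ∈ Finset.Icc 1 m, f (k + 1) := by
  refine Finset.prod_nbij' (fun i => m + 1 - i) (fun i => m + 1 - i) ?_ ?_ ?_ ?_ ?_ <;>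
    simp only [Finset.mem_Icc]
  · intro i hi; omega
  · intro i hi; omega
  · intro i hi; omega
  · intro i hi; omega
  · intro i hi; congr 1; omega

/-- The reduction of the amplitude in terms of the partition function. -/
theorem Z_reduction (hq : q ≠ 0) (hq4 : σ (q ^ 4) ≠ 0) (hu : ∀ j, u j ≠ 0)
    (hw : u 1 * w = q ^ 2) :
    Z (m + 1) q (Function.update u (m + 2) w) = (1 + refl q (u 1)) * refl q (u 1)⁻¹ *
      (∏ k ∈ Finset.Icc 1 m, wt q (u 1 * u (k + 1))) *
      (∏ k ∈ Finset.Icc 1 m, wt q (u (k + 1) * w)) *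
        Z m q (rotate m u) := by
  have hw0 : w ≠ 0 := right_ne_zero_of_mul (hw.trans_ne (pow_ne_zero 2 hq))
  set y : ℕ → ℂ := fun k => Function.update u (m + 2) w (m + 2 - k) with hy
  have hy0 : ∀ j, y j ≠ 0 := fun j => by
    rw [hy]
    dsimp only
    rcases eq_or_ne (m + 2 - j) (m + 2) with h | h
    · rw [h, Function.update_self]; exact hw0
    · rw [Function.update_of_ne h]; exact hu _
  have hy' : ∀ j, 1 ≤ j → y j = u (m + 2 - j) := fun j hj => Function.update_of_ne (by omega) _ _
  have h1 : y (m + 1) = u 1 := by rw [hy' _ (by omega)]; congr 1; omega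
  have h2 : y 0 = w := by simp [hy]
  rw [Z_eq_amplitude, Z_eq_amplitude, amplitude_reduction hq hq4 hy0 (by rw [h1, h2, hw]), h1, h2,
    ← prod_Icc_reflect m fun k => wt q (u 1 * u k), ← prod_Icc_reflect m fun k => wt q (u k * w)]
  congr 1
  · congr 1
    · congr 1
      exact Finset.prod_congr rfl fun k hk => by rw [hy' _ (Finset.mem_Icc.1 hk).1]
    · exact Finset.prod_congr rfl fun k hk => by rw [hy' _ (Finset.mem_Icc.1 hk).1]
  · refine amplitude_congr fun j hj => ?_
    rcases eq_or_ne j 0 with rfl | hj0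
    · simp [rotate]
    · rw [Function.update_of_ne hj0, hy' _ (by omega), rotate, if_pos (by omega)]
      congr 1
      omega

theorem prefactor_congr (h : ∀ i ∈ Finset.Icc 1 n, u i = v i) :
    prefactor n q u = prefactor n q v := by
  unfold prefactor
  congr 1
  · congr 1
    exact Finset.prod_congr rfl fun i hi => by rw [h i hi]
  · refine Finset.prod_congr rfl fun i hi => Finset.prod_congr rfl fun j hj => ?_
    rw [h i hi, h j (by rw [Finset.mem_Icc] at hj ⊢; omega)]

theorem prefactor_reduction (m : ℕ) (q : ℂ) (u : ℕ → ℂ) :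
    prefactor (m + 1) q u =
      σ (q ^ 2) / (σ q ^ 2 * σ (q ^ 4)) * (σ (u 1) * σ (q * u 1) * σ (q * (u 1)⁻¹)) *
      (∏ k ∈ Finset.Icc 1 m,
        (den q (u 1) (u (k + 1)) / σ (u 1 * (u (k + 1))⁻¹)) ^ 2 / σ (q ^ 4) ^ 2) *
      prefactor m q (rotate m u) := by
  have h : prefactor m q (rotate m u) = prefactor m q fun i => u (i + 1) :=
    prefactor_congr fun i hi => if_pos (Finset.mem_Icc.1 hi).2
  rw [h, prefactor, prefactor, prod_Icc_one_succ, prod_Icc_one_succ, prod_Icc_shift,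
    Finset.prod_div_distrib, Finset.prod_const, Nat.card_Icc, Nat.add_sub_cancel]
  simp only [prod_Icc_shift]
  rw [show (m + 1) ^ 2 = m ^ 2 + 2 * m + 1 by ring, show 2 * (m + 1) = 2 * m + 2 by ring]
  simp only [pow_add, pow_mul, div_eq_mul_inv, mul_inv]
  ring

/-- If the last column of the kernel is replaced by a multiple of the first unit vector, then the
determinant is that of the kernel of the smaller system. The rotation of its columns has sign
`(-1)^m`, and the expansion along the last column contributes `(-1)^{m+1}`. -/
theorem cramer_kernel_single (q : ℂ) (u : ℕ → ℂ) (c : ℂ) :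
    (kernel (m + 1) q u).cramer (Pi.single 0 c) (Fin.last (m + 1)) =
      -c * (kernel m q (rotate m u)).det := by
  have hsub : (((kernel (m + 1) q u).updateCol (Fin.last (m + 1)) (Pi.single 0 c)).submatrix
      (Fin.succAbove 0) (Fin.last (m + 1)).succAbove).submatrix id (finRotate (m + 1)) =
      kernel m q (rotate m u) := by
    ext r d
    have hd : u ((finRotate (m + 1) d).val + 1) = rotate m u (d.val + 1) := by
      rw [rotate]
      split_ifs with h
      · rw [coe_finRotate_of_ne_last (fun h' => by rw [h', Fin.val_last] at h; omega)]
      · rw [show d = Fin.last m from Fin.ext (by rw [Fin.val_last]; omega), finRotate_last]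
        rfl
    simp only [Matrix.submatrix_apply, Fin.succAbove_zero, Fin.succAbove_last, id]
    rw [Matrix.updateCol_ne (Fin.castSucc_lt_last _).ne]
    simp only [kernel, kernelColumn, Matrix.of_apply, Fin.val_succ, Fin.val_castSucc, hd]
    simp only [Nat.add_le_add_iff_right]
    split_ifs with h
    · rw [rotate, rotate, if_pos h]
    · rfl
  have hdet := congrArg Matrix.det hsub
  rw [Matrix.det_permute', sign_finRotate] at hdet
  rw [Matrix.cramer_apply, Matrix.det_succ_column _ (Fin.last (m + 1)), Finset.sum_eq_single 0]
  · rw [Matrix.updateCol_self, Pi.single_eq_same, ← hdet]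
    simp only [Fin.val_zero, Fin.val_last, Nat.add_sub_cancel, zero_add]
    push_cast
    rw [pow_succ]
    ring
  · intro i _ hi
    rw [Matrix.updateCol_self, Pi.single_eq_of_ne hi, mul_zero, zero_mul]
  · simp

theorem rotate_inv (m : ℕ) (u : ℕ → ℂ) : (rotate m u)⁻¹ = rotate m u⁻¹ := by
  ext j
  simp only [rotate, Pi.inv_apply]
  split_ifs <;> rfl

theorem determinantFormula_rotate (m : ℕ) (q : ℂ) (u : ℕ → ℂ) :
    determinantFormula m q (rotate m u) = prefactor m q (rotate m u) *
      (∏ k ∈ Finset.Icc 1 m, den q (u (k + 1)) (u 1) / σ (u (k + 1) * (u 1)⁻¹)) *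
      ((u 1 - 1) * (kernel m q (rotate m u)).det +
        ((u 1)⁻¹ - 1) * (kernel m q (rotate m u⁻¹)).det) := by
  have h : rotate m u (m + 1) = u 1 := if_neg (by omega)
  rw [determinantFormula, h, rotate_inv]
  congr 2
  exact Finset.prod_congr rfl fun k hk => by rw [rotate, if_pos (Finset.mem_Icc.1 hk).2]

/-- At a zero of `den(u_1, w)`, only the first entry of the cleared column survives. -/
theorem column₁_node (hd : den q (u 1) w = 0) :
    column₁ (m + 1) q u w = Pi.single 0 ((w ^ 2 - 1) * (w ^ 2 * num q (u 1) w) *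
      ∏ k ∈ Finset.Icc 1 m, w ^ 2 * den q (u (k + 1)) w) := by
  have h1 : (1 : ℕ) ∈ Finset.Icc 1 (m + 1) := Finset.mem_Icc.2 (by omega)
  ext r
  rw [column₁]
  rcases eq_or_ne r 0 with rfl | hr
  · rw [Pi.single_eq_same, if_pos (by simp), Fin.val_zero, zero_add,
      prod_erase_one m fun k => w ^ 2 * den q (u k) w]
  · have hr' : r.val ≠ 0 := fun h => hr (Fin.ext h)
    rw [Pi.single_eq_of_ne hr]
    split_ifs
    · rw [Finset.prod_eq_zero (Finset.mem_erase.2 ⟨by omega, h1⟩) (by rw [hd, mul_zero]), mul_zero]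
    · exact Finset.prod_eq_zero h1 (by rw [hd, mul_zero])

theorem column₂_node (hd : den q (u 1) w = 0) :
    column₂ (m + 1) q u w = Pi.single 0 ((1 - w ^ 2) * (w * num q (u 1)⁻¹ w⁻¹) *
      ∏ k ∈ Finset.Icc 1 m, w ^ 2 * den q (u (k + 1)) w) := by
  have h1 : (1 : ℕ) ∈ Finset.Icc 1 (m + 1) := Finset.mem_Icc.2 (by omega)
  ext r
  rw [column₂]
  rcases eq_or_ne r 0 with rfl | hr
  · rw [Pi.single_eq_same, if_pos (by simp), Fin.val_zero, zero_add,
      prod_erase_one m fun k => w ^ 2 * den q (u k) w]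
  · have hr' : r.val ≠ 0 := fun h => hr (Fin.ext h)
    rw [Pi.single_eq_of_ne hr]
    split_ifs
    · rw [Finset.prod_eq_zero (Finset.mem_erase.2 ⟨by omega, h1⟩) (by rw [hd, mul_zero]), mul_zero]
    · rw [Finset.prod_eq_zero h1 (by rw [hd, mul_zero]), mul_zero]

/-- The factors that involve one of the parameters `b = u_2, …, u_{m+1}` agree on both sides of the
recursion. -/
theorem node_factor (hq : q ≠ 0) {a b : ℂ} (ha : a ≠ 0) (hb : b ≠ 0) (hab : a ^ 2 ≠ b ^ 2) :
    q ^ 2 / a * wt q (a * b) * wt q (b * (q ^ 2 / a)) * (q ^ 2 / a * σ (b * (q ^ 2 / a)⁻¹)) *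
        (den q b a / σ (b * a⁻¹)) =
      (den q a b / σ (a * b⁻¹)) ^ 2 / σ (q ^ 4) ^ 2 * ((q ^ 2 / a) ^ 2 * den q b (q ^ 2 / a)) := by
  have h1 : σ (b * (q ^ 2 / a)⁻¹) = -σ (q ^ 2 * a⁻¹ * b⁻¹) := by
    rw [σ, σ]; field_simp; ring
  have h2 : σ (q ^ 2 * b⁻¹ * (q ^ 2 / a)⁻¹) = σ (a * b⁻¹) := by
    congr 1; field_simp
  have h3 : σ (b * a⁻¹) = -σ (a * b⁻¹) := by
    rw [σ, σ]; field_simp; ring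
  have h4 : σ (a * b⁻¹) ≠ 0 := fun h => hab (by
    rw [σ_eq_zero (by positivity)] at h
    field_simp at h
    exact h)
  rw [den_comm q b a, den, den, wt, wt, h1, h2, h3, mul_assoc (q ^ 2) a b,
    mul_assoc (q ^ 2) b (q ^ 2 / a)]
  generalize σ (q ^ 2 * (a * b)) = X
  generalize σ (q ^ 2 * (b * (q ^ 2 / a))) = Y
  generalize σ (q ^ 2 * a⁻¹ * b⁻¹) = V
  generalize σ (q ^ 4) = F
  generalize σ (a * b⁻¹) = T at *
  field_simp

/-- The factors of the recursion that involve only `a = u_1`, for the first determinant. -/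
theorem node_head₁ (hq : q ≠ 0) (hq4 : σ (q ^ 4) ≠ 0) {a : ℂ} (ha : a ≠ 0) :
    q ^ 2 / a * ((1 + refl q a) * refl q a⁻¹) * (q ^ 2 / a * σ (a * (q ^ 2 / a)⁻¹)) *
        (q ^ 2 / a + 1) * (a - 1) =
      -(σ (q ^ 2) / (σ q ^ 2 * σ (q ^ 4)) * (σ a * σ (q * a) * σ (q * a⁻¹)) *
        (((q ^ 2 / a) ^ 2 - 1) * ((q ^ 2 / a) ^ 2 * num q a (q ^ 2 / a)))) := by
  have h8 := pow_eight_sub_one_ne_zero hq hq4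
  have h2 := pow_two_sub_one_ne_zero hq hq4
  rw [refl_eq hq ha, refl_eq hq (inv_ne_zero ha), num, σ_pow_four hq, σ_eq hq, σ_eq ha,
    σ_eq (pow_ne_zero 2 hq), σ_eq (mul_ne_zero hq ha), σ_eq (mul_ne_zero hq (inv_ne_zero ha)),
    σ_eq (by positivity)]
  field_simp
  ring

/-- The factors of the recursion that involve only `a = u_1`, for the second determinant. -/
theorem node_head₂ (hq : q ≠ 0) (hq4 : σ (q ^ 4) ≠ 0) {a : ℂ} (ha : a ≠ 0) :
    q ^ 2 / a * ((1 + refl q a) * refl q a⁻¹) * (q ^ 2 / a * σ (a * (q ^ 2 / a)⁻¹)) *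
        (q ^ 2 / a + 1) * (a⁻¹ - 1) =
      -(σ (q ^ 2) / (σ q ^ 2 * σ (q ^ 4)) * (σ a * σ (q * a) * σ (q * a⁻¹)) *
        ((1 - (q ^ 2 / a) ^ 2) * (q ^ 2 / a * num q a⁻¹ (q ^ 2 / a)⁻¹))) := by
  have h8 := pow_eight_sub_one_ne_zero hq hq4
  have h2 := pow_two_sub_one_ne_zero hq hq4
  rw [refl_eq hq ha, refl_eq hq (inv_ne_zero ha), num, σ_pow_four hq, σ_eq hq, σ_eq ha,
    σ_eq (pow_ne_zero 2 hq), σ_eq (mul_ne_zero hq ha), σ_eq (mul_ne_zero hq (inv_ne_zero ha)),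
    σ_eq (by positivity)]
  field_simp
  ring

/-- The formula for the smaller system implies that the defect vanishes at `u_1 w = q²`: both sides
of the formula satisfy the same recursion there. -/
theorem defect_eq_zero_of_mul_eq (hq : q ≠ 0) (hq4 : σ (q ^ 4) ≠ 0) (hu : Generic (m + 1) q u)
    (hZ : Z m q (rotate m u) = determinantFormula m q (rotate m u)) (hw : u 1 * w = q ^ 2) :
    defect (m + 1) q u w = 0 := by
  have ha := hu.ne_zero 1
  have hwa : w = q ^ 2 / u 1 := by rw [← hw]; field_simp
  have hd : den q (u 1) w = 0 := by
    rw [den, hwa, show q ^ 2 * (u 1)⁻¹ * (q ^ 2 / u 1)⁻¹ = 1 by field_simp,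
      (σ_eq_zero one_ne_zero).2 (one_pow 2), mul_zero]
  have hP : w ^ m * (∏ k ∈ Finset.Icc 1 m, wt q (u 1 * u (k + 1))) *
      (∏ k ∈ Finset.Icc 1 m, wt q (u (k + 1) * w)) *
      (∏ k ∈ Finset.Icc 1 m, w * σ (u (k + 1) * w⁻¹)) *
      (∏ k ∈ Finset.Icc 1 m, den q (u (k + 1)) (u 1) / σ (u (k + 1) * (u 1)⁻¹)) =
      (∏ k ∈ Finset.Icc 1 m,
        (den q (u 1) (u (k + 1)) / σ (u 1 * (u (k + 1))⁻¹)) ^ 2 / σ (q ^ 4) ^ 2) *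
      ∏ k ∈ Finset.Icc 1 m, w ^ 2 * den q (u (k + 1)) w := by
    have : w ^ m = ∏ _k ∈ Finset.Icc 1 m, w := by simp
    rw [this, ← Finset.prod_mul_distrib, ← Finset.prod_mul_distrib, ← Finset.prod_mul_distrib,
      ← Finset.prod_mul_distrib, ← Finset.prod_mul_distrib]
    refine Finset.prod_congr rfl fun k hk => ?_
    rw [Finset.mem_Icc] at hk
    rw [hwa]
    exact node_factor hq ha (hu.ne_zero _) (hu.sq_ne_sq 1 (Finset.mem_Icc.2 (by omega)) (k + 1)
      (Finset.mem_Icc.2 (by omega)) (by omega))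
  have h1 := node_head₁ hq hq4 ha
  have h2 := node_head₂ hq hq4 ha
  rw [← hwa] at h1 h2
  rw [defect, Z_reduction hq hq4 hu.ne_zero hw, hZ, determinantFormula_rotate, prefactor_reduction,
    prod_Icc_one_succ m fun i => w * σ (u i * w⁻¹), column₁_node hd, column₂_node hd,
    cramer_kernel_single, cramer_kernel_single, pow_succ]
  generalize (∏ k ∈ Finset.Icc 1 m, wt q (u 1 * u (k + 1))) = A₁ at *
  generalize (∏ k ∈ Finset.Icc 1 m, wt q (u (k + 1) * w)) = A₂ at *
  generalize (∏ k ∈ Finset.Icc 1 m, w * σ (u (k + 1) * w⁻¹)) = A₃ at *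
  generalize (∏ k ∈ Finset.Icc 1 m, den q (u (k + 1)) (u 1) / σ (u (k + 1) * (u 1)⁻¹)) = A₄ at *
  generalize (∏ k ∈ Finset.Icc 1 m,
        (den q (u 1) (u (k + 1)) / σ (u 1 * (u (k + 1))⁻¹)) ^ 2 / σ (q ^ 4) ^ 2) = B₁ at *
  generalize (∏ k ∈ Finset.Icc 1 m, w ^ 2 * den q (u (k + 1)) w) = B₂ at *
  generalize (kernel m q (rotate m u)).det = D₁
  generalize (kernel m q (rotate m u⁻¹)).det = D₂
  generalize prefactor m q (rotate m u) = P
  linear_combination P * w * ((1 + refl q (u 1)) * refl q (u 1)⁻¹) * (w * σ (u 1 * w⁻¹)) * (w + 1) *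
      ((u 1 - 1) * D₁ + ((u 1)⁻¹ - 1) * D₂) * hP + B₁ * B₂ * P * D₁ * h1 + B₁ * B₂ * P * D₂ * h2

end

/-! ### Interpolation -/

section

variable {q : ℂ} {n m k : ℕ} {u v : ℕ → ℂ} {w x : ℂ}

theorem Generic.rotate (hu : Generic (m + 1) q u) : Generic (m + 1) q (rotate m u) := by
  have h : DASASM.rotate m u = u ∘ fun j => if j ≤ m then j + 1 else 1 := by
    ext j
    rw [DASASM.rotate, Function.comp_apply]
    split_ifs <;> rfl
  rw [h]
  refine hu.comp (fun i hi => ?_) fun i hi j hj hij => ?_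
  · rw [Finset.mem_Icc] at hi ⊢
    split_ifs <;> omega
  · rw [Finset.mem_Icc] at hi hj
    split_ifs <;> omega

theorem Generic.swap (hu : Generic n q u) {p : ℕ} (hp : 1 ≤ p) (hpn : p + 1 ≤ n) :
    Generic n q (u ∘ Equiv.swap p (p + 1)) := by
  refine hu.comp (fun i hi => ?_) fun i _ j _ hij => (Equiv.injective _).ne hij
  rw [Equiv.swap_apply_def]
  rw [Finset.mem_Icc] at hi ⊢
  split_ifs <;> omega

/-- The defect vanishes where `(u_k w)² = q⁴`. For `k = 1` this is the recursion and its image under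
`u_1 ↦ -u_1`, and symmetry in `u_1, …, u_n` gives the other values of `k`. -/
theorem defect_eq_zero_of_mul_sq_eq (hq : q ≠ 0) (hq4 : σ (q ^ 4) ≠ 0)
    (H : ∀ v, Generic (m + 1) q v → Z m q v = determinantFormula m q v)
    (hk : 1 ≤ k) (hkm : k ≤ m + 1) (hu : Generic (m + 1) q u) (hw : (u k * w) ^ 2 = q ^ 4) :
    defect (m + 1) q u w = 0 := by
  have hw0 : w ≠ 0 := fun h => pow_ne_zero 4 hq (by rw [← hw, h]; simp)
  induction k, hk using Nat.le_induction generalizing u with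
  | base =>
    have h : (u 1 * w) ^ 2 = (q ^ 2) ^ 2 := by rw [hw]; ring
    rcases sq_eq_sq_iff_eq_or_eq_neg.1 h with h | h
    · exact defect_eq_zero_of_mul_eq hq hq4 hu (H _ hu.rotate) h
    · have hu' : Generic (m + 1) q (Function.update u 1 (-u 1)) := hu.congr_sq fun j => by
        rcases eq_or_ne j 1 with rfl | hj
        · rw [Function.update_self, neg_sq]
        · rw [Function.update_of_ne hj]
      rw [← neg_eq_zero, ← defect_neg]
      exact defect_eq_zero_of_mul_eq hq hq4 hu' (H _ hu'.rotate)
        (by rw [Function.update_self, neg_mul, h, neg_neg])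
  | succ k hk ih =>
    rw [← defect_swap hq hq4 hu hw0 hk hkm]
    exact ih (by omega) (hu.swap hk hkm) (by rw [Function.comp_apply, Equiv.swap_apply_left, hw])

/-- The defect vanishes identically: its degree is at most `4n + 1`, and it vanishes at the `4n + 2`
points `w` for which `w²` is one of `u_k²`, `q⁴ u_k⁻²` and `q⁻⁴ u_1⁻²`. -/
theorem defect_eq_zero (hq : q ≠ 0) (hq4 : σ (q ^ 4) ≠ 0)
    (H : ∀ v, Generic (m + 1) q v → Z m q v = determinantFormula m q v)
    (hu : Generic (m + 1) q u) (hw : w ≠ 0) : defect (m + 1) q u w = 0 := by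
  have h0 := hu.ne_zero
  have hI : ∀ i : Fin (m + 1), i.val + 1 ∈ Finset.Icc 1 (m + 1) := fun i =>
    Finset.mem_Icc.2 (by omega)
  have h1 : 1 ∈ Finset.Icc 1 (m + 1) := Finset.mem_Icc.2 (by omega)
  have hne : ∀ i j : Fin (m + 1), u (i.val + 1) ^ 2 = u (j.val + 1) ^ 2 → i = j := fun i j h => by
    by_contra hij
    exact hu.sq_ne_sq _ (hI i) _ (hI j) (fun h => hij (Fin.ext (by omega))) h
  -- The values of `w ^ 2` at the zeros; `hA`, `hB`, `hC` and `hD` show that they are distinct.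
  let t : Fin (m + 1) ⊕ Fin (m + 1) ⊕ Unit → ℂ := Sum.elim (fun i => u (i.val + 1) ^ 2)
    (Sum.elim (fun i => q ^ 4 / u (i.val + 1) ^ 2) fun _ => 1 / (q ^ 4 * u 1 ^ 2))
  have hA : ∀ i j : Fin (m + 1), u (i.val + 1) ^ 2 ≠ q ^ 4 / u (j.val + 1) ^ 2 := fun i j h =>
    hu.mul_ne_pow _ (hI i) _ (hI j) (by rw [h, div_mul_cancel₀ _ (pow_ne_zero 2 (h0 _))])
  have hB : ∀ i : Fin (m + 1), u (i.val + 1) ^ 2 ≠ 1 / (q ^ 4 * u 1 ^ 2) := fun i h =>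
    hu.mul_ne_one 1 h1 _ (hI i) (by
      rw [h, mul_one_div_cancel (mul_ne_zero (pow_ne_zero 4 hq) (pow_ne_zero 2 (h0 _)))])
  have hC : ∀ i : Fin (m + 1), q ^ 4 / u (i.val + 1) ^ 2 ≠ 1 / (q ^ 4 * u 1 ^ 2) := fun i h => by
    have := h0 1; have := h0 (i.val + 1)
    refine hu.shift_ne_sq 1 h1 _ (hI i) ?_
    field_simp at h
    linear_combination h
  have hD : ∀ i j : Fin (m + 1), q ^ 4 / u (i.val + 1) ^ 2 = q ^ 4 / u (j.val + 1) ^ 2 → i = j :=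
    fun i j h => by
      have := h0 (i.val + 1); have := h0 (j.val + 1)
      refine (hne _ _ ?_).symm
      field_simp at h
      exact h
  refine (isPoly_defect (by omega) q u).eq_zero_of_roots (t := t) ?_ ?_ ?_ ?_ hw
  · rintro (i | i | i) (j | j | j) h
    · exact congrArg _ (hne i j h)
    · exact absurd h (hA i j)
    · exact absurd h (hB i)
    · exact absurd h.symm (hA j i)
    · exact congrArg _ (congrArg _ (hD i j h))
    · exact absurd h (hC i)
    · exact absurd h.symm (hB j)
    · exact absurd h.symm (hC j)
    · rfl
  · rintro (i | i | i)
    · exact pow_ne_zero 2 (h0 _)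
    · exact div_ne_zero (pow_ne_zero 4 hq) (pow_ne_zero 2 (h0 _))
    · exact one_div_ne_zero (mul_ne_zero (pow_ne_zero 4 hq) (pow_ne_zero 2 (h0 _)))
  · simp only [Fintype.card_sum, Fintype.card_fin, Fintype.card_unit]
    omega
  · rintro (i | i | i) r hr
    · exact defect_eq_zero_of_sq_eq hq hu (hI i) hr
    · refine defect_eq_zero_of_mul_sq_eq hq hq4 H (by omega) (by omega : i.val + 1 ≤ m + 1) hu ?_
      rw [mul_pow, show r ^ 2 = q ^ 4 / u (i.val + 1) ^ 2 from hr,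
        mul_div_cancel₀ _ (pow_ne_zero 2 (h0 _))]
    · have hr' : r ^ 2 = 1 / (q ^ 4 * u 1 ^ 2) := hr
      have hr0 : r ≠ 0 := fun h => by
        rw [h, zero_pow two_ne_zero] at hr'
        exact one_div_ne_zero (mul_ne_zero (pow_ne_zero 4 hq) (pow_ne_zero 2 (h0 _))) hr'.symm
      have h2 : defect (m + 1) q u⁻¹ r⁻¹ = 0 := by
        refine defect_eq_zero_of_mul_sq_eq hq hq4 H le_rfl (by omega) hu.inv ?_
        have := h0 1
        rw [mul_pow, inv_pow, hr', Pi.inv_apply]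
        field_simp
      rw [defect_inv hr0] at h2
      exact (mul_eq_zero.1 h2).resolve_left
        (mul_ne_zero (pow_ne_zero _ (by norm_num)) (pow_ne_zero _ (inv_ne_zero hr0)))

theorem Z_zero (q : ℂ) (u : ℕ → ℂ) : Z 0 q u = 1 := by
  rw [Z_eq_amplitude, amplitude, scattering]
  simp [incoming]

theorem Z_eq_of_generic (hq : q ≠ 0) (hq4 : σ (q ^ 4) ≠ 0) (n : ℕ) {u : ℕ → ℂ}
    (hu : Generic (n + 1) q u) : Z n q u = determinantFormula n q u := by
  induction n generalizing u with
  | zero =>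
    have h0 := hu.ne_zero 1
    have h1 : u 1 ^ 2 - 1 ≠ 0 := sub_ne_zero.2 (hu.sq_ne_one 1 (by simp))
    have h2 : 1 - u 1 ^ 2 ≠ 0 := sub_ne_zero.2 (hu.sq_ne_one 1 (by simp)).symm
    rw [Z_zero, determinantFormula, prefactor]
    simp only [kernel, kernelColumn, Pi.inv_apply]
    simp
    have h3 : (u 1 ^ 2)⁻¹ - 1 = (1 - u 1 ^ 2) / u 1 ^ 2 := by field_simp
    rw [h3]
    field_simp
    ring
  | succ m ih =>
    have hg : Generic (m + 1) q u := hu.comp (f := id)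
      (fun i hi => by rw [Finset.mem_Icc] at hi ⊢; dsimp; omega) fun _ _ _ _ h => h
    have hmem : m + 1 + 1 ∈ Finset.Icc 1 (m + 1 + 1) := Finset.mem_Icc.2 (by omega)
    have hw := hu.ne_zero (m + 1 + 1)
    have hw1 := hu.sq_ne_one _ hmem
    have hI : ∀ k ∈ Finset.Icc 1 (m + 1), k ∈ Finset.Icc 1 (m + 1 + 1) := fun k hk => by
      rw [Finset.mem_Icc] at hk ⊢; omega
    have hE : ∀ k ∈ Finset.Icc 1 (m + 1), den q (u k) (u (m + 1 + 1)) ≠ 0 := fun k hk =>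
      den_ne_zero hq (hu.ne_zero k) hw (hu.mul_ne_one _ (hI k hk) _ hmem)
        (hu.mul_ne_pow _ (hI k hk) _ hmem)
    have hS : ∏ i ∈ Finset.Icc 1 (m + 1), σ (u i * (u (m + 1 + 1))⁻¹) ≠ 0 :=
      Finset.prod_ne_zero_iff.2 fun i hi h => by
        have h0 := hu.ne_zero i
        rw [σ_eq_zero (mul_ne_zero h0 (inv_ne_zero hw))] at h
        refine hu.sq_ne_sq i (hI i hi) _ hmem (by rw [Finset.mem_Icc] at hi; omega) ?_
        field_simp at h
        exact h
    have hw2 : u (m + 1 + 1) + 1 ≠ 0 := fun h => hw1 (by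
      linear_combination (u (m + 1 + 1) - 1) * h)
    have h := defect_eq_zero hq hq4 (fun v hv => ih hv) hg hw
    rw [defect_eq hw hw1 hE, Function.update_eq_self, mul_eq_zero, sub_eq_zero] at h
    have h := h.resolve_left (mul_ne_zero (pow_ne_zero _ hw) hw2)
    rw [determinantFormula, Finset.prod_div_distrib]
    refine mul_right_cancel₀ hS (h.trans ?_)
    generalize ∏ i ∈ Finset.Icc 1 (m + 1), σ (u i * (u (m + 1 + 1))⁻¹) = S at hS ⊢
    field_simp

end

/-! ### Extension by continuity -/

section

variable {q : ℂ} {n m k : ℕ} {u v : ℕ → ℂ} {w x : ℂ}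

open Filter Topology

/-- Two monomials of different degrees agree only at finitely many points. -/
theorem eventually_mul_pow_ne {a b : ℂ} (ha : a ≠ 0) (c : ℂ) {k l : ℕ} (hkl : k ≠ l) :
    ∀ᶠ t in 𝓝[≠] c, a * t ^ k ≠ b * t ^ l := by
  let P : Polynomial ℂ := Polynomial.C a * Polynomial.X ^ k - Polynomial.C b * Polynomial.X ^ l
  have hP : P ≠ 0 := fun h => ha (by
    have := congrArg (fun p => Polynomial.coeff p k) h
    simpa [P, Polynomial.coeff_X_pow, hkl] using this)
  have hfin : ((P.roots.toFinset : Set ℂ) \ {c}).Finite := P.roots.toFinset.finite_toSet.sdiff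
  have hmem : ((P.roots.toFinset : Set ℂ) \ {c})ᶜ ∈ 𝓝 c :=
    hfin.isClosed.isOpen_compl.mem_nhds (by simp)
  filter_upwards [nhdsWithin_le_nhds hmem, self_mem_nhdsWithin] with t ht htc h
  refine ht ⟨?_, htc⟩
  rw [Finset.mem_coe, Multiset.mem_toFinset, Polynomial.mem_roots hP, Polynomial.IsRoot.def]
  simp [P, h]

/-- Along the curve `u_j t^j`, parameters become generic for `t ≠ 1` close to `1`, since different
powers of `t` occur on the two sides of each forbidden equation. -/
theorem eventually_generic (hq : q ≠ 0) (hq4 : σ (q ^ 4) ≠ 0) (hu : ∀ j, u j ≠ 0) :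
    ∀ᶠ t in 𝓝[≠] (1 : ℂ), Generic n q fun j => u j * t ^ j := by
  have h0 : ∀ᶠ t in 𝓝[≠] (1 : ℂ), t ≠ 0 :=
    nhdsWithin_le_nhds (isOpen_ne.mem_nhds one_ne_zero)
  have h1 : ∀ᶠ t in 𝓝[≠] (1 : ℂ), ∀ i ∈ Finset.Icc 1 n, u i ^ 2 * t ^ (2 * i) ≠ 1 * t ^ 0 :=
    (Finset.eventually_all _).2 fun i hi =>
      eventually_mul_pow_ne (pow_ne_zero 2 (hu i)) 1 (by rw [Finset.mem_Icc] at hi; omega)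
  have h2 : ∀ᶠ t in 𝓝[≠] (1 : ℂ), ∀ i ∈ Finset.Icc 1 n, ∀ j ∈ Finset.Icc 1 n, i ≠ j →
      u i ^ 2 * t ^ (2 * i) ≠ u j ^ 2 * t ^ (2 * j) :=
    (Finset.eventually_all _).2 fun i _ => (Finset.eventually_all _).2 fun j _ =>
      eventually_imp_distrib_left.2 fun hij =>
        eventually_mul_pow_ne (pow_ne_zero 2 (hu i)) 1 (by omega)
  have h3 : ∀ᶠ t in 𝓝[≠] (1 : ℂ), ∀ i ∈ Finset.Icc 1 n, ∀ j ∈ Finset.Icc 1 n,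
      q ^ 4 * u i ^ 2 * u j ^ 2 * t ^ (2 * i + 2 * j) ≠ 1 * t ^ 0 :=
    (Finset.eventually_all _).2 fun i hi => (Finset.eventually_all _).2 fun j _ =>
      eventually_mul_pow_ne (mul_ne_zero (mul_ne_zero (pow_ne_zero 4 hq) (pow_ne_zero 2 (hu i)))
        (pow_ne_zero 2 (hu j))) 1 (by rw [Finset.mem_Icc] at hi; omega)
  have h4 : ∀ᶠ t in 𝓝[≠] (1 : ℂ), ∀ i ∈ Finset.Icc 1 n, ∀ j ∈ Finset.Icc 1 n,
      u i ^ 2 * u j ^ 2 * t ^ (2 * i + 2 * j) ≠ q ^ 4 * t ^ 0 :=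
    (Finset.eventually_all _).2 fun i hi => (Finset.eventually_all _).2 fun j _ =>
      eventually_mul_pow_ne (mul_ne_zero (pow_ne_zero 2 (hu i)) (pow_ne_zero 2 (hu j))) 1
        (by rw [Finset.mem_Icc] at hi; omega)
  have h5 : ∀ᶠ t in 𝓝[≠] (1 : ℂ), ∀ i ∈ Finset.Icc 1 n, ∀ j ∈ Finset.Icc 1 n, i ≠ j →
      q ^ 8 * u i ^ 2 * t ^ (2 * i) ≠ u j ^ 2 * t ^ (2 * j) :=
    (Finset.eventually_all _).2 fun i _ => (Finset.eventually_all _).2 fun j _ =>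
      eventually_imp_distrib_left.2 fun hij =>
        eventually_mul_pow_ne (mul_ne_zero (pow_ne_zero 8 hq) (pow_ne_zero 2 (hu i))) 1 (by omega)
  filter_upwards [h0, h1, h2, h3, h4, h5] with t h0 h1 h2 h3 h4 h5
  refine ⟨fun i => mul_ne_zero (hu i) (pow_ne_zero i h0), fun i hi h => h1 i hi ?_,
    fun i hi j hj hij h => h2 i hi j hj hij ?_, fun i hi j hj h => h3 i hi j hj ?_,
    fun i hi j hj h => h4 i hi j hj ?_, fun i hi j hj h => ?_⟩
  · linear_combination h
  · linear_combination h
  · linear_combination h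
  · linear_combination h
  · rcases eq_or_ne i j with rfl | hij
    · have h6 : (q ^ 8 - 1) * (u i * t ^ i) ^ 2 = 0 := by linear_combination h
      exact mul_ne_zero (pow_eight_sub_one_ne_zero hq hq4)
        (pow_ne_zero 2 (mul_ne_zero (hu i) (pow_ne_zero i h0))) h6
    · refine h5 i hi j hj hij ?_
      linear_combination h

theorem continuousAt_σ {f : ℂ → ℂ} {a : ℂ} (hf : ContinuousAt f a) (h : f a ≠ 0) :
    ContinuousAt (fun t => σ (f t)) a :=
  hf.sub (hf.inv₀ h)

theorem continuousAt_prod {s : Finset ℕ} {f : ℕ → ℂ → ℂ} {a : ℂ}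
    (hf : ∀ i ∈ s, ContinuousAt (f i) a) : ContinuousAt (fun t => ∏ i ∈ s, f i t) a :=
  tendsto_finsetProd s hf

section
variable {v : ℂ → ℕ → ℂ} {a : ℂ}

theorem continuousAt_den (hq : q ≠ 0) {f g : ℂ → ℂ} (hf : ContinuousAt f a) (hg : ContinuousAt g a)
    (hf0 : f a ≠ 0) (hg0 : g a ≠ 0) : ContinuousAt (fun t => den q (f t) (g t)) a :=
  (continuousAt_σ ((continuousAt_const.mul hf).mul hg) (by dsimp; positivity)).mul
    (continuousAt_σ ((continuousAt_const.mul (hf.inv₀ hf0)).mul (hg.inv₀ hg0))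
      (by dsimp; positivity))

theorem continuousAt_bulkWeight (hq : q ≠ 0) {f : ℂ → ℂ} (hf : ContinuousAt f a) (hf0 : f a ≠ 0)
    (l b r t : Bool) : ContinuousAt (fun x => bulkWeight q (f x) l b r t) a := by
  unfold bulkWeight
  split_ifs
  · exact continuousAt_const
  · exact (continuousAt_σ (continuousAt_const.mul hf) (by dsimp; positivity)).div_const _
  · exact (continuousAt_σ (continuousAt_const.mul (hf.inv₀ hf0)) (by dsimp; positivity)).div_const _
  · exact continuousAt_const

theorem continuousAt_Z (hq : q ≠ 0) (hv : ∀ j, ContinuousAt (fun t => v t j) a)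
    (h0 : ∀ j, v a j ≠ 0) : ContinuousAt (fun t => Z n q (v t)) a := by
  unfold Z
  refine tendsto_finsetSum _ fun C _ => continuousAt_prod fun i _ => ?_
  refine (ContinuousAt.mul ?_ (continuousAt_prod fun j _ =>
    continuousAt_bulkWeight hq ((hv _).mul (hv _)) (mul_ne_zero (h0 _) (h0 _)) _ _ _ _)).mul ?_
  · unfold leftWeight
    split_ifs
    · have := h0 i
      exact (continuousAt_σ (continuousAt_const.mul (hv i)) (by dsimp; positivity)).div_const _
    · exact continuousAt_const
  · unfold rightWeight
    split_ifs
    · have := h0 i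
      exact (continuousAt_σ (continuousAt_const.mul ((hv i).inv₀ this))
        (by dsimp; positivity)).div_const _
    · exact continuousAt_const

theorem continuousAt_prefactor (hq : q ≠ 0) (hv : ∀ j, ContinuousAt (fun t => v t j) a)
    (h0 : ∀ j, v a j ≠ 0)
    (hs : ∀ i ∈ Finset.Icc 1 n, ∀ j ∈ Finset.Icc 1 n, i < j → σ (v a i * (v a j)⁻¹) ≠ 0) :
    ContinuousAt (fun t => prefactor n q (v t)) a := by
  unfold prefactor
  refine (continuousAt_const.mul (continuousAt_prod fun i _ => ?_)).mul
    (continuousAt_prod fun i hi => continuousAt_prod fun j hj => ?_)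
  · have := h0 i
    exact ((continuousAt_σ (hv i) this).mul
      (continuousAt_σ (continuousAt_const.mul (hv i)) (by dsimp; positivity))).mul
      (continuousAt_σ (continuousAt_const.mul ((hv i).inv₀ this)) (by dsimp; positivity))
  · rw [Finset.mem_Icc] at hi hj
    exact ((continuousAt_den hq (hv i) (hv j) (h0 i) (h0 j)).div
      (continuousAt_σ ((hv i).mul ((hv j).inv₀ (h0 j))) (mul_ne_zero (h0 i) (inv_ne_zero (h0 j))))
      (hs i (Finset.mem_Icc.2 (by omega)) j (Finset.mem_Icc.2 (by omega)) (by omega))).pow 2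

theorem continuousAt_det_kernel (hq : q ≠ 0) (hv : ∀ j, ContinuousAt (fun t => v t j) a)
    (h0 : ∀ j, v a j ≠ 0) (h1 : ∀ i ∈ Finset.Icc 1 (n + 1), v a i ^ 2 ≠ 1)
    (hd : ∀ i ∈ Finset.Icc 1 n, ∀ j ∈ Finset.Icc 1 (n + 1), den q (v a i) (v a j) ≠ 0) :
    ContinuousAt (fun t => (kernel n q (v t)).det) a := by
  refine ContinuousAt.comp (g := Matrix.det) (f := fun t => kernel n q (v t))
    (continuous_id.matrix_det).continuousAt
    (continuousAt_pi.2 fun r => continuousAt_pi.2 fun c => ?_)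
  have hc : c.val + 1 ∈ Finset.Icc 1 (n + 1) := Finset.mem_Icc.2 (by omega)
  simp only [kernel, kernelColumn, Matrix.of_apply]
  split_ifs with h
  · refine ContinuousAt.div ?_ (continuousAt_den hq (hv _) (hv _) (h0 _) (h0 _))
      (hd _ (Finset.mem_Icc.2 (by omega)) _ hc)
    exact (continuousAt_const.add ((hv _).pow 2)).add (((hv _).inv₀ (h0 _)).pow 2)
  · exact (((hv _).pow 2).sub continuousAt_const).inv₀ (sub_ne_zero.2 (h1 _ hc))

theorem continuousAt_determinantFormula (hq : q ≠ 0) (hv : ∀ j, ContinuousAt (fun t => v t j) a)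
    (h0 : ∀ j, v a j ≠ 0) (h1 : ∀ i ∈ Finset.Icc 1 (n + 1), v a i ^ 2 ≠ 1)
    (hs : ∀ i ∈ Finset.Icc 1 (n + 1), ∀ j ∈ Finset.Icc 1 (n + 1), i < j →
      σ (v a i * (v a j)⁻¹) ≠ 0)
    (hd : ∀ i ∈ Finset.Icc 1 n, ∀ j ∈ Finset.Icc 1 (n + 1), den q (v a i) (v a j) ≠ 0) :
    ContinuousAt (fun t => determinantFormula n q (v t)) a := by
  have hI : ∀ i ∈ Finset.Icc 1 n, i ∈ Finset.Icc 1 (n + 1) := fun i hi => by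
    rw [Finset.mem_Icc] at hi ⊢; omega
  refine ((continuousAt_prefactor hq hv h0 fun i hi j hj => hs i (hI i hi) j (hI j hj)).mul
    (continuousAt_prod fun i hi => ?_)).mul
    ((((hv _).sub continuousAt_const).mul (continuousAt_det_kernel hq hv h0 h1 hd)).add
      ((((hv _).inv₀ (h0 _)).sub continuousAt_const).mul
        (continuousAt_det_kernel (v := fun t => (v t)⁻¹) hq (fun j => (hv j).inv₀ (h0 j))
          (fun j => inv_ne_zero (h0 j)) (fun i hi h => h1 i hi (by simpa using h))
          fun i hi j hj => ?_)))
  · rw [Finset.mem_Icc] at hi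
    exact (continuousAt_den hq (hv i) (hv _) (h0 i) (h0 _)).div
      (continuousAt_σ ((hv i).mul ((hv _).inv₀ (h0 _))) (mul_ne_zero (h0 i) (inv_ne_zero (h0 _))))
      (hs i (Finset.mem_Icc.2 (by omega)) _ (Finset.mem_Icc.2 (by omega)) (by omega))
  · rw [Pi.inv_apply, Pi.inv_apply, den_inv]
    exact hd i hi j hj

end

/-- Both sides of the formula are continuous along the curve `u_j t^j`, so the formula extends from
generic parameters to all parameters for which it makes sense. -/
theorem Z_eq_determinantFormula (hq : q ≠ 0) (hq4 : σ (q ^ 4) ≠ 0) (h0 : ∀ j, u j ≠ 0)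
    (h1 : ∀ i ∈ Finset.Icc 1 (n + 1), u i ^ 2 ≠ 1)
    (hs : ∀ i ∈ Finset.Icc 1 (n + 1), ∀ j ∈ Finset.Icc 1 (n + 1), i < j →
      σ (u i * (u j)⁻¹) ≠ 0)
    (hd : ∀ i ∈ Finset.Icc 1 n, ∀ j ∈ Finset.Icc 1 (n + 1), den q (u i) (u j) ≠ 0) :
    Z n q u = determinantFormula n q u := by
  let v : ℂ → ℕ → ℂ := fun t j => u j * t ^ j
  have hv1 : v 1 = u := by ext j; simp [v]
  have hv : ∀ j, ContinuousAt (fun t => v t j) 1 := fun j => by fun_prop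
  have hZ := (continuousAt_Z (n := n) hq hv (by rwa [hv1])).mono_left
    (nhdsWithin_le_nhds (s := {1}ᶜ))
  have hF := (continuousAt_determinantFormula (n := n) hq hv (by rwa [hv1]) (by rwa [hv1])
    (by rwa [hv1]) (by rwa [hv1])).mono_left (nhdsWithin_le_nhds (s := {1}ᶜ))
  simp only [hv1] at hZ hF
  refine tendsto_nhds_unique (hZ.congr' ?_) hF
  filter_upwards [eventually_generic hq hq4 h0 (n := n + 1)] with t ht
  exact Z_eq_of_generic hq hq4 n ht

theorem Z_congr (h : ∀ i ∈ Finset.Icc 1 (n + 1), u i = v i) : Z n q u = Z n q v := by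
  rw [Z_eq_amplitude, Z_eq_amplitude]
  exact amplitude_congr fun j hj => h _ (Finset.mem_Icc.2 (by omega))

theorem kernel_congr (h : ∀ i ∈ Finset.Icc 1 (n + 1), u i = v i) : kernel n q u = kernel n q v := by
  ext r c
  rw [kernel, kernel, Matrix.of_apply, Matrix.of_apply, h _ (Finset.mem_Icc.2 (by omega)),
    kernelColumn_congr fun k hk => h k (by rw [Finset.mem_Icc] at hk ⊢; omega)]

theorem determinantFormula_congr (h : ∀ i ∈ Finset.Icc 1 (n + 1), u i = v i) :
    determinantFormula n q u = determinantFormula n q v := by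
  have hI : ∀ i ∈ Finset.Icc 1 n, u i = v i := fun i hi =>
    h i (by rw [Finset.mem_Icc] at hi ⊢; omega)
  rw [determinantFormula, determinantFormula, prefactor_congr hI, kernel_congr h,
    kernel_congr (u := u⁻¹) (v := v⁻¹) fun i hi => congrArg Inv.inv (h i hi),
    h (n + 1) (Finset.mem_Icc.2 (by omega)),
    Finset.prod_congr rfl fun i hi => by rw [hI i hi]]

theorem det_scale_last (c : ℂ) (A : Matrix (Fin (n + 1)) (Fin (n + 1)) ℂ) :
    (Matrix.of fun r s => (if r.val + 1 ≤ n then 1 else c) * A r s).det = c * A.det := by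
  rw [Matrix.det_mul_column, Fin.prod_univ_castSucc]
  simp

end

end DASASM

theorem mainTheorem3 (n : ℕ) (q : ℂ) (u : ℕ → ℂ)
    (hq : q ≠ 0) (hq4 : DASASM.σ (q ^ 4) ≠ 0)
    (hu : ∀ i ∈ Finset.Icc 1 (n + 1), u i ≠ 0)
    (hu1 : ∀ i ∈ Finset.Icc 1 (n + 1), u i ^ 2 ≠ 1)
    (huu : ∀ i ∈ Finset.Icc 1 (n + 1), ∀ j ∈ Finset.Icc 1 (n + 1), i < j →
      DASASM.σ (u i * (u j)⁻¹) ≠ 0)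
    (hden : ∀ i ∈ Finset.Icc 1 n, ∀ j ∈ Finset.Icc 1 (n + 1),
      DASASM.σ (q ^ 2 * u i * u j) ≠ 0 ∧ DASASM.σ (q ^ 2 * (u i)⁻¹ * (u j)⁻¹) ≠ 0) :
    DASASM.Z n q u =
      DASASM.σ (q ^ 2) ^ n / (DASASM.σ q ^ (2 * n) * DASASM.σ (q ^ 4) ^ (n ^ 2)) *
      (∏ i ∈ Finset.Icc 1 n,
        DASASM.σ (u i) * DASASM.σ (q * u i) * DASASM.σ (q * (u i)⁻¹) *
          DASASM.σ (q ^ 2 * u i * u (n + 1)) * DASASM.σ (q ^ 2 * (u i)⁻¹ * (u (n + 1))⁻¹) /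
          DASASM.σ (u i * (u (n + 1))⁻¹)) *
      (∏ i ∈ Finset.Icc 1 n, ∏ j ∈ Finset.Icc (i + 1) n,
        (DASASM.σ (q ^ 2 * u i * u j) * DASASM.σ (q ^ 2 * (u i)⁻¹ * (u j)⁻¹) /
          DASASM.σ (u i * (u j)⁻¹)) ^ 2) *
      (Matrix.det (Matrix.of fun r c : Fin (n + 1) =>
          if r.val + 1 ≤ n then
            (q ^ 2 + q⁻¹ ^ 2 + u (r.val + 1) ^ 2 + (u (c.val + 1))⁻¹ ^ 2) /
              (DASASM.σ (q ^ 2 * u (r.val + 1) * u (c.val + 1)) * DASASM.σ (q ^ 2 * (u (r.val + 1))⁻¹ * (u (c.val + 1))⁻¹))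
          else (u (n + 1) - 1) / (u (c.val + 1) ^ 2 - 1)) +
        Matrix.det (Matrix.of fun r c : Fin (n + 1) =>
          if r.val + 1 ≤ n then
            (q ^ 2 + q⁻¹ ^ 2 + (u (r.val + 1))⁻¹ ^ 2 + u (c.val + 1) ^ 2) /
              (DASASM.σ (q ^ 2 * u (r.val + 1) * u (c.val + 1)) * DASASM.σ (q ^ 2 * (u (r.val + 1))⁻¹ * (u (c.val + 1))⁻¹))
          else ((u (n + 1))⁻¹ - 1) / ((u (c.val + 1))⁻¹ ^ 2 - 1))) := by
  -- The values of `u` outside `1, …, n + 1` do not matter and are made nonzero.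
  let v : ℕ → ℂ := fun j => if j ∈ Finset.Icc 1 (n + 1) then u j else 1
  have hv : ∀ j ∈ Finset.Icc 1 (n + 1), u j = v j := fun j hj => (if_pos hj).symm
  have hI : ∀ i ∈ Finset.Icc 1 n, i ∈ Finset.Icc 1 (n + 1) := fun i hi => by
    rw [Finset.mem_Icc] at hi ⊢; omega
  have hZ : DASASM.Z n q u = DASASM.determinantFormula n q u := by
    rw [DASASM.Z_congr hv, DASASM.determinantFormula_congr hv]
    refine DASASM.Z_eq_determinantFormula hq hq4 (fun j => ?_) (fun i hi => ?_)
      (fun i hi j hj hij => ?_) fun i hi j hj => ?_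
    · by_cases hj : j ∈ Finset.Icc 1 (n + 1)
      · rw [← hv j hj]; exact hu j hj
      · rw [show v j = 1 from if_neg hj]; exact one_ne_zero
    · rw [← hv i hi]; exact hu1 i hi
    · rw [← hv i hi, ← hv j hj]; exact huu i hi j hj hij
    · rw [← hv i (hI i hi), ← hv j hj]
      exact mul_ne_zero (hden i hi j hj).1 (hden i hi j hj).2
  have h1 := DASASM.det_scale_last (u (n + 1) - 1) (DASASM.kernel n q u)
  have h2 := DASASM.det_scale_last ((u (n + 1))⁻¹ - 1) (DASASM.kernel n q u⁻¹)
  have h3 : ∏ i ∈ Finset.Icc 1 n,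
      DASASM.σ (u i) * DASASM.σ (q * u i) * DASASM.σ (q * (u i)⁻¹) *
          DASASM.σ (q ^ 2 * u i * u (n + 1)) * DASASM.σ (q ^ 2 * (u i)⁻¹ * (u (n + 1))⁻¹) /
          DASASM.σ (u i * (u (n + 1))⁻¹) =
      (∏ i ∈ Finset.Icc 1 n, DASASM.σ (u i) * DASASM.σ (q * u i) * DASASM.σ (q * (u i)⁻¹)) *
        ∏ i ∈ Finset.Icc 1 n, DASASM.den q (u i) (u (n + 1)) / DASASM.σ (u i * (u (n + 1))⁻¹) := by
    rw [← Finset.prod_mul_distrib]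
    refine Finset.prod_congr rfl fun i _ => ?_
    rw [DASASM.den]
    ring
  rw [hZ, DASASM.determinantFormula, DASASM.prefactor, ← h1, ← h2, h3, ← mul_assoc,
    mul_right_comm _ _ (∏ i ∈ Finset.Icc 1 n, DASASM.den q (u i) (u (n + 1)) / _)]
  congr 3
  · ext r c
    simp only [DASASM.kernel, DASASM.kernelColumn, Matrix.of_apply, DASASM.num, DASASM.den]
    split_ifs
    · rw [one_mul]
    · rw [div_eq_mul_inv]
  · ext r c
    simp only [DASASM.kernel, DASASM.kernelColumn, Matrix.of_apply, Pi.inv_apply, DASASM.den_inv]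
    simp only [DASASM.num, DASASM.den, inv_inv]
    split_ifs
    · rw [one_mul]
    · rw [div_eq_mul_inv]
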